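/- A *locally Hermitian symmetric space* $(M,J,h)$ is a Kähler manifold ($J$ an integrable almost complex structure, $h$ a $J$-invariant Riemannian metric, the form $\omega(X,Y)=h(JX,Y)$ closed) whose curvature tensor $R(X,Y)Z=\nabla_X\nabla_YZ-\nabla_Y\nabla_XZ-\nabla_{[X,Y]}Z$ is parallel, $\nabla R=0$, where $\nabla$ is the Levi-Civita connection. **Corollary 3.5.** Let $N=M_1\times\cdots\times M_n$ with the product metric $h$ and the product complex structure $J$, where each $(M_i,J_i,h^i)$ is a locally Hermitian symmetric space satisfying $$h^i\big(R^i(Y,X)X,\;R^i(X,J_iX)J_iX\big)=0$$ for all tangent vectors $X,Y$ at all points of $M_i$, $R^i$ being the Riemann curvature of $M_i$. Let $\alpha,\beta>0$, $0<T\le\infty$, and let $u:S^1\times(0,T)\to N$ be a smooth solution of the Schrödinger–Airy (Hirota) geometric flow $$u_t=\alpha J_u\nabla_xu_x+\beta\Big(\nabla_x^2u_x+\tfrac12R(u_x,J_uu_x)J_uu_x\Big),$$ where $S^1$ is the unit circle with arc length parameter $x$, $R$ is the curvature of $N$ and $\nabla_x$ is the covariant derivative on $u^{-1}TN$ induced by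 the Levi-Civita connection of $N$. Then $$E_3(u)=\int_{S^1}h(\nabla_xu_x,\nabla_xu_x)\,dx-\frac14\int_{S^1}h\big(u_x,R(u_x,Ju_x)Ju_x\big)\,dx$$ is conserved: $\frac{d}{dt}E_3(u(\cdot,t))=0$ for every $t\in(0,T)$, and hence $E_3(u(\cdot,t))$ is constant on $(0,T)$. -/

import Mathlib

open Set Manifold Bundle
open scoped ContDiff Topology

noncomputable section

namespace SchrodingerAiry

/-! ### Calculus on an open subset of the model vector space

`G y` is the matrix of a metric and `A y` the matrix of an almost complex structure, at the point
with coordinates `y`. -/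

section Coordinates

variable {E : Type*} [NormedAddCommGroup E] [NormedSpace ℝ E]

/-- The Christoffel symbols `Γ_y(v, w)` of the Levi-Civita connection of `G`, by the Koszul formula:
`2 G(Γ(v, w), z) = ∂_v G(w, z) + ∂_w G(v, z) - ∂_z G(v, w)` for all `z`. For constant `w` this is
`∇_v w`. The inverse is that of `G y : E → E*`, which is invertible when `G y` is an inner product
on a finite-dimensional space. -/
def christoffel (G : E → E →L[ℝ] E →L[ℝ] ℝ) (y v w : E) : E :=
  (G y).inverse ((1 / 2 : ℝ) •
    (fderiv ℝ G y v w + fderiv ℝ G y w v - ((fderiv ℝ G y).flip v).flip w))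

/-- The curvature `R(v, w) z = ∇_v ∇_w z - ∇_w ∇_v z` for constant vector fields `v`, `w`, `z`. -/
def curvatureCoord (G : E → E →L[ℝ] E →L[ℝ] ℝ) (y v w z : E) : E :=
  fderiv ℝ (fun y' => christoffel G y' w z) y v - fderiv ℝ (fun y' => christoffel G y' v z) y w
    + christoffel G y v (christoffel G y w z) - christoffel G y w (christoffel G y v z)

/-- The covariant derivative of the curvature tensor, `(∇_a R)(v, w) z`. -/
def nablaCurvatureCoord (G : E → E →L[ℝ] E →L[ℝ] ℝ) (y a v w z : E) : E :=
  fderiv ℝ (fun y' => curvatureCoord G y' v w z) y a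
    + christoffel G y a (curvatureCoord G y v w z)
    - curvatureCoord G y (christoffel G y a v) w z
    - curvatureCoord G y v (christoffel G y a w) z
    - curvatureCoord G y v w (christoffel G y a z)

/-- The Nijenhuis tensor `[A v, A w] - A [A v, w] - A [v, A w] - [v, w]` of the almost complex
structure `A`, for constant vector fields `v`, `w`. -/
def nijenhuisCoord (A : E → E →L[ℝ] E) (y v w : E) : E :=
  VectorField.lieBracket ℝ (fun y' => A y' v) (fun y' => A y' w) y
    - A y (VectorField.lieBracket ℝ (fun y' => A y' v) (fun _ => w) y)
    - A y (VectorField.lieBracket ℝ (fun _ => v) (fun y' => A y' w) y)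
    - VectorField.lieBracket ℝ (fun _ => v) (fun _ => w) y

/-- The exterior derivative `dω(a, b, c)` of the two-form `ω(v, w) = G(A v, w)`. -/
def dKahlerFormCoord (G : E → E →L[ℝ] E →L[ℝ] ℝ) (A : E → E →L[ℝ] E) (y a b c : E) : ℝ :=
  fderiv ℝ (fun y' => G y' (A y' b) c) y a
    - fderiv ℝ (fun y' => G y' (A y' a) c) y b
    + fderiv ℝ (fun y' => G y' (A y' a) b) y c

end Coordinates

/-! ### Manifolds

`TangentSpace I p` is a copy of the model vector space `E`, identified with it through the
preferred chart at `p`; the derivative at `p` of that chart is the identity. -/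

section Manifolds

variable {E : Type*} [NormedAddCommGroup E] [NormedSpace ℝ E]
  {H : Type*} [TopologicalSpace H] (I : ModelWithCorners ℝ E H)
  {M : Type*} [TopologicalSpace M] [ChartedSpace H M]

/-- The metric `g` in the preferred chart at `p`: its pullback by the inverse of that chart. -/
def metricInChart (g : ∀ q : M, TangentSpace I q →L[ℝ] TangentSpace I q →L[ℝ] ℝ) (p : M) (y : E) :
    E →L[ℝ] E →L[ℝ] ℝ :=
  let B : E →L[ℝ] E →L[ℝ] ℝ := g ((extChartAt I p).symm y)
  let D : E →L[ℝ] E := mfderiv 𝓘(ℝ, E) I (extChartAt I p).symm y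
  B.bilinearComp D D

/-- The field of endomorphisms `J` in the preferred chart at `p`. -/
def complexStructureInChart (J : ∀ q : M, TangentSpace I q →L[ℝ] TangentSpace I q) (p : M) (y : E) :
    E →L[ℝ] E :=
  let D : E →L[ℝ] TangentSpace I ((extChartAt I p).symm y) :=
    mfderiv 𝓘(ℝ, E) I (extChartAt I p).symm y
  let D' : TangentSpace I ((extChartAt I p).symm y) →L[ℝ] E :=
    mfderiv I 𝓘(ℝ, E) (extChartAt I p) ((extChartAt I p).symm y)
  D' ∘L J ((extChartAt I p).symm y) ∘L D

/-- The Riemann curvature operator `R(v, w) z = ∇_v ∇_w z - ∇_w ∇_v z - ∇_[v, w] z` of the metric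
`g` at the point `p`. -/
def curvature (g : ∀ q : M, TangentSpace I q →L[ℝ] TangentSpace I q →L[ℝ] ℝ) (p : M)
    (v w z : TangentSpace I p) : TangentSpace I p :=
  curvatureCoord (E := E) (metricInChart I g p) (extChartAt I p p) v w z

/-- The velocity `c'(s)` of a curve `c`. -/
def velocity (c : ℝ → M) (s : ℝ) : TangentSpace I (c s) :=
  mfderiv 𝓘(ℝ, ℝ) I c s (1 : ℝ)

/-- The covariant derivative, at the parameter `s`, of a vector field `V` along a curve `c`, for the
connection on the pullback of the tangent bundle induced by the Levi-Civita connection of `g`. In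
the preferred chart at `c s` it is `V' + Γ(c', V)`. -/
def covDerivAlong (g : ∀ q : M, TangentSpace I q →L[ℝ] TangentSpace I q →L[ℝ] ℝ) (c : ℝ → M)
    (V : ∀ s, TangentSpace I (c s)) (s : ℝ) : TangentSpace I (c s) :=
  deriv (fun s' => (mfderiv I 𝓘(ℝ, E) (extChartAt I (c s)) (c s') (V s') : E)) s
    + christoffel (E := E) (metricInChart I g (c s)) (extChartAt I (c s) (c s)) (velocity I c s) (V s)

variable [IsManifold I ∞ M]

/-- `(M, J, h)` is a Kähler manifold: `J` is a smooth almost complex structure which is integrable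
(its Nijenhuis tensor vanishes) and isometric for the Riemannian metric `h`, and the two-form
`ω(X, Y) = h(J X, Y)` is closed. The tensor identities are required in the preferred charts. -/
structure IsKahler (h : ContMDiffRiemannianMetric I ∞ E (fun p : M => TangentSpace I p))
    (J : ∀ p : M, TangentSpace I p →L[ℝ] TangentSpace I p) : Prop where
  smooth : ContMDiff I (I.prod 𝓘(ℝ, E →L[ℝ] E)) ∞
    (fun p => TotalSpace.mk' (E →L[ℝ] E) (E := fun p : M => TangentSpace I p →L[ℝ] TangentSpace I p)
      p (J p))
  sq_eq_neg : ∀ (p : M) (v : TangentSpace I p), J p (J p v) = -v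
  isometric : ∀ (p : M) (v w : TangentSpace I p), h.inner p (J p v) (J p w) = h.inner p v w
  integrable : ∀ (p : M), ∀ y ∈ (extChartAt I p).target, ∀ v w : E,
    nijenhuisCoord (complexStructureInChart I J p) y v w = 0
  closed : ∀ (p : M), ∀ y ∈ (extChartAt I p).target, ∀ a b c : E,
    dKahlerFormCoord (metricInChart I h.inner p) (complexStructureInChart I J p) y a b c = 0

/-- `(M, J, h)` is a locally Hermitian symmetric space: a Kähler manifold whose curvature tensor is
parallel, `∇ R = 0`. -/
structure IsLocallyHermitianSymmetric
    (h : ContMDiffRiemannianMetric I ∞ E (fun p : M => TangentSpace I p))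
    (J : ∀ p : M, TangentSpace I p →L[ℝ] TangentSpace I p) : Prop extends IsKahler I h J where
  parallel : ∀ (p : M), ∀ y ∈ (extChartAt I p).target, ∀ a v w z : E,
    nablaCurvatureCoord (metricInChart I h.inner p) y a v w z = 0

end Manifolds

/-! ### The flow and the energy

The circle is `Circle`, parametrized by the arc length `x ↦ Circle.exp x`. -/

section Flow

variable {E : Type*} [NormedAddCommGroup E] [NormedSpace ℝ E]
  {H : Type*} [TopologicalSpace H] (I : ModelWithCorners ℝ E H)
  {M : Type*} [TopologicalSpace M] [ChartedSpace H M]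
  (g : ∀ q : M, TangentSpace I q →L[ℝ] TangentSpace I q →L[ℝ] ℝ)
  (J : ∀ q : M, TangentSpace I q →L[ℝ] TangentSpace I q)

/-- The vector field `u_x` along a map `u` from the circle. -/
def ux (u : Circle → M) (x : ℝ) : TangentSpace I (u (Circle.exp x)) :=
  velocity I (fun x' => u (Circle.exp x')) x

/-- `∇_x u_x`. -/
def nablaUx (u : Circle → M) (x : ℝ) : TangentSpace I (u (Circle.exp x)) :=
  covDerivAlong I g (fun x' => u (Circle.exp x')) (ux I u) x

/-- `∇_x ∇_x u_x`. -/
def nablaSqUx (u : Circle → M) (x : ℝ) : TangentSpace I (u (Circle.exp x)) :=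
  covDerivAlong I g (fun x' => u (Circle.exp x')) (nablaUx I g u) x

/-- `R(u_x, J u_x) J u_x`. -/
def curvUx (u : Circle → M) (x : ℝ) : TangentSpace I (u (Circle.exp x)) :=
  curvature I g (u (Circle.exp x)) (ux I u x) (J _ (ux I u x)) (J _ (ux I u x))

/-- `E₃(u) = ∫ g(∇_x u_x, ∇_x u_x) dx - (1/4) ∫ g(u_x, R(u_x, J u_x) J u_x) dx`. -/
def energy3 (u : Circle → M) : ℝ :=
  (∫ x in (0 : ℝ)..(2 * Real.pi), g (u (Circle.exp x)) (nablaUx I g u x) (nablaUx I g u x))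
    - (1 / 4) * ∫ x in (0 : ℝ)..(2 * Real.pi), g (u (Circle.exp x)) (ux I u x) (curvUx I g J u x)

/-- The open time interval `(0, T)`; `T` may be infinite. -/
def timeInterval (T : EReal) : Set ℝ := {t | 0 < t ∧ (t : EReal) < T}

/-- `u : S¹ × (0, T) → M` is a smooth solution of the geometric Schrödinger-Airy (Hirota) flow
`u_t = α J ∇_x u_x + β (∇_x² u_x + (1/2) R(u_x, J u_x) J u_x)`. -/
structure IsSmoothSolution (α β : ℝ) (T : EReal) (u : Circle → ℝ → M) : Prop where
  smooth : ContMDiffOn ((𝓡 1).prod 𝓘(ℝ, ℝ)) I ∞ (fun z : Circle × ℝ => u z.1 z.2)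
    (univ ×ˢ timeInterval T)
  eqn : ∀ t ∈ timeInterval T, ∀ x : ℝ,
    velocity I (fun t' => u (Circle.exp x) t') t =
      α • J _ (nablaUx I g (fun ξ => u ξ t) x)
        + β • (nablaSqUx I g (fun ξ => u ξ t) x + (1 / 2 : ℝ) • curvUx I g J (fun ξ => u ξ t) x)

end Flow

/-! ### Product manifolds -/

section Product

variable {n : ℕ} {E : Fin n → Type*} [∀ i, NormedAddCommGroup (E i)] [∀ i, NormedSpace ℝ (E i)]
  {M : Fin n → Type*} [∀ i, TopologicalSpace (M i)] [∀ i, ChartedSpace (E i) (M i)]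

/-- The model of the product of manifolds modelled on the vector spaces `E i`. The tangent space at
`p` of the product is the product of the tangent spaces at the `p i`. -/
abbrev productModel (E : Fin n → Type*) [∀ i, NormedAddCommGroup (E i)]
    [∀ i, NormedSpace ℝ (E i)] : ModelWithCorners ℝ (∀ i, E i) (ModelPi E) :=
  ModelWithCorners.pi fun i => 𝓘(ℝ, E i)

/-- The product metric `h(v, w) = ∑ᵢ hⁱ(vᵢ, wᵢ)`. -/
def productMetric
    (g : ∀ i, ∀ q : M i, TangentSpace 𝓘(ℝ, E i) q →L[ℝ] TangentSpace 𝓘(ℝ, E i) q →L[ℝ] ℝ)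
    (p : ∀ i, M i) :
    TangentSpace (productModel E) p →L[ℝ] TangentSpace (productModel E) p →L[ℝ] ℝ :=
  let B : ∀ i, E i →L[ℝ] E i →L[ℝ] ℝ := fun i => g i (p i)
  let S : (∀ i, E i) →L[ℝ] (∀ i, E i) →L[ℝ] ℝ :=
    ∑ i, (B i).bilinearComp (ContinuousLinearMap.proj i) (ContinuousLinearMap.proj i)
  S

/-- The product complex structure `(J v)ᵢ = Jᵢ vᵢ`. -/
def productComplexStructure
    (J : ∀ i, ∀ q : M i, TangentSpace 𝓘(ℝ, E i) q →L[ℝ] TangentSpace 𝓘(ℝ, E i) q)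
    (p : ∀ i, M i) :
    TangentSpace (productModel E) p →L[ℝ] TangentSpace (productModel E) p :=
  let A : ∀ i, E i →L[ℝ] E i := fun i => J i (p i)
  let S : (∀ i, E i) →L[ℝ] (∀ i, E i) :=
    ContinuousLinearMap.pi fun i => (A i).comp (ContinuousLinearMap.proj i)
  S

end Product

end SchrodingerAiry

end

/-! On one factor write X = u_x, V = u_t, S = R(X, JX)JX and W = ∇_x²X + S/2, so the flow reads V =
αJ∇_xX + βW. The density e = |∇_xX|² − ¼⟨X, S⟩ obeys a pointwise conservation law ∂_t e = ∂_x q with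
an explicit flux q, and integrating over a period of x removes q.

To find q: since ∇R = 0 and ∇J = 0, commuting ∇_t past ∇_x gives ∂_t e = 2⟨∇_x²V + R(V, X)X, ∇_xX⟩ −
⟨∇_xV, S⟩ (`fderiv_coordDensity`). Moving the x-derivatives off V leaves, up to an x-derivative,
2⟨V, ∇_xW + R(∇_xX, X)X⟩. Now insert the flow. The β part is ∂_x|W|² + ∂_x⟨R(∇_xX, X)X, ∇_xX⟩ + ⟨S,
R(∇_xX, X)X⟩, and the last term is zero by the curvature hypothesis with Y = ∇_xX; this is its only
use. The α part is ∂_x of 2⟨J∇_xX, ∇_x²X⟩ plus ⟨J∇_xX, ∇_xS⟩ + 2⟨J∇_xX, R(∇_xX, X)X⟩, which vanishes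
by the Kähler symmetries of R (`inner_schrodinger_term`). The two parts meet in
`fderiv_coordDensity_eq_fderiv_coordFlux`. That ∇J = 0 is itself derived from integrability and dω =
0 (`nabla_endo_eq_zero`).

The computation takes place in one fixed chart, whereas a tangent vector at q is by definition read
in the preferred chart at q. The naturality of ∇ and R under changes of charts (`IsLocalIsometryOn`)
bridges the two. For the product, the Koszul formula splits as a sum, so ∇, R and the flow decouple
(`fieldUt_component`) and the energy is the integral of the sum of the densities of the factors
(`energy3_product`). -/

namespace SchrodingerAiry

set_option maxSynthPendingDepth 3
set_option synthInstance.maxHeartbeats 100000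

/-! ### Levi-Civita calculus of a metric on an open set -/

section LocalGeometry

variable {E : Type*} [NormedAddCommGroup E] [NormedSpace ℝ E]
  {P : Type*} [NormedAddCommGroup P] [NormedSpace ℝ P]

/-- `G` is a smooth Riemannian metric on the open set `O`. -/
structure IsMetricOn (G : E → E →L[ℝ] E →L[ℝ] ℝ) (O : Set E) : Prop where
  isOpen : IsOpen O
  smooth : ContDiffOn ℝ ∞ G O
  symm : ∀ y ∈ O, ∀ v w, G y v w = G y w v
  pos : ∀ y ∈ O, ∀ v, v ≠ 0 → 0 < G y v v

/-- The right-hand side of the Koszul formula, as a bounded bilinear map. -/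
noncomputable def koszulForm (G : E → E →L[ℝ] E →L[ℝ] ℝ) (y : E) : E →L[ℝ] E →L[ℝ] E →L[ℝ] ℝ :=
  fderiv ℝ G y + (fderiv ℝ G y).flip
    - (ContinuousLinearMap.flipₗᵢ ℝ E E ℝ).toContinuousLinearEquiv.toContinuousLinearMap ∘L
        (fderiv ℝ G y).flip

/-- The Christoffel symbols as a bounded bilinear map. -/
noncomputable def christoffelMap (G : E → E →L[ℝ] E →L[ℝ] ℝ) (y : E) : E →L[ℝ] E →L[ℝ] E :=
  (ContinuousLinearMap.compL ℝ E (E →L[ℝ] ℝ) E (G y).inverse) ∘L ((1 / 2 : ℝ) • koszulForm G y)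

/-- The bundled form is the one that gets differentiated: the product rule for continuous linear
maps then handles the base point and both slots. -/
theorem christoffelMap_apply (G : E → E →L[ℝ] E →L[ℝ] ℝ) (y v w : E) :
    christoffelMap G y v w = christoffel G y v w := by
  simp only [christoffelMap, christoffel, ContinuousLinearMap.comp_apply,
    ContinuousLinearMap.compL_apply]
  congr 1

theorem ContDiffOn.fderiv_of_isOpen_infty {F : Type*} [NormedAddCommGroup F] [NormedSpace ℝ F]
    {f : P → F} {Ω : Set P} (hf : ContDiffOn ℝ ∞ f Ω) (hΩ : IsOpen Ω) :
    ContDiffOn ℝ ∞ (fderiv ℝ f) Ω :=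
  hf.fderiv_of_isOpen hΩ (by simp)

theorem ContDiffOn.differentiableAt_infty {F : Type*} [NormedAddCommGroup F] [NormedSpace ℝ F]
    {f : P → F} {Ω : Set P} (hf : ContDiffOn ℝ ∞ f Ω) (hΩ : IsOpen Ω) {z : P} (hz : z ∈ Ω) :
    DifferentiableAt ℝ f z :=
  (hf.contDiffAt (hΩ.mem_nhds hz)).differentiableAt (by simp)

theorem fderiv_fderiv_comm {F : Type*} [NormedAddCommGroup F] [NormedSpace ℝ F]
    {f : P → F} {Ω : Set P} (hf : ContDiffOn ℝ ∞ f Ω) (hΩ : IsOpen Ω) {z : P} (hz : z ∈ Ω)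
    (a b : P) : fderiv ℝ (fderiv ℝ f) z a b = fderiv ℝ (fderiv ℝ f) z b a :=
  (hf.contDiffAt (hΩ.mem_nhds hz)).isSymmSndFDerivAt (by simp; exact WithTop.coe_le_coe.2 (le_top : (2 : ℕ∞) ≤ ⊤)) a b

theorem fderiv_apply_apply {F : Type*} [NormedAddCommGroup F] [NormedSpace ℝ F]
    {L : P → E →L[ℝ] F} {v : P → E} {z : P} (hL : DifferentiableAt ℝ L z)
    (hv : DifferentiableAt ℝ v z) (a : P) :
    fderiv ℝ (fun z => L z (v z)) z a = fderiv ℝ L z a (v z) + L z (fderiv ℝ v z a) := by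
  rw [fderiv_clm_apply hL hv]
  simp [add_comm]

theorem fderiv_apply_apply₂ {E' F : Type*} [NormedAddCommGroup E'] [NormedSpace ℝ E']
    [NormedAddCommGroup F] [NormedSpace ℝ F]
    {B : P → E →L[ℝ] E' →L[ℝ] F} {v : P → E} {w : P → E'} {z : P} (hB : DifferentiableAt ℝ B z)
    (hv : DifferentiableAt ℝ v z) (hw : DifferentiableAt ℝ w z) (a : P) :
    fderiv ℝ (fun z => B z (v z) (w z)) z a =
      fderiv ℝ B z a (v z) (w z) + B z (fderiv ℝ v z a) (w z) + B z (v z) (fderiv ℝ w z a) := by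
  rw [fderiv_apply_apply (hB.clm_apply hv) hw, fderiv_apply_apply hB hv]
  simp

theorem fderiv_comp_apply' {F : Type*} [NormedAddCommGroup F] [NormedSpace ℝ F]
    {f : E → F} {u : P → E} {z : P} (hf : DifferentiableAt ℝ f (u z))
    (hu : DifferentiableAt ℝ u z) (a : P) :
    fderiv ℝ (fun z => f (u z)) z a = fderiv ℝ f (u z) (fderiv ℝ u z a) := by
  have := fderiv_comp z hf hu
  rw [show (fun z => f (u z)) = f ∘ u from rfl, this]
  rfl

/-- The covariant derivative in direction `a` of a vector field `V` along a map `F`. -/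
noncomputable def covDeriv (G : E → E →L[ℝ] E →L[ℝ] ℝ) (F V : P → E) (a : P) (z : P) : E :=
  fderiv ℝ V z a + christoffel G (F z) (fderiv ℝ F z a) (V z)

namespace IsMetricOn

variable {G : E → E →L[ℝ] E →L[ℝ] ℝ} {O : Set E}

section

variable (hG : IsMetricOn G O)
include hG

theorem differentiableAt {y : E} (hy : y ∈ O) : DifferentiableAt ℝ G y :=
  ContDiffOn.differentiableAt_infty hG.smooth hG.isOpen hy

theorem fderiv_symm {y : E} (hy : y ∈ O) (a v w : E) :
    fderiv ℝ G y a v w = fderiv ℝ G y a w v := by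
  have h : (fun y => G y v w) =ᶠ[𝓝 y] fun y => G y w v := by
    filter_upwards [hG.isOpen.mem_nhds hy] with y' hy' using hG.symm y' hy' v w
  have h2 := congrArg (fun L : E →L[ℝ] ℝ => L a) (h.fderiv_eq (𝕜 := ℝ))
  rw [fderiv_apply_apply₂ (hG.differentiableAt hy) (by fun_prop) (by fun_prop),
    fderiv_apply_apply₂ (hG.differentiableAt hy) (by fun_prop) (by fun_prop)] at h2
  simpa using h2

variable [FiniteDimensional ℝ E]

/-- Positivity makes `G y` injective, and E* has the dimension of E. Hence the `inverse` inside
`christoffel` is a true inverse and not the default value 0. -/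
theorem exists_equiv {y : E} (hy : y ∈ O) : ∃ e : E ≃L[ℝ] (E →L[ℝ] ℝ), (e : E →L[ℝ] E →L[ℝ] ℝ) = G y := by
  have hinj : Function.Injective (G y : E →ₗ[ℝ] (E →L[ℝ] ℝ)) := by
    change Function.Injective (G y)
    rw [injective_iff_map_eq_zero]
    intro v h0
    by_contra hne
    have := hG.pos y hy v hne
    simp [h0] at this
  have hdim : Module.finrank ℝ E = Module.finrank ℝ (E →L[ℝ] ℝ) := by
    rw [← (LinearMap.toContinuousLinearMap : (E →ₗ[ℝ] ℝ) ≃ₗ[ℝ] (E →L[ℝ] ℝ)).finrank_eq]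
    exact (Subspace.dual_finrank_eq (K := ℝ) (V := E)).symm
  refine ⟨(LinearEquiv.ofInjectiveOfFinrankEq _ hinj hdim).toContinuousLinearEquiv, ?_⟩
  ext v w
  rfl

theorem apply_inverse {y : E} (hy : y ∈ O) (φ : E →L[ℝ] ℝ) : G y ((G y).inverse φ) = φ := by
  obtain ⟨e, he⟩ := hG.exists_equiv hy
  rw [← he, ContinuousLinearMap.inverse_equiv]
  simp

omit [FiniteDimensional ℝ E] in
theorem ext_inner {y : E} (hy : y ∈ O) {v w : E} (h : ∀ z, G y v z = G y w z) : v = w := by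
  by_contra hne
  have := hG.pos y hy (v - w) (sub_ne_zero.2 hne)
  simp [h] at this

theorem koszul {y : E} (hy : y ∈ O) (v w z : E) :
    2 * G y (christoffel G y v w) z =
      fderiv ℝ G y v w z + fderiv ℝ G y w v z - fderiv ℝ G y z v w := by
  rw [christoffel, hG.apply_inverse hy]
  simp

theorem christoffel_symm {y : E} (hy : y ∈ O) (v w : E) :
    christoffel G y v w = christoffel G y w v := by
  refine hG.ext_inner hy fun z => ?_
  have h1 := hG.koszul hy v w z
  have h2 := hG.koszul hy w v z
  have h3 := hG.fderiv_symm hy z v w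
  linarith

/-- Metric compatibility: in the sum of the Koszul formulas for (a, v, w) and (a, w, v) the
derivatives along v and w cancel. -/
theorem fderiv_eq {y : E} (hy : y ∈ O) (a v w : E) :
    fderiv ℝ G y a v w = G y (christoffel G y a v) w + G y v (christoffel G y a w) := by
  have h1 := hG.koszul hy a v w
  have h2 := hG.koszul hy a w v
  have h3 := hG.fderiv_symm hy a v w
  have h4 := hG.fderiv_symm hy v a w
  have h5 := hG.fderiv_symm hy w a v
  rw [hG.symm y hy v]
  linarith

omit [FiniteDimensional ℝ E] in
theorem contDiffOn_koszulForm : ContDiffOn ℝ ∞ (koszulForm G) O := by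
  have h1 : ContDiffOn ℝ ∞ (fderiv ℝ G) O := ContDiffOn.fderiv_of_isOpen_infty hG.smooth hG.isOpen
  have h2 : ContDiffOn ℝ ∞ (fun y => (fderiv ℝ G y).flip) O :=
    (ContinuousLinearMap.flipₗᵢ ℝ E E (E →L[ℝ] ℝ)).contDiff.comp_contDiffOn h1
  exact (h1.add h2).sub (contDiffOn_const.clm_comp h2)

/-- The one nonlinear ingredient is operator inversion, which is smooth at invertible operators of a
complete space. -/
theorem contDiffOn_christoffelMap : ContDiffOn ℝ ∞ (christoffelMap G) O := by
  have hc : CompleteSpace E := FiniteDimensional.complete ℝ E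
  have h1 : ContDiffOn ℝ ∞ (fun y => (G y).inverse) O := by
    intro y hy
    obtain ⟨e, he⟩ := hG.exists_equiv hy
    have := contDiffAt_map_inverse (𝕜 := ℝ) (n := ∞) e
    rw [he] at this
    exact this.comp_contDiffWithinAt y (hG.smooth y hy)
  have h2 : ContDiffOn ℝ ∞ (fun y => (1 / 2 : ℝ) • koszulForm G y) O :=
    contDiffOn_const (c := (1 / 2 : ℝ)) |>.smul hG.contDiffOn_koszulForm
  exact ((ContinuousLinearMap.compL ℝ E (E →L[ℝ] ℝ) E).contDiff.comp_contDiffOn h1).clm_comp h2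

theorem differentiableAt_christoffelMap {y : E} (hy : y ∈ O) :
    DifferentiableAt ℝ (christoffelMap G) y :=
  ContDiffOn.differentiableAt_infty hG.contDiffOn_christoffelMap hG.isOpen hy

theorem fderiv_christoffel {y : E} (hy : y ∈ O) (a v w : E) :
    fderiv ℝ (fun y' => christoffel G y' v w) y a = fderiv ℝ (christoffelMap G) y a v w := by
  have := fderiv_apply_apply₂ (B := christoffelMap G) (v := fun _ => v) (w := fun _ => w)
    (hG.differentiableAt_christoffelMap hy) (by fun_prop) (by fun_prop) a
  simpa [← christoffelMap_apply] using this

theorem curvatureCoord_eq {y : E} (hy : y ∈ O) (v w z : E) :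
    curvatureCoord G y v w z =
      fderiv ℝ (christoffelMap G) y v w z - fderiv ℝ (christoffelMap G) y w v z
        + christoffel G y v (christoffel G y w z) - christoffel G y w (christoffel G y v z) := by
  rw [curvatureCoord, hG.fderiv_christoffel hy, hG.fderiv_christoffel hy]

end

/-! ### Covariant derivatives of fields along a map -/

section Along

variable [FiniteDimensional ℝ E] (hG : IsMetricOn G O) {F : P → E} {Ω : Set P} (hΩ : IsOpen Ω)
  (hF : ContDiffOn ℝ ∞ F Ω) (hFO : MapsTo F Ω O)
include hG hΩ hF hFO

omit hΩ in
theorem contDiffOn_christoffel {V W : P → E} (hV : ContDiffOn ℝ ∞ V Ω) (hW : ContDiffOn ℝ ∞ W Ω) :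
    ContDiffOn ℝ ∞ (fun z => christoffel G (F z) (V z) (W z)) Ω := by
  simp only [← christoffelMap_apply]
  exact ((hG.contDiffOn_christoffelMap.comp hF hFO).clm_apply hV).clm_apply hW

omit hΩ [FiniteDimensional ℝ E] in
theorem contDiffOn_inner {V W : P → E} (hV : ContDiffOn ℝ ∞ V Ω) (hW : ContDiffOn ℝ ∞ W Ω) :
    ContDiffOn ℝ ∞ (fun z => G (F z) (V z) (W z)) Ω :=
  ((hG.smooth.comp hF hFO).clm_apply hV).clm_apply hW

omit hG hFO [FiniteDimensional ℝ E] in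
theorem contDiffOn_fderiv_apply (a : P) : ContDiffOn ℝ ∞ (fun z => fderiv ℝ F z a) Ω :=
  (ContDiffOn.fderiv_of_isOpen_infty hF hΩ).clm_apply contDiffOn_const

theorem contDiffOn_covDeriv {V : P → E} (hV : ContDiffOn ℝ ∞ V Ω) (a : P) :
    ContDiffOn ℝ ∞ (covDeriv G F V a) Ω :=
  ((ContDiffOn.fderiv_of_isOpen_infty hV hΩ).clm_apply contDiffOn_const).add
    (hG.contDiffOn_christoffel hF hFO
      ((ContDiffOn.fderiv_of_isOpen_infty hF hΩ).clm_apply contDiffOn_const) hV)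

omit hΩ in
theorem contDiffOn_curvature {V W Z : P → E} (hV : ContDiffOn ℝ ∞ V Ω)
    (hW : ContDiffOn ℝ ∞ W Ω) (hZ : ContDiffOn ℝ ∞ Z Ω) :
    ContDiffOn ℝ ∞ (fun z => curvatureCoord G (F z) (V z) (W z) (Z z)) Ω := by
  have h1 : ContDiffOn ℝ ∞ (fun z => fderiv ℝ (christoffelMap G) (F z)) Ω :=
    (ContDiffOn.fderiv_of_isOpen_infty hG.contDiffOn_christoffelMap hG.isOpen).comp hF hFO
  have hc := fun {V W : P → E} => hG.contDiffOn_christoffel hF hFO (V := V) (W := W)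
  refine ContDiffOn.congr (((((h1.clm_apply hV).clm_apply hW).clm_apply hZ).sub
    (((h1.clm_apply hW).clm_apply hV).clm_apply hZ)).add (hc hV (hc hW hZ)) |>.sub
      (hc hW (hc hV hZ))) fun z hz => hG.curvatureCoord_eq (hFO hz) _ _ _

/-- The Levi-Civita connection is metric. -/
theorem fderiv_inner {V W : P → E} (hV : ContDiffOn ℝ ∞ V Ω) (hW : ContDiffOn ℝ ∞ W Ω) {z : P}
    (hz : z ∈ Ω) (a : P) : fderiv ℝ (fun z => G (F z) (V z) (W z)) z a =
      G (F z) (covDeriv G F V a z) (W z) + G (F z) (V z) (covDeriv G F W a z) := by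
  have hFz := ContDiffOn.differentiableAt_infty hF hΩ hz
  have hGz := hG.differentiableAt (hFO hz)
  rw [fderiv_apply_apply₂ (B := fun z => G (F z)) (hGz.comp z hFz)
    (ContDiffOn.differentiableAt_infty hV hΩ hz) (ContDiffOn.differentiableAt_infty hW hΩ hz),
    fderiv_comp_apply' hGz hFz, hG.fderiv_eq (hFO hz)]
  simp only [covDeriv, map_add, _root_.add_apply]
  ring

/-- The Levi-Civita connection is torsion free. -/
theorem covDeriv_fderiv_comm {z : P} (hz : z ∈ Ω) (a b : P) :
    covDeriv G F (fun z => fderiv ℝ F z b) a z = covDeriv G F (fun z => fderiv ℝ F z a) b z := by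
  have hd := ContDiffOn.differentiableAt_infty (ContDiffOn.fderiv_of_isOpen_infty hF hΩ) hΩ hz
  rw [covDeriv, covDeriv, fderiv_apply_apply hd (by fun_prop), fderiv_apply_apply hd (by fun_prop),
    fderiv_fderiv_comm hF hΩ hz, hG.christoffel_symm (hFO hz)]
  simp

/-- The Ricci identity. Second derivatives of `F` and `V` are symmetric in a, b and drop out, as do
the products of Γ with first derivatives of `V`; the derivative of Γ and its quadratic terms remain.
There is no bracket term because constant directions commute. Later curvature identities rest on
this formula. -/
theorem covDeriv_covDeriv_sub {V : P → E} (hV : ContDiffOn ℝ ∞ V Ω) {z : P} (hz : z ∈ Ω)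
    (a b : P) :
    covDeriv G F (covDeriv G F V b) a z - covDeriv G F (covDeriv G F V a) b z =
      curvatureCoord G (F z) (fderiv ℝ F z a) (fderiv ℝ F z b) (V z) := by
  have hFz := ContDiffOn.differentiableAt_infty hF hΩ hz
  have hVz := ContDiffOn.differentiableAt_infty hV hΩ hz
  have hF' := ContDiffOn.differentiableAt_infty (ContDiffOn.fderiv_of_isOpen_infty hF hΩ) hΩ hz
  have hV' := ContDiffOn.differentiableAt_infty (ContDiffOn.fderiv_of_isOpen_infty hV hΩ) hΩ hz
  have hΓ := hG.differentiableAt_christoffelMap (hFO hz)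
  have key : ∀ a b : P, fderiv ℝ (covDeriv G F V b) z a =
      fderiv ℝ (fderiv ℝ V) z a b
        + (fderiv ℝ (christoffelMap G) (F z) (fderiv ℝ F z a) (fderiv ℝ F z b) (V z)
          + christoffelMap G (F z) (fderiv ℝ (fderiv ℝ F) z a b) (V z)
          + christoffelMap G (F z) (fderiv ℝ F z b) (fderiv ℝ V z a)) := by
    intro a b
    have h1 : covDeriv G F V b = fun z => fderiv ℝ V z b +
        christoffelMap G (F z) (fderiv ℝ F z b) (V z) := by
      funext z; rw [covDeriv, christoffelMap_apply]
    have h2 : DifferentiableAt ℝ (fun z => fderiv ℝ F z b) z := hF'.clm_apply (by fun_prop)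
    have h3 : DifferentiableAt ℝ (fun z => fderiv ℝ V z b) z := hV'.clm_apply (by fun_prop)
    have h4 : DifferentiableAt ℝ (fun z => christoffelMap G (F z)) z := hΓ.comp z hFz
    rw [h1, fderiv_fun_add h3 ((h4.clm_apply h2).clm_apply hVz), _root_.add_apply,
      fderiv_apply_apply₂ h4 h2 hVz, fderiv_comp_apply' hΓ hFz,
      fderiv_apply_apply hF' (by fun_prop), fderiv_apply_apply hV' (by fun_prop)]
    simp
  rw [covDeriv.eq_1 G F (covDeriv G F V b), covDeriv.eq_1 G F (covDeriv G F V a), key, key,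
    hG.curvatureCoord_eq (hFO hz), fderiv_fderiv_comm hF hΩ hz b a,
    fderiv_fderiv_comm hV hΩ hz b a]
  simp only [covDeriv, ← christoffelMap_apply, map_add]
  abel

end Along

end IsMetricOn

end LocalGeometry

end SchrodingerAiry

namespace SchrodingerAiry

set_option maxSynthPendingDepth 3
set_option synthInstance.maxHeartbeats 100000

/-! ### Symmetries of the curvature tensor -/

section LocalCurvature

variable {E : Type*} [NormedAddCommGroup E] [NormedSpace ℝ E]
  {P : Type*} [NormedAddCommGroup P] [NormedSpace ℝ P]

theorem fderiv_apply_apply₃ {E₁ E₂ E₃ F : Type*} [NormedAddCommGroup E₁] [NormedSpace ℝ E₁]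
    [NormedAddCommGroup E₂] [NormedSpace ℝ E₂] [NormedAddCommGroup E₃] [NormedSpace ℝ E₃]
    [NormedAddCommGroup F] [NormedSpace ℝ F]
    {B : P → E₁ →L[ℝ] E₂ →L[ℝ] E₃ →L[ℝ] F} {v : P → E₁} {w : P → E₂} {x : P → E₃} {z : P}
    (hB : DifferentiableAt ℝ B z)
    (hv : DifferentiableAt ℝ v z) (hw : DifferentiableAt ℝ w z) (hx : DifferentiableAt ℝ x z)
    (a : P) : fderiv ℝ (fun z => B z (v z) (w z) (x z)) z a =
      fderiv ℝ B z a (v z) (w z) (x z) + B z (fderiv ℝ v z a) (w z) (x z)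
        + B z (v z) (fderiv ℝ w z a) (x z) + B z (v z) (w z) (fderiv ℝ x z a) := by
  rw [fderiv_apply_apply ((hB.clm_apply hv).clm_apply hw) hx, fderiv_apply_apply₂ hB hv hw]
  simp

/-- The curvature as a bounded trilinear map. -/
noncomputable def curvatureMap (G : E → E →L[ℝ] E →L[ℝ] ℝ) (y : E) : E →L[ℝ] E →L[ℝ] E →L[ℝ] E :=
  let T : E →L[ℝ] E →L[ℝ] E →L[ℝ] E :=
    (ContinuousLinearMap.compL ℝ E E E).bilinearComp (christoffelMap G y) (christoffelMap G y)
  fderiv ℝ (christoffelMap G) y - (fderiv ℝ (christoffelMap G) y).flip + T - T.flip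

theorem covDeriv_congr {G : E → E →L[ℝ] E →L[ℝ] ℝ} {F V W : P → E} {z : P} (h : V =ᶠ[𝓝 z] W)
    (a : P) : covDeriv G F V a z = covDeriv G F W a z := by
  rw [covDeriv, covDeriv, h.fderiv_eq, h.eq_of_nhds]

/-- Realizes two prescribed vectors as partial derivatives of one map, so that pointwise identities
for R follow from commuting covariant derivatives along that map. -/
theorem exists_affine_surface (y v w : E) : ∃ F : ℝ × ℝ → E, ContDiff ℝ ∞ F ∧ F 0 = y ∧
    fderiv ℝ F 0 (1, 0) = v ∧ fderiv ℝ F 0 (0, 1) = w := by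
  let L : ℝ × ℝ →L[ℝ] E := (ContinuousLinearMap.fst ℝ ℝ ℝ).smulRight v +
    (ContinuousLinearMap.snd ℝ ℝ ℝ).smulRight w
  refine ⟨fun p => y + L p, contDiff_const.add L.contDiff, by simp, ?_, ?_⟩ <;>
  · rw [fderiv_const_add, L.fderiv]
    simp [L]

namespace IsMetricOn

variable {G : E → E →L[ℝ] E →L[ℝ] ℝ} {O : Set E}

section

variable [FiniteDimensional ℝ E] (hG : IsMetricOn G O)
include hG

theorem curvatureMap_apply {y : E} (hy : y ∈ O) (v w z : E) :
    curvatureMap G y v w z = curvatureCoord G y v w z := by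
  rw [hG.curvatureCoord_eq hy]
  simp [curvatureMap, christoffelMap_apply]

theorem contDiffOn_curvatureMap : ContDiffOn ℝ ∞ (curvatureMap G) O := by
  have h1 := ContDiffOn.fderiv_of_isOpen_infty hG.contDiffOn_christoffelMap hG.isOpen
  have h2 : ContDiffOn ℝ ∞ (fun y => (fderiv ℝ (christoffelMap G) y).flip) O :=
    (ContinuousLinearMap.flipₗᵢ ℝ E E (E →L[ℝ] E)).contDiff.comp_contDiffOn h1
  have h3 : ContDiffOn ℝ ∞ (fun y => (ContinuousLinearMap.compL ℝ E E E).bilinearComp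
      (christoffelMap G y) (christoffelMap G y)) O := by
    unfold ContinuousLinearMap.bilinearComp
    have h4 : ContDiffOn ℝ ∞ (fun y => (ContinuousLinearMap.compL ℝ E E E) ∘L
      (christoffelMap G y)) O := contDiffOn_const.clm_comp hG.contDiffOn_christoffelMap
    have h5 : ContDiffOn ℝ ∞ (fun y => ((ContinuousLinearMap.compL ℝ E E E) ∘L
      (christoffelMap G y)).flip) O :=
      (ContinuousLinearMap.flipₗᵢ ℝ E (E →L[ℝ] E) (E →L[ℝ] E)).contDiff.comp_contDiffOn h4
    exact (ContinuousLinearMap.flipₗᵢ ℝ E E (E →L[ℝ] E)).contDiff.comp_contDiffOn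
      (h5.clm_comp hG.contDiffOn_christoffelMap)
  have h4 : ContDiffOn ℝ ∞ (fun y => ((ContinuousLinearMap.compL ℝ E E E).bilinearComp
      (christoffelMap G y) (christoffelMap G y)).flip) O :=
    (ContinuousLinearMap.flipₗᵢ ℝ E E (E →L[ℝ] E)).contDiff.comp_contDiffOn h3
  exact ((h1.sub h2).add h3).sub h4

theorem differentiableAt_curvatureMap {y : E} (hy : y ∈ O) :
    DifferentiableAt ℝ (curvatureMap G) y :=
  ContDiffOn.differentiableAt_infty hG.contDiffOn_curvatureMap hG.isOpen hy

theorem fderiv_curvatureCoord {y : E} (hy : y ∈ O) (a v w z : E) :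
    fderiv ℝ (fun y' => curvatureCoord G y' v w z) y a = fderiv ℝ (curvatureMap G) y a v w z := by
  have h : (fun y' => curvatureCoord G y' v w z) =ᶠ[𝓝 y] fun y' => curvatureMap G y' v w z := by
    filter_upwards [hG.isOpen.mem_nhds hy] with y' hy' using (hG.curvatureMap_apply hy' v w z).symm
  rw [h.fderiv_eq, fderiv_apply_apply₃ (B := curvatureMap G) (v := fun _ => v) (w := fun _ => w)
    (x := fun _ => z) (hG.differentiableAt_curvatureMap hy) (by fun_prop) (by fun_prop)
    (by fun_prop)]
  simp

omit [FiniteDimensional ℝ E] hG in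
theorem _root_.SchrodingerAiry.curvatureCoord_antisymm (y v w z : E) :
    curvatureCoord G y v w z = -curvatureCoord G y w v z := by
  simp only [curvatureCoord]
  abel

theorem fderiv_christoffelMap_symm {y : E} (hy : y ∈ O) (a v w : E) :
    fderiv ℝ (christoffelMap G) y a v w = fderiv ℝ (christoffelMap G) y a w v := by
  rw [← hG.fderiv_christoffel hy, ← hG.fderiv_christoffel hy]
  have h : (fun y' => christoffel G y' v w) =ᶠ[𝓝 y] fun y' => christoffel G y' w v := by
    filter_upwards [hG.isOpen.mem_nhds hy] with y' hy' using hG.christoffel_symm hy' v w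
  rw [h.fderiv_eq]

/-- Symmetry of Γ, that is, absence of torsion, cancels the twelve terms in pairs. -/
theorem bianchi {y : E} (hy : y ∈ O) (v w z : E) :
    curvatureCoord G y v w z + curvatureCoord G y w z v + curvatureCoord G y z v w = 0 := by
  rw [hG.curvatureCoord_eq hy, hG.curvatureCoord_eq hy, hG.curvatureCoord_eq hy,
    hG.fderiv_christoffelMap_symm hy v z w, hG.fderiv_christoffelMap_symm hy w v z,
    hG.fderiv_christoffelMap_symm hy z w v, hG.christoffel_symm hy z w,
    hG.christoffel_symm hy v w, hG.christoffel_symm hy z v]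
  abel

end

section Along

variable [FiniteDimensional ℝ E] (hG : IsMetricOn G O) {F : P → E} {Ω : Set P} (hΩ : IsOpen Ω)
  (hF : ContDiffOn ℝ ∞ F Ω) (hFO : MapsTo F Ω O)
include hG hΩ hF hFO

/-- The second derivative of the scalar ⟨V, W⟩ is symmetric in a and b. Expanded by metric
compatibility in both orders, its mixed terms agree, so the commutators of ∇ on `V` and on `W` have
to cancel. -/
theorem inner_curvature_along {V W : P → E} (hV : ContDiffOn ℝ ∞ V Ω) (hW : ContDiffOn ℝ ∞ W Ω)
    {z : P} (hz : z ∈ Ω) (a b : P) :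
    G (F z) (curvatureCoord G (F z) (fderiv ℝ F z a) (fderiv ℝ F z b) (V z)) (W z) =
      -G (F z) (V z) (curvatureCoord G (F z) (fderiv ℝ F z a) (fderiv ℝ F z b) (W z)) := by
  have hf := hG.contDiffOn_inner hF hFO hV hW
  have hf' := ContDiffOn.differentiableAt_infty (ContDiffOn.fderiv_of_isOpen_infty hf hΩ) hΩ hz
  have hDV := fun c => hG.contDiffOn_covDeriv hΩ hF hFO hV c
  have hDW := fun c => hG.contDiffOn_covDeriv hΩ hF hFO hW c
  have key : ∀ a b, fderiv ℝ (fderiv ℝ (fun z => G (F z) (V z) (W z))) z a b =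
      (G (F z) (covDeriv G F (covDeriv G F V b) a z) (W z)
        + G (F z) (covDeriv G F V b z) (covDeriv G F W a z))
      + (G (F z) (covDeriv G F V a z) (covDeriv G F W b z)
        + G (F z) (V z) (covDeriv G F (covDeriv G F W b) a z)) := by
    intro a b
    have h1 : fderiv ℝ (fderiv ℝ (fun z => G (F z) (V z) (W z))) z a b =
        fderiv ℝ (fun z => fderiv ℝ (fun z => G (F z) (V z) (W z)) z b) z a := by
      rw [fderiv_apply_apply hf' (by fun_prop)]
      simp
    have h2 : (fun z => fderiv ℝ (fun z => G (F z) (V z) (W z)) z b) =ᶠ[𝓝 z]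
        fun z => G (F z) (covDeriv G F V b z) (W z) + G (F z) (V z) (covDeriv G F W b z) := by
      filter_upwards [hΩ.mem_nhds hz] with z' hz' using hG.fderiv_inner hΩ hF hFO hV hW hz' b
    rw [h1, h2.fderiv_eq, fderiv_fun_add, _root_.add_apply,
      hG.fderiv_inner hΩ hF hFO (hDV b) hW hz, hG.fderiv_inner hΩ hF hFO hV (hDW b) hz]
    · exact ContDiffOn.differentiableAt_infty (hG.contDiffOn_inner hF hFO (hDV b) hW) hΩ hz
    · exact ContDiffOn.differentiableAt_infty (hG.contDiffOn_inner hF hFO hV (hDW b)) hΩ hz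
  have h1 := key a b
  have h2 := key b a
  rw [fderiv_fderiv_comm hf hΩ hz, h2] at h1
  rw [← hG.covDeriv_covDeriv_sub hΩ hF hFO hV hz, ← hG.covDeriv_covDeriv_sub hΩ hF hFO hW hz]
  simp only [map_sub, _root_.sub_apply]
  linarith

omit [FiniteDimensional ℝ E] in
/-- A parallel field of endomorphisms commutes with covariant differentiation. -/
theorem covDeriv_endomorphism {A : E → E →L[ℝ] E} (hA : ContDiffOn ℝ ∞ A O)
    (hpar : ∀ y ∈ O, ∀ a v, fderiv ℝ A y a v + christoffel G y a (A y v)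
      - A y (christoffel G y a v) = 0)
    {V : P → E} (hV : ContDiffOn ℝ ∞ V Ω) {z : P} (hz : z ∈ Ω) (a : P) :
    covDeriv G F (fun z => A (F z) (V z)) a z = A (F z) (covDeriv G F V a z) := by
  have hFz := ContDiffOn.differentiableAt_infty hF hΩ hz
  have hAz := ContDiffOn.differentiableAt_infty hA hG.isOpen (hFO hz)
  have hVz := ContDiffOn.differentiableAt_infty hV hΩ hz
  have h := hpar (F z) (hFO hz) (fderiv ℝ F z a) (V z)
  rw [covDeriv, covDeriv, fderiv_apply_apply (L := fun z => A (F z)) (hAz.comp z hFz) hVz,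
    fderiv_comp_apply' hAz hFz, map_add]
  rw [sub_eq_zero] at h
  rw [← h]
  abel

/-- A parallel curvature tensor satisfies the Leibniz rule. -/
theorem covDeriv_curvature
    (hpar : ∀ y ∈ O, ∀ a v w z, nablaCurvatureCoord G y a v w z = 0) {V W Z : P → E}
    (hV : ContDiffOn ℝ ∞ V Ω) (hW : ContDiffOn ℝ ∞ W Ω) (hZ : ContDiffOn ℝ ∞ Z Ω) {z : P}
    (hz : z ∈ Ω) (a : P) :
    covDeriv G F (fun z => curvatureCoord G (F z) (V z) (W z) (Z z)) a z =
      curvatureCoord G (F z) (covDeriv G F V a z) (W z) (Z z)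
      + curvatureCoord G (F z) (V z) (covDeriv G F W a z) (Z z)
      + curvatureCoord G (F z) (V z) (W z) (covDeriv G F Z a z) := by
  have hFz := ContDiffOn.differentiableAt_infty hF hΩ hz
  have hRz := hG.differentiableAt_curvatureMap (hFO hz)
  have hd := fun {V : P → E} (hV : ContDiffOn ℝ ∞ V Ω) =>
    ContDiffOn.differentiableAt_infty hV hΩ hz
  have h := hpar (F z) (hFO hz) (fderiv ℝ F z a) (V z) (W z) (Z z)
  rw [nablaCurvatureCoord, hG.fderiv_curvatureCoord (hFO hz)] at h
  have h1 : (fun z => curvatureCoord G (F z) (V z) (W z) (Z z)) =ᶠ[𝓝 z]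
      fun z => curvatureMap G (F z) (V z) (W z) (Z z) := by
    filter_upwards [hΩ.mem_nhds hz] with z' hz' using (hG.curvatureMap_apply (hFO hz') _ _ _).symm
  rw [covDeriv_congr h1, covDeriv, fderiv_apply_apply₃ (B := fun z => curvatureMap G (F z))
    (hRz.comp z hFz) (hd hV) (hd hW) (hd hZ), fderiv_comp_apply' hRz hFz]
  simp only [← hG.curvatureMap_apply (hFO hz)] at h ⊢
  simp only [covDeriv, map_add, _root_.add_apply]
  rw [← sub_eq_zero]
  rw [← h]
  abel

end Along

section Algebra

variable [FiniteDimensional ℝ E] (hG : IsMetricOn G O) {y : E} (hy : y ∈ O)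
include hG hy

theorem inner_curvature (v w z z' : E) :
    G y (curvatureCoord G y v w z) z' = -G y z (curvatureCoord G y v w z') := by
  obtain ⟨F, hF, rfl, rfl, rfl⟩ := exists_affine_surface y v w
  exact hG.inner_curvature_along (Ω := F ⁻¹' O) (hG.isOpen.preimage hF.continuous) hF.contDiffOn
    (mapsTo_preimage _ _) (contDiffOn_const (c := z)) (contDiffOn_const (c := z')) hy _ _

/-- A parallel endomorphism passes through both iterated covariant derivatives, hence through their
commutator. -/
theorem curvature_endomorphism {A : E → E →L[ℝ] E} (hA : ContDiffOn ℝ ∞ A O)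
    (hpar : ∀ y ∈ O, ∀ a v, fderiv ℝ A y a v + christoffel G y a (A y v)
      - A y (christoffel G y a v) = 0) (v w z : E) :
    curvatureCoord G y v w (A y z) = A y (curvatureCoord G y v w z) := by
  obtain ⟨F, hF, rfl, rfl, rfl⟩ := exists_affine_surface y v w
  have hΩ : IsOpen (F ⁻¹' O) := hG.isOpen.preimage hF.continuous
  have hFO := mapsTo_preimage F O
  have hc : ContDiffOn ℝ ∞ (fun _ : ℝ × ℝ => z) (F ⁻¹' O) := contDiffOn_const
  have hD := fun c => hG.contDiffOn_covDeriv hΩ hF.contDiffOn hFO hc c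
  have hAc : ContDiffOn ℝ ∞ (fun p => A (F p) z) (F ⁻¹' O) :=
    (hA.comp hF.contDiffOn hFO).clm_apply hc
  rw [← hG.covDeriv_covDeriv_sub hΩ hF.contDiffOn hFO hAc hy,
    ← hG.covDeriv_covDeriv_sub hΩ hF.contDiffOn hFO hc hy, map_sub]
  have key : ∀ a b, covDeriv G F (covDeriv G F (fun p => A (F p) z) b) a 0 =
      A (F 0) (covDeriv G F (covDeriv G F (fun _ => z) b) a 0) := by
    intro a b
    rw [← hG.covDeriv_endomorphism hΩ hF.contDiffOn hFO hA hpar (hD b) hy]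
    apply covDeriv_congr
    filter_upwards [hΩ.mem_nhds hy] with p hp using
      hG.covDeriv_endomorphism hΩ hF.contDiffOn hFO hA hpar hc hp b
  rw [key, key]

/-- The classical octahedron argument: four Bianchi identities, obtained by cycling the letters,
combined with skewness in each pair of slots. -/
theorem curvature_pair_symm (a b c d : E) :
    G y (curvatureCoord G y a b c) d = G y (curvatureCoord G y c d a) b := by
  have B : ∀ a b c d, G y (curvatureCoord G y a b c) d + G y (curvatureCoord G y b c a) d
      + G y (curvatureCoord G y c a b) d = 0 := by
    intro a b c d
    have := congrArg (fun v => G y v d) (hG.bianchi hy a b c)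
    simpa using this
  have S1 : ∀ a b c d, G y (curvatureCoord G y a b c) d = -G y (curvatureCoord G y b a c) d := by
    intro a b c d
    rw [curvatureCoord_antisymm]
    simp
  have S2 : ∀ a b c d, G y (curvatureCoord G y a b c) d = -G y (curvatureCoord G y a b d) c := by
    intro a b c d
    rw [hG.inner_curvature hy, hG.symm y hy]
  linarith [B a b c d, B b c d a, B c d a b, B d a b c, S1 a b c d, S1 b c a d, S1 c a b d,
    S2 a b c d, S2 b c a d, S2 c a b d, S2 b c d a, S2 c d b a, S2 d b c a, S2 c d a b, S2 d a c b,
    S2 a c d b, S2 d a b c, S2 a b d c, S2 b d a c, S1 b d c a, S1 c a d b, S1 d a b c, S1 a c b d,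
    S1 c d a b, S1 d b a c, S1 a c d b, S1 b d a c]

end Algebra

end IsMetricOn

end LocalCurvature

end SchrodingerAiry

namespace SchrodingerAiry

set_option maxSynthPendingDepth 3
set_option synthInstance.maxHeartbeats 100000

/-! ### Kähler structures on an open set, and ∇J = 0 -/

section LocalKahler

variable {E : Type*} [NormedAddCommGroup E] [NormedSpace ℝ E]

/-- `A` is a smooth almost complex structure on `O`, isometric for the metric `G`. -/
structure IsAlmostHermitianOn (G : E → E →L[ℝ] E →L[ℝ] ℝ) (A : E → E →L[ℝ] E) (O : Set E) : Prop
    extends IsMetricOn G O where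
  smooth_endo : ContDiffOn ℝ ∞ A O
  sq_eq_neg : ∀ y ∈ O, ∀ v, A y (A y v) = -v
  isometric : ∀ y ∈ O, ∀ v w, G y (A y v) (A y w) = G y v w

/-- An isometry whose square is −1 is skew-adjoint. -/
theorem inner_endo {G : E → E →L[ℝ] E →L[ℝ] ℝ} {A : E → E →L[ℝ] E} {O : Set E}
    (h : IsAlmostHermitianOn G A O) {y : E} (hy : y ∈ O) (v w : E) :
    G y (A y v) w = -G y v (A y w) := by
  have := h.isometric y hy v (A y w)
  rw [h.sq_eq_neg y hy] at this
  rw [← this]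
  simp

/-- The covariant derivative of the complex structure of a Kähler manifold vanishes. -/
theorem IsAlmostHermitianOn.nabla_endo_eq_zero [FiniteDimensional ℝ E]
    {G : E → E →L[ℝ] E →L[ℝ] ℝ} {A : E → E →L[ℝ] E}
    {O : Set E} (h : IsAlmostHermitianOn G A O) {y : E} (hy : y ∈ O)
    (hN : ∀ v w, nijenhuisCoord A y v w = 0)
    (hω : ∀ a b c, dKahlerFormCoord G A y a b c = 0) (a v : E) :
    fderiv ℝ A y a v + christoffel G y a (A y v) - A y (christoffel G y a v) = 0 := by
  have hm := h.toIsMetricOn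
  have hAd : DifferentiableAt ℝ A y :=
    ContDiffOn.differentiableAt_infty h.smooth_endo hm.isOpen hy
  have hGd := hm.differentiableAt hy
  have hO := hm.isOpen.mem_nhds hy
  have hdA : ∀ a v, fderiv ℝ (fun y' => A y' v) y a = fderiv ℝ A y a v := by
    intro a v
    rw [fderiv_apply_apply hAd (by fun_prop)]
    simp
  -- `B a` is the covariant derivative ∇_a A at `y`; the aim is to show that it vanishes.
  set B : E → E → E := fun a v =>
    fderiv ℝ A y a v + christoffel G y a (A y v) - A y (christoffel G y a v) with hB
  have hdω : ∀ a b c, fderiv ℝ (fun y' => G y' (A y' b) c) y a =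
      G y (B a b) c + G y (A y (christoffel G y a b)) c + G y (A y b) (christoffel G y a c) := by
    intro a b c
    rw [fderiv_apply_apply₂ hGd (hAd.clm_apply (by fun_prop)) (by fun_prop), hdA, hm.fderiv_eq hy]
    simp [hB]
    ring
  -- Differentiates the skewness of `A`.
  have hskew : ∀ a b c, G y (B a b) c = -G y (B a c) b := by
    intro a b c
    have h1 : (fun y' => G y' (A y' b) c) =ᶠ[𝓝 y] fun y' => -G y' (A y' c) b := by
      filter_upwards [hO] with y' hy'
      rw [inner_endo h hy', hm.symm y' hy']
    have h2 := congrArg (fun L : E →L[ℝ] ℝ => L a) (h1.fderiv_eq (𝕜 := ℝ))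
    rw [fderiv_fun_neg] at h2
    simp only [_root_.neg_apply] at h2
    rw [hdω, hdω, inner_endo h hy, inner_endo h hy] at h2
    linarith [hm.symm y hy b (A y (christoffel G y a c)),
      hm.symm y hy (christoffel G y a b) (A y c), inner_endo h hy c (christoffel G y a b),
      inner_endo h hy (christoffel G y a c) b, hm.symm y hy c (A y (christoffel G y a b))]
  -- Differentiates A² = −1.
  have hBA : ∀ a v, B a (A y v) = -A y (B a v) := by
    intro a v
    have h1 : (fun y' => A y' (A y' v)) =ᶠ[𝓝 y] fun y' => -v := by
      filter_upwards [hO] with y' hy' using h.sq_eq_neg y' hy' v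
    have h2 := congrArg (fun L : E →L[ℝ] E => L a) (h1.fderiv_eq (𝕜 := ℝ))
    rw [fderiv_apply_apply hAd (hAd.clm_apply (by fun_prop)), hdA] at h2
    simp at h2
    simp only [hB, map_sub, map_add, h.sq_eq_neg y hy, ← christoffelMap_apply, map_neg] at h2 ⊢
    rw [← sub_eq_zero, ← h2]
    abel
  -- dω is the cyclic sum of ∇ω; the Christoffel terms cancel by symmetry.
  have hcyc : ∀ a b c, G y (B a b) c + G y (B b c) a + G y (B c a) b = 0 := by
    intro a b c
    have h1 := hω a b c
    rw [dKahlerFormCoord, hdω, hdω, hdω] at h1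
    have h2 := hskew b a c
    rw [hm.christoffel_symm hy b a, hm.christoffel_symm hy c a, hm.christoffel_symm hy c b,
      inner_endo h hy (christoffel G y a c) b, hm.symm y hy (christoffel G y a c),
      inner_endo h hy a (christoffel G y b c),
      hm.symm y hy a] at h1
    linarith
  -- Without torsion, Lie brackets become covariant derivatives, and the Nijenhuis tensor is an
  -- expression in ∇A alone.
  have hNB : ∀ v w c, G y (B (A y v) w) c - G y (B (A y w) v) c - G y (B w v) (A y c)
      + G y (B v w) (A y c) = 0 := by
    intro v w c
    have h1 := congrArg (fun x => G y x c) (hN v w)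
    simp only [nijenhuisCoord, VectorField.lieBracket, hdA] at h1
    have h2 : ∀ x, G y x (A y c) = -G y (A y x) c := fun x => by rw [inner_endo h hy, neg_neg]
    rw [h2, h2]
    simp only [hB]
    simp [h.sq_eq_neg y hy] at h1 ⊢
    rw [hm.christoffel_symm hy (A y v) (A y w), hm.christoffel_symm hy (A y v) w,
      hm.christoffel_symm hy w v, hm.christoffel_symm hy (A y w) v]
    linarith
  have hsw : ∀ a v w, G y (B a (A y v)) w = G y (B a v) (A y w) := by
    intro a v w
    rw [hBA]
    simp [inner_endo h hy]
  -- Closedness at (Jv, w, c) and at (v, Jw, c) rewrites the first two terms of `hNB`. The other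
  -- terms then cancel and −2⟨B_c v, Jw⟩ = 0 is left.
  have hfin : ∀ c v w, G y (B c v) (A y w) = 0 := by
    intro c v w
    have e1 := hNB v w c
    have e2 := hcyc v w (A y c)
    have e3 := hskew w (A y c) v
    have e4 := hcyc (A y v) w c
    have e5 := hcyc v (A y w) c
    have e6 := hskew (A y w) v c
    have e7 := hsw v w c
    have e8 := hsw w c v
    have e9 := hsw c v w
    linarith
  change B a v = 0
  refine hm.ext_inner hy fun z => ?_
  -- Since J(−Jz) = z, the vectors Jw exhaust the space.
  have := hfin a v (-A y z)
  rw [map_neg, h.sq_eq_neg y hy, neg_neg] at this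
  simp [this]

/-- A Kähler structure with parallel curvature on an open subset of a vector space, subject to the
curvature identity `⟨R(Y, X) X, R(X, J X) J X⟩ = 0`. -/
structure IsSymmetricKahlerOn (G : E → E →L[ℝ] E →L[ℝ] ℝ) (A : E → E →L[ℝ] E) (O : Set E) : Prop
    extends IsAlmostHermitianOn G A O where
  parallel_endo : ∀ y ∈ O, ∀ a v, fderiv ℝ A y a v + christoffel G y a (A y v)
    - A y (christoffel G y a v) = 0
  parallel_curvature : ∀ y ∈ O, ∀ a v w z, nablaCurvatureCoord G y a v w z = 0
  curvature_identity : ∀ y ∈ O, ∀ v w, G y (curvatureCoord G y w v v)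
    (curvatureCoord G y v (A y v) (A y v)) = 0

end LocalKahler

/-! ### The local conservation law in coordinates -/

section ConservationLaw

variable {E : Type*} [NormedAddCommGroup E] [NormedSpace ℝ E]

variable (G : E → E →L[ℝ] E →L[ℝ] ℝ) (A : E → E →L[ℝ] E) (F : ℝ × ℝ → E)

/-- `u_x` in coordinates. -/
noncomputable def coordUx (z : ℝ × ℝ) : E := fderiv ℝ F z (1, 0)

/-- `u_t` in coordinates. -/
noncomputable def coordUt (z : ℝ × ℝ) : E := fderiv ℝ F z (0, 1)

/-- `∇_x` in coordinates. -/
noncomputable def coordDx (V : ℝ × ℝ → E) : ℝ × ℝ → E := covDeriv G F V (1, 0)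

/-- `R(u_x, J u_x) J u_x` in coordinates. -/
noncomputable def coordCurv (z : ℝ × ℝ) : E :=
  curvatureCoord G (F z) (coordUx F z) (A (F z) (coordUx F z)) (A (F z) (coordUx F z))

/-- `∇_x² u_x + (1/2) R(u_x, J u_x) J u_x` in coordinates. -/
noncomputable def coordAiry (z : ℝ × ℝ) : E :=
  coordDx G F (coordDx G F (coordUx F)) z + (1 / 2 : ℝ) • coordCurv G A F z

/-- The energy density in coordinates. -/
noncomputable def coordDensity (z : ℝ × ℝ) : ℝ :=
  G (F z) (coordDx G F (coordUx F) z) (coordDx G F (coordUx F) z)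
    - (1 / 4) * G (F z) (coordUx F z) (coordCurv G A F z)

/-- The flux of the energy density in coordinates. -/
noncomputable def coordFlux (α β : ℝ) (z : ℝ × ℝ) : ℝ :=
  -- The first two terms are the boundary terms from moving x-derivatives off u_t. The two terms in
  -- `β` and the one in `α` are primitives of what the Airy and the Schrödinger parts of u_t
  -- contribute.
  2 * G (F z) (coordDx G F (coordUt F) z) (coordDx G F (coordUx F) z)
    - 2 * G (F z) (coordUt F z) (coordAiry G A F z)
    + β * G (F z) (coordAiry G A F z) (coordAiry G A F z)
    + β * G (F z) (curvatureCoord G (F z) (coordDx G F (coordUx F) z) (coordUx F z) (coordUx F z))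
        (coordDx G F (coordUx F) z)
    + 2 * α * G (F z) (A (F z) (coordDx G F (coordUx F) z))
        (coordDx G F (coordDx G F (coordUx F)) z)

namespace IsSymmetricKahlerOn

variable {G A F} [FiniteDimensional ℝ E] {O : Set E} (h : IsSymmetricKahlerOn G A O)
include h

/-- Pair symmetry carries both J's to the other pair, where R commutes with J and J is an isometry.
-/
theorem curvature_endo_endo {y : E} (hy : y ∈ O) (v w z : E) :
    curvatureCoord G y (A y v) (A y w) z = curvatureCoord G y v w z := by
  have hm := h.toIsMetricOn
  refine hm.ext_inner hy fun z' => ?_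
  rw [hm.curvature_pair_symm hy, hm.curvature_endomorphism hy h.smooth_endo h.parallel_endo,
    h.isometric y hy, hm.curvature_pair_symm hy]

/-- Apply J to the first pair of slots, then use J² = −1 and antisymmetry. -/
theorem curvature_endo_right {y : E} (hy : y ∈ O) (v w z : E) :
    curvatureCoord G y v (A y w) z = curvatureCoord G y w (A y v) z := by
  have h1 := h.curvature_endo_endo hy v (A y w) z
  have hm := h.toIsMetricOn
  rw [h.sq_eq_neg y hy, curvatureCoord_antisymm, ← hm.curvatureMap_apply hy, map_neg,
    _root_.neg_apply, _root_.neg_apply, hm.curvatureMap_apply hy, neg_neg] at h1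
  exact h1.symm

/-- Differentiating `⟨X, R(X, J X) J X⟩`. -/
theorem inner_curvature_variation {y : E} (hy : y ∈ O) (x v : E) :
    G y x (curvatureCoord G y v (A y x) (A y x) + curvatureCoord G y x (A y v) (A y x)
      + curvatureCoord G y x (A y x) (A y v)) =
    3 * G y v (curvatureCoord G y x (A y x) (A y x)) := by
  have hm := h.toIsMetricOn
  -- Each of the three slots contributes the same amount; `curvature_endo_right` reduces the middle
  -- slot to the first.
  have e1 : G y x (curvatureCoord G y v (A y x) (A y x)) =
      G y v (curvatureCoord G y x (A y x) (A y x)) := by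
    rw [hm.symm y hy, hm.curvature_pair_symm hy, curvatureCoord_antisymm, map_neg,
      _root_.neg_apply, hm.inner_curvature hy, neg_neg]
  have e2 : G y x (curvatureCoord G y x (A y x) (A y v)) =
      G y v (curvatureCoord G y x (A y x) (A y x)) := by
    have hc := fun z => hm.curvature_endomorphism hy h.smooth_endo h.parallel_endo x (A y x) z
    rw [hc, hm.symm y hy x, inner_endo h.toIsAlmostHermitianOn hy, hm.inner_curvature hy, neg_neg]
  rw [map_add, map_add, h.curvature_endo_right hy x v, e1, e2]
  ring

/-- The contribution of the Schrödinger term. -/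
theorem inner_schrodinger_term {y : E} (hy : y ∈ O) (x v : E) :
    G y (A y v) (curvatureCoord G y v (A y x) (A y x) + curvatureCoord G y x (A y v) (A y x)
      + curvatureCoord G y x (A y x) (A y v)) + 2 * G y (A y v) (curvatureCoord G y v x x) = 0 := by
  have hm := h.toIsMetricOn
  have hc := fun a b z => hm.curvature_endomorphism hy h.smooth_endo h.parallel_endo a b z
  have e1 : G y (A y v) (curvatureCoord G y x (A y x) (A y v)) = 0 := by
    have := hm.inner_curvature hy x (A y x) (A y v) (A y v)
    rw [hm.symm y hy] at this
    linarith
  -- J comes out of the last slot and cancels by isometry; the remaining J passes from `x` to `v` in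
  -- the first pair, and pair symmetry then makes it act on the outer vector.
  have e2 : G y (A y v) (curvatureCoord G y v (A y x) (A y x)) =
      -G y (A y v) (curvatureCoord G y v x x) := by
    rw [hc, h.isometric y hy, h.curvature_endo_right hy, hm.symm y hy, hm.curvature_pair_symm hy,
      curvatureCoord_antisymm, map_neg, _root_.neg_apply, hm.symm y hy]
  rw [map_add, map_add, h.curvature_endo_right hy x v, e1, e2]
  ring

variable {Ω : Set (ℝ × ℝ)} (hΩ : IsOpen Ω) (hF : ContDiffOn ℝ ∞ F Ω) (hFO : MapsTo F Ω O)
include hΩ hF hFO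

omit h hFO [FiniteDimensional ℝ E] in
theorem contDiffOn_coordUx : ContDiffOn ℝ ∞ (coordUx F) Ω :=
  IsMetricOn.contDiffOn_fderiv_apply hΩ hF _

omit h hFO [FiniteDimensional ℝ E] in
theorem contDiffOn_coordUt : ContDiffOn ℝ ∞ (coordUt F) Ω :=
  IsMetricOn.contDiffOn_fderiv_apply hΩ hF _

theorem contDiffOn_coordDx {V : ℝ × ℝ → E} (hV : ContDiffOn ℝ ∞ V Ω) :
    ContDiffOn ℝ ∞ (coordDx G F V) Ω :=
  h.toIsMetricOn.contDiffOn_covDeriv hΩ hF hFO hV _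

omit hΩ [FiniteDimensional ℝ E] in
theorem contDiffOn_endo {V : ℝ × ℝ → E} (hV : ContDiffOn ℝ ∞ V Ω) :
    ContDiffOn ℝ ∞ (fun z => A (F z) (V z)) Ω :=
  (h.smooth_endo.comp hF hFO).clm_apply hV

theorem contDiffOn_coordCurv : ContDiffOn ℝ ∞ (coordCurv G A F) Ω := by
  have hX : ContDiffOn ℝ ∞ (coordUx F) Ω := contDiffOn_coordUx hΩ hF
  have hAX := h.contDiffOn_endo hF hFO hX
  exact h.toIsMetricOn.contDiffOn_curvature hF hFO hX hAX hAX

theorem contDiffOn_coordAiry : ContDiffOn ℝ ∞ (coordAiry G A F) Ω :=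
  (h.contDiffOn_coordDx hΩ hF hFO (h.contDiffOn_coordDx hΩ hF hFO (contDiffOn_coordUx hΩ hF))).add
    (contDiffOn_const.smul (h.contDiffOn_coordCurv hΩ hF hFO))

theorem contDiffOn_coordDensity : ContDiffOn ℝ ∞ (coordDensity G A F) Ω := by
  have hX : ContDiffOn ℝ ∞ (coordUx F) Ω := contDiffOn_coordUx hΩ hF
  have hDX := h.contDiffOn_coordDx hΩ hF hFO hX
  have hi := fun {V W : ℝ × ℝ → E} => h.toIsMetricOn.contDiffOn_inner hF hFO (V := V) (W := W)
  exact (hi hDX hDX).sub (contDiffOn_const.mul (hi hX (h.contDiffOn_coordCurv hΩ hF hFO)))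

theorem contDiffOn_coordFlux (α β : ℝ) : ContDiffOn ℝ ∞ (coordFlux G A F α β) Ω := by
  have hX : ContDiffOn ℝ ∞ (coordUx F) Ω := contDiffOn_coordUx hΩ hF
  have hV : ContDiffOn ℝ ∞ (coordUt F) Ω := contDiffOn_coordUt hΩ hF
  have hDX := h.contDiffOn_coordDx hΩ hF hFO hX
  have hDV := h.contDiffOn_coordDx hΩ hF hFO hV
  have hDDX := h.contDiffOn_coordDx hΩ hF hFO hDX
  have hW := h.contDiffOn_coordAiry hΩ hF hFO
  have hR := h.toIsMetricOn.contDiffOn_curvature hF hFO hDX hX hX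
  have hA := h.contDiffOn_endo hF hFO hDX
  have hi := fun {V W : ℝ × ℝ → E} => h.toIsMetricOn.contDiffOn_inner hF hFO (V := V) (W := W)
  exact (((((contDiffOn_const.mul (hi hDV hDX)).sub (contDiffOn_const.mul (hi hV hW))).add
    (contDiffOn_const.mul (hi hW hW))).add (contDiffOn_const.mul (hi hR hDX))).add
    (contDiffOn_const.mul (hi hA hDDX)))

/-- The time derivative of the energy density. -/
theorem fderiv_coordDensity {z : ℝ × ℝ} (hz : z ∈ Ω) :
    fderiv ℝ (coordDensity G A F) z (0, 1) =
      2 * G (F z) (coordDx G F (coordDx G F (coordUt F)) z +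
        curvatureCoord G (F z) (coordUt F z) (coordUx F z) (coordUx F z))
          (coordDx G F (coordUx F) z)
        - G (F z) (coordDx G F (coordUt F) z) (coordCurv G A F z) := by
  have hm := h.toIsMetricOn
  have hX : ContDiffOn ℝ ∞ (coordUx F) Ω := contDiffOn_coordUx hΩ hF
  have hDX := h.contDiffOn_coordDx hΩ hF hFO hX
  have hS := h.contDiffOn_coordCurv hΩ hF hFO
  have hAX := h.contDiffOn_endo hF hFO hX
  have hi := fun {V W : ℝ × ℝ → E} => hm.contDiffOn_inner hF hFO (V := V) (W := W)
  have hd := fun {f : ℝ × ℝ → ℝ} (hf : ContDiffOn ℝ ∞ f Ω) =>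
    ContDiffOn.differentiableAt_infty hf hΩ hz
  -- Torsion-freeness: ∇_t u_x = ∇_x u_t.
  have hflip : ∀ z ∈ Ω, covDeriv G F (coordUx F) (0, 1) z = coordDx G F (coordUt F) z :=
    fun z hz => hm.covDeriv_fderiv_comm hΩ hF hFO hz _ _
  -- Exchanging ∇_t and ∇_x on u_x costs the curvature term R(u_t, u_x)u_x.
  have h2 : covDeriv G F (coordDx G F (coordUx F)) (0, 1) z =
      coordDx G F (coordDx G F (coordUt F)) z +
        curvatureCoord G (F z) (coordUt F z) (coordUx F z) (coordUx F z) := by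
    have h3 := hm.covDeriv_covDeriv_sub hΩ hF hFO hX hz (0, 1) (1, 0)
    have h4 : covDeriv G F (coordUx F) (0, 1) =ᶠ[𝓝 z] coordDx G F (coordUt F) := by
      filter_upwards [hΩ.mem_nhds hz] with z' hz' using hflip z' hz'
    rw [covDeriv_congr h4, sub_eq_iff_eq_add] at h3
    rw [add_comm]
    exact h3
  have h5 := hm.covDeriv_curvature hΩ hF hFO h.parallel_curvature hX hAX hAX hz (0, 1)
  rw [hm.covDeriv_endomorphism hΩ hF hFO h.smooth_endo h.parallel_endo hX hz, hflip z hz] at h5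
  have e : coordDensity G A F = fun z =>
    G (F z) (coordDx G F (coordUx F) z) (coordDx G F (coordUx F) z)
      - (1 / 4) * G (F z) (coordUx F z) (coordCurv G A F z) := rfl
  rw [e, fderiv_fun_sub (hd (hi hDX hDX)) ((hd (hi hX hS)).const_mul _),
    fderiv_const_mul (hd (hi hX hS))]
  simp only [_root_.sub_apply, _root_.smul_apply, smul_eq_mul]
  -- The quartic term yields one copy of ⟨∇_x u_t, S⟩ from its first factor and three from
  -- `inner_curvature_variation`, which the coefficient 1/4 normalizes to one.
  rw [hm.fderiv_inner hΩ hF hFO hDX hDX hz, hm.fderiv_inner hΩ hF hFO hX hS hz, hflip z hz, h2,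
    show covDeriv G F (coordCurv G A F) (0, 1) z = _ from h5,
    h.inner_curvature_variation (hFO hz), hm.symm (F z) (hFO hz) (coordDx G F (coordUx F) z),
    coordCurv]
  ring

/-- The spatial derivative of the flux. -/
theorem fderiv_coordFlux (α β : ℝ) {z : ℝ × ℝ} (hz : z ∈ Ω) :
    fderiv ℝ (coordFlux G A F α β) z (1, 0) =
      2 * (G (F z) (coordDx G F (coordDx G F (coordUt F)) z) (coordDx G F (coordUx F) z)
        + G (F z) (coordDx G F (coordUt F) z) (coordDx G F (coordDx G F (coordUx F)) z))
      - 2 * (G (F z) (coordDx G F (coordUt F) z) (coordAiry G A F z)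
        + G (F z) (coordUt F z) (coordDx G F (coordAiry G A F) z))
      + 2 * β * G (F z) (coordDx G F (coordAiry G A F) z) (coordAiry G A F z)
      + 2 * β * G (F z) (curvatureCoord G (F z) (coordDx G F (coordUx F) z) (coordUx F z)
          (coordUx F z)) (coordDx G F (coordDx G F (coordUx F)) z)
      + 2 * α * G (F z) (A (F z) (coordDx G F (coordUx F) z))
          (coordDx G F (coordDx G F (coordDx G F (coordUx F))) z) := by
  have hm := h.toIsMetricOn
  have hX : ContDiffOn ℝ ∞ (coordUx F) Ω := contDiffOn_coordUx hΩ hF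
  have hV : ContDiffOn ℝ ∞ (coordUt F) Ω := contDiffOn_coordUt hΩ hF
  have hDX := h.contDiffOn_coordDx hΩ hF hFO hX
  have hDV := h.contDiffOn_coordDx hΩ hF hFO hV
  have hDDX := h.contDiffOn_coordDx hΩ hF hFO hDX
  have hW := h.contDiffOn_coordAiry hΩ hF hFO
  have hR := hm.contDiffOn_curvature hF hFO hDX hX hX
  have hA := h.contDiffOn_endo hF hFO hDX
  have hi := fun {V W : ℝ × ℝ → E} => hm.contDiffOn_inner hF hFO (V := V) (W := W)
  have hd := fun {f : ℝ × ℝ → ℝ} (hf : ContDiffOn ℝ ∞ f Ω) =>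
    (ContDiffOn.differentiableAt_infty hf hΩ hz).hasFDerivAt
  have key := (((((hd (hi hDV hDX)).const_mul 2).sub ((hd (hi hV hW)).const_mul 2)).add
    ((hd (hi hW hW)).const_mul β)).add ((hd (hi hR hDX)).const_mul β)).add
    ((hd (hi hA hDDX)).const_mul (2 * α))
  rw [show fderiv ℝ (coordFlux G A F α β) z = _ from key.fderiv]
  simp only [_root_.sub_apply, _root_.add_apply, _root_.smul_apply, smul_eq_mul]
  rw [hm.fderiv_inner hΩ hF hFO hDV hDX hz, hm.fderiv_inner hΩ hF hFO hV hW hz,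
    hm.fderiv_inner hΩ hF hFO hW hW hz, hm.fderiv_inner hΩ hF hFO hR hDX hz,
    hm.fderiv_inner hΩ hF hFO hA hDDX hz,
    hm.covDeriv_endomorphism hΩ hF hFO h.smooth_endo h.parallel_endo hDX hz,
    hm.covDeriv_curvature hΩ hF hFO h.parallel_curvature hDX hX hX hz]
  -- Every derivative is now named as an iterated ∇_x, so what follows is pointwise algebra of
  -- vectors in one fibre.
  change 2 * (G (F z) (coordDx G F (coordDx G F (coordUt F)) z) (coordDx G F (coordUx F) z)
        + G (F z) (coordDx G F (coordUt F) z) (coordDx G F (coordDx G F (coordUx F)) z))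
      - 2 * (G (F z) (coordDx G F (coordUt F) z) (coordAiry G A F z)
        + G (F z) (coordUt F z) (coordDx G F (coordAiry G A F) z))
      + β * (G (F z) (coordDx G F (coordAiry G A F) z) (coordAiry G A F z)
        + G (F z) (coordAiry G A F z) (coordDx G F (coordAiry G A F) z))
      + β * (G (F z) (curvatureCoord G (F z) (coordDx G F (coordDx G F (coordUx F)) z)
            (coordUx F z) (coordUx F z)
          + curvatureCoord G (F z) (coordDx G F (coordUx F) z)
            (coordDx G F (coordUx F) z) (coordUx F z)
          + curvatureCoord G (F z) (coordDx G F (coordUx F) z) (coordUx F z)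
            (coordDx G F (coordUx F) z)) (coordDx G F (coordUx F) z)
        + G (F z) (curvatureCoord G (F z) (coordDx G F (coordUx F) z) (coordUx F z) (coordUx F z))
          (coordDx G F (coordDx G F (coordUx F)) z))
      + 2 * α * (G (F z) (A (F z) (coordDx G F (coordDx G F (coordUx F)) z))
          (coordDx G F (coordDx G F (coordUx F)) z)
        + G (F z) (A (F z) (coordDx G F (coordUx F) z))
          (coordDx G F (coordDx G F (coordDx G F (coordUx F))) z)) = _
  generalize coordDx G F (coordDx G F (coordDx G F (coordUx F))) z = x3
  generalize coordDx G F (coordDx G F (coordUx F)) z = x2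
  generalize coordDx G F (coordUx F) z = x1
  generalize coordUx F z = x
  generalize coordDx G F (coordAiry G A F) z = w1
  generalize coordAiry G A F z = w
  have hy := hFO hz
  have e1 : curvatureCoord G (F z) x1 x1 x = 0 := by
    simp [curvatureCoord]
  have e2 : G (F z) (curvatureCoord G (F z) x1 x x1) x1 = 0 := by
    have := hm.inner_curvature hy x1 x x1 x1
    rw [hm.symm _ hy x1] at this
    linarith
  -- The Jacobi operator v ↦ R(v, x)x is self-adjoint; hence the factor 2 in the result.
  have e3 : G (F z) (curvatureCoord G (F z) x2 x x) x1 =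
      G (F z) (curvatureCoord G (F z) x1 x x) x2 := by
    rw [hm.curvature_pair_symm hy, curvatureCoord_antisymm, map_neg, _root_.neg_apply,
      hm.inner_curvature hy, neg_neg, hm.symm _ hy]
  have e4 : G (F z) (A (F z) x2) x2 = 0 := by
    have := inner_endo h.toIsAlmostHermitianOn hy x2 x2
    rw [hm.symm _ hy x2] at this
    linarith
  simp only [map_add, _root_.add_apply, e1, e2, e3, e4, map_zero, _root_.zero_apply,
    hm.symm _ hy w w1]
  ring

/-- Local form of the conservation law: along a solution of the flow, the time derivative of the
energy density is the spatial derivative of the flux. -/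
theorem fderiv_coordDensity_eq_fderiv_coordFlux (α β : ℝ)
    (heq : ∀ z ∈ Ω, coordUt F z =
      α • A (F z) (coordDx G F (coordUx F) z) + β • coordAiry G A F z)
    {z : ℝ × ℝ} (hz : z ∈ Ω) :
    fderiv ℝ (coordDensity G A F) z (0, 1) = fderiv ℝ (coordFlux G A F α β) z (1, 0) := by
  have hm := h.toIsMetricOn
  have hy := hFO hz
  have hX : ContDiffOn ℝ ∞ (coordUx F) Ω := contDiffOn_coordUx hΩ hF
  have hDX := h.contDiffOn_coordDx hΩ hF hFO hX
  have hDDX := h.contDiffOn_coordDx hΩ hF hFO hDX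
  have hAX := h.contDiffOn_endo hF hFO hX
  have hS := h.contDiffOn_coordCurv hΩ hF hFO
  have hS1 : coordDx G F (coordCurv G A F) z = _ :=
    hm.covDeriv_curvature hΩ hF hFO h.parallel_curvature hX hAX hAX hz (1, 0)
  rw [hm.covDeriv_endomorphism hΩ hF hFO h.smooth_endo h.parallel_endo hX hz] at hS1
  have hW1 : coordDx G F (coordAiry G A F) z =
      coordDx G F (coordDx G F (coordDx G F (coordUx F))) z
        + (1 / 2 : ℝ) • coordDx G F (coordCurv G A F) z := by
    have hd := fun {V : ℝ × ℝ → E} (hV : ContDiffOn ℝ ∞ V Ω) =>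
      (ContDiffOn.differentiableAt_infty hV hΩ hz).hasFDerivAt
    have hk := (hd hDDX).add ((hd hS).const_smul (1 / 2 : ℝ))
    rw [coordDx, covDeriv, show fderiv ℝ (coordAiry G A F) z = _ from hk.fderiv, coordAiry]
    simp only [coordDx, covDeriv, ← christoffelMap_apply, map_add, map_smul, _root_.add_apply,
      _root_.smul_apply, smul_add]
    abel
  rw [h.fderiv_coordDensity hΩ hF hFO hz, h.fderiv_coordFlux hΩ hF hFO α β hz]
  have hut := heq z hz
  -- This will cancel the curvature terms carrying `α`, once ∇_x S is expanded by the Leibniz rule.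
  have e1 := h.inner_schrodinger_term hy (coordUx F z) (coordDx G F (coordUx F) z)
  -- The curvature hypothesis with Y = ∇_x u_x removes ⟨R(∇_x u_x, u_x)u_x, S⟩, the one `β` term
  -- that is not an x-derivative.
  have e2 := h.curvature_identity _ hy (coordUx F z) (coordDx G F (coordUx F) z)
  have e3 : G (F z) (curvatureCoord G (F z) (coordUt F z) (coordUx F z) (coordUx F z))
      (coordDx G F (coordUx F) z) = G (F z) (coordUt F z)
        (curvatureCoord G (F z) (coordDx G F (coordUx F) z) (coordUx F z) (coordUx F z)) := by
    rw [hm.curvature_pair_symm hy, curvatureCoord_antisymm, map_neg, _root_.neg_apply,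
      hm.inner_curvature hy, neg_neg]
  rw [show curvatureCoord G (F z) (coordUx F z) (A (F z) (coordUx F z)) (A (F z) (coordUx F z)) =
    coordCurv G A F z from rfl] at e2
  have e1' : G (F z) (A (F z) (coordDx G F (coordUx F) z)) (coordDx G F (coordCurv G A F) z) +
      2 * G (F z) (A (F z) (coordDx G F (coordUx F) z))
        (curvatureCoord G (F z) (coordDx G F (coordUx F) z) (coordUx F z) (coordUx F z)) = 0 := by
    rw [hS1]
    exact e1
  rw [map_add, _root_.add_apply, e3]
  generalize coordDx G F (coordDx G F (coordUt F)) z = v2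
  generalize coordDx G F (coordUt F) z = v1
  have hsy := hm.symm _ hy
  rw [hut, hW1, coordAiry]
  clear hS1 hW1 hut e1 e3
  generalize curvatureCoord G (F z) (coordDx G F (coordUx F) z) (coordUx F z) (coordUx F z) = r at *
  generalize coordDx G F (coordDx G F (coordDx G F (coordUx F))) z = x3 at *
  generalize coordDx G F (coordDx G F (coordUx F)) z = x2 at *
  generalize coordDx G F (coordUx F) z = x1 at *
  generalize coordDx G F (coordCurv G A F) z = s1 at *
  generalize coordCurv G A F z = s at *
  simp only [map_add, map_smul, _root_.add_apply, _root_.smul_apply, smul_eq_mul]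
  rw [hsy x3 x2, hsy x3 s, hsy s1 x2, hsy s1 s, hsy x2 r, hsy s r, e2]
  -- With `e2` inserted the `β` terms match identically; only the Schrödinger identity remains.
  linear_combination α * e1'

end IsSymmetricKahlerOn

end ConservationLaw

end SchrodingerAiry

namespace SchrodingerAiry

set_option maxSynthPendingDepth 3
set_option synthInstance.maxHeartbeats 100000

/-! ### Naturality of the connection and curvature under local isometries -/

section Transformation

variable {E : Type*} [NormedAddCommGroup E] [NormedSpace ℝ E]
  {P : Type*} [NormedAddCommGroup P] [NormedSpace ℝ P]

/-- `τ` is a smooth map from `O` to `O'` with surjective derivative, under which the metric `G'` on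
`O'` pulls back to the metric `G` on `O`. -/
structure IsLocalIsometryOn (G G' : E → E →L[ℝ] E →L[ℝ] ℝ) (τ : E → E) (O O' : Set E) : Prop where
  source : IsMetricOn G O
  target : IsMetricOn G' O'
  smooth : ContDiffOn ℝ ∞ τ O
  mapsTo : MapsTo τ O O'
  pullback : ∀ y ∈ O, ∀ v w, G y v w = G' (τ y) (fderiv ℝ τ y v) (fderiv ℝ τ y w)
  surjective : ∀ y ∈ O, Function.Surjective (fderiv ℝ τ y)

namespace IsLocalIsometryOn

variable {G G' : E → E →L[ℝ] E →L[ℝ] ℝ} {τ : E → E} {O O' : Set E}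
  (h : IsLocalIsometryOn G G' τ O O') [FiniteDimensional ℝ E]
include h

/-- The transformation law of the Christoffel symbols. -/
theorem fderiv_christoffel {y : E} (hy : y ∈ O) (v w : E) :
    fderiv ℝ τ y (christoffel G y v w) =
      fderiv ℝ (fderiv ℝ τ) y v w + christoffel G' (τ y) (fderiv ℝ τ y v) (fderiv ℝ τ y w) := by
  have hy' := h.mapsTo hy
  have hO := h.source.isOpen
  have hτ := ContDiffOn.differentiableAt_infty h.smooth hO hy
  have hτ' := ContDiffOn.differentiableAt_infty
    (ContDiffOn.fderiv_of_isOpen_infty h.smooth hO) hO hy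
  have hG := h.source.differentiableAt hy
  have hG' := h.target.differentiableAt hy'
  have hd : ∀ a v w, fderiv ℝ G y a v w =
      fderiv ℝ G' (τ y) (fderiv ℝ τ y a) (fderiv ℝ τ y v) (fderiv ℝ τ y w)
        + G' (τ y) (fderiv ℝ (fderiv ℝ τ) y a v) (fderiv ℝ τ y w)
        + G' (τ y) (fderiv ℝ τ y v) (fderiv ℝ (fderiv ℝ τ) y a w) := by
    intro a v w
    have h1 : fderiv ℝ G y a v w = fderiv ℝ (fun y => G y v w) y a := by
      rw [fderiv_apply_apply₂ hG (by fun_prop) (by fun_prop)]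
      simp
    have h2 : (fun y => G y v w) =ᶠ[𝓝 y]
        fun y => G' (τ y) (fderiv ℝ τ y v) (fderiv ℝ τ y w) := by
      filter_upwards [hO.mem_nhds hy] with y' hy' using h.pullback y' hy' v w
    rw [h1, h2.fderiv_eq, fderiv_apply_apply₂ (B := fun y => G' (τ y)) (hG'.comp y hτ)
      (hτ'.clm_apply (by fun_prop)) (hτ'.clm_apply (by fun_prop)), fderiv_comp_apply' hG' hτ,
      fderiv_apply_apply hτ' (by fun_prop), fderiv_apply_apply hτ' (by fun_prop)]
    simp
  refine h.target.ext_inner hy' fun z' => ?_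
  -- Test vectors in the image of dτ suffice, and for these the two Koszul formulas can be compared.
  obtain ⟨z, rfl⟩ := h.surjective y hy z'
  have h1 := h.source.koszul hy v w z
  rw [h.pullback y hy, hd, hd, hd] at h1
  have h2 := h.target.koszul hy' (fderiv ℝ τ y v) (fderiv ℝ τ y w) (fderiv ℝ τ y z)
  rw [fderiv_fderiv_comm h.smooth hO hy w v, fderiv_fderiv_comm h.smooth hO hy z v,
    fderiv_fderiv_comm h.smooth hO hy z w,
    h.target.symm _ hy' (fderiv ℝ (fderiv ℝ τ) y v z) (fderiv ℝ τ y w)] at h1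
  rw [map_add, _root_.add_apply]
  linarith

/-- Local isometries preserve covariant derivatives. -/
theorem covDeriv_comp {F V : P → E} {z : P} (hz : F z ∈ O) (hF : DifferentiableAt ℝ F z)
    (hV : DifferentiableAt ℝ V z) (a : P) :
    covDeriv G' (fun z => τ (F z)) (fun z => fderiv ℝ τ (F z) (V z)) a z =
      fderiv ℝ τ (F z) (covDeriv G F V a z) := by
  have hO := h.source.isOpen
  have hτ := ContDiffOn.differentiableAt_infty h.smooth hO hz
  have hτ' := ContDiffOn.differentiableAt_infty
    (ContDiffOn.fderiv_of_isOpen_infty h.smooth hO) hO hz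
  rw [covDeriv, covDeriv, map_add, h.fderiv_christoffel hz, fderiv_comp_apply' hτ hF,
    fderiv_apply_apply (L := fun z => fderiv ℝ τ (F z)) (hτ'.comp z hF) hV,
    fderiv_comp_apply' hτ' hF]
  abel

/-- Local isometries preserve the curvature. -/
theorem fderiv_curvatureCoord {y : E} (hy : y ∈ O) (v w z : E) :
    fderiv ℝ τ y (curvatureCoord G y v w z) =
      curvatureCoord G' (τ y) (fderiv ℝ τ y v) (fderiv ℝ τ y w) (fderiv ℝ τ y z) := by
  -- Viewing R as a commutator of covariant derivatives, which τ preserves, avoids differentiating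
  -- the transformation law of Γ and hence third derivatives of τ.
  obtain ⟨F, hF, rfl, rfl, rfl⟩ := exists_affine_surface y v w
  have hG := h.source
  have hO := hG.isOpen
  have hΩ : IsOpen (F ⁻¹' O) := hO.preimage hF.continuous
  have hFO := mapsTo_preimage F O
  have hFd : ∀ p, DifferentiableAt ℝ F p := fun p => hF.differentiable (by simp) p
  have hc : ContDiffOn ℝ ∞ (fun _ : ℝ × ℝ => z) (F ⁻¹' O) := contDiffOn_const
  have hD := fun c => hG.contDiffOn_covDeriv hΩ hF.contDiffOn hFO hc c
  have hτF : ContDiffOn ℝ ∞ (fun p => τ (F p)) (F ⁻¹' O) := h.smooth.comp hF.contDiffOn hFO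
  have hτFO : MapsTo (fun p => τ (F p)) (F ⁻¹' O) O' := fun p hp => h.mapsTo hp
  have hτV : ContDiffOn ℝ ∞ (fun p => fderiv ℝ τ (F p) z) (F ⁻¹' O) :=
    ((ContDiffOn.fderiv_of_isOpen_infty h.smooth hO).comp hF.contDiffOn hFO).clm_apply hc
  have key : ∀ a b, covDeriv G' (fun p => τ (F p))
      (covDeriv G' (fun p => τ (F p)) (fun p => fderiv ℝ τ (F p) z) b) a 0 =
      fderiv ℝ τ (F 0) (covDeriv G F (covDeriv G F (fun _ => z) b) a 0) := by
    intro a b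
    rw [← h.covDeriv_comp hy (hFd 0) (ContDiffOn.differentiableAt_infty (hD b) hΩ hy)]
    apply covDeriv_congr
    filter_upwards [hΩ.mem_nhds hy] with p hp using
      h.covDeriv_comp hp (hFd p) (ContDiffOn.differentiableAt_infty hc hΩ hp) b
  have h1 := h.target.covDeriv_covDeriv_sub hΩ hτF hτFO hτV hy (1, 0) (0, 1)
  have hτ := ContDiffOn.differentiableAt_infty h.smooth hO hy
  rw [fderiv_comp_apply' hτ (hFd 0), fderiv_comp_apply' hτ (hFd 0)] at h1
  rw [← hG.covDeriv_covDeriv_sub hΩ hF.contDiffOn hFO hc hy, map_sub, ← h1, key, key]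

end IsLocalIsometryOn

end Transformation

end SchrodingerAiry

namespace SchrodingerAiry

set_option maxSynthPendingDepth 3
set_option synthInstance.maxHeartbeats 100000

/-! ### Tensors on the manifold and their expressions in a chart -/

section Charts

variable {E : Type*} [NormedAddCommGroup E] [NormedSpace ℝ E]
  {M : Type*} [TopologicalSpace M] [ChartedSpace E M]

/-- The derivative at `q` of the preferred chart at `p`. -/
noncomputable def chartDeriv (p q : M) : E →L[ℝ] E :=
  mfderiv 𝓘(ℝ, E) 𝓘(ℝ, E) (extChartAt 𝓘(ℝ, E) p) q

/-- The derivative at `y` of the inverse of the preferred chart at `p`. -/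
noncomputable def chartSymmDeriv (p : M) (y : E) : E →L[ℝ] E :=
  mfderiv 𝓘(ℝ, E) 𝓘(ℝ, E) (extChartAt 𝓘(ℝ, E) p).symm y

/-- The bilinear form `g` at `q`, on the model vector space. -/
def formAt (g : ∀ q : M, TangentSpace 𝓘(ℝ, E) q →L[ℝ] TangentSpace 𝓘(ℝ, E) q →L[ℝ] ℝ) (q : M) :
    E →L[ℝ] E →L[ℝ] ℝ := g q

/-- The endomorphism `J` at `q`, on the model vector space. -/
def endoAt (J : ∀ q : M, TangentSpace 𝓘(ℝ, E) q →L[ℝ] TangentSpace 𝓘(ℝ, E) q) (q : M) :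
    E →L[ℝ] E := J q

/-- The curvature at `q`, on the model vector space. -/
noncomputable def curvatureAt
    (g : ∀ q : M, TangentSpace 𝓘(ℝ, E) q →L[ℝ] TangentSpace 𝓘(ℝ, E) q →L[ℝ] ℝ) (q : M)
    (v w z : E) : E := curvature 𝓘(ℝ, E) g q v w z

theorem metricInChart_apply
    (g : ∀ q : M, TangentSpace 𝓘(ℝ, E) q →L[ℝ] TangentSpace 𝓘(ℝ, E) q →L[ℝ] ℝ) (p : M) (y v w : E) :
    metricInChart 𝓘(ℝ, E) g p y v w =
      formAt g ((extChartAt 𝓘(ℝ, E) p).symm y) (chartSymmDeriv p y v) (chartSymmDeriv p y w) :=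
  rfl

theorem complexStructureInChart_apply
    (J : ∀ q : M, TangentSpace 𝓘(ℝ, E) q →L[ℝ] TangentSpace 𝓘(ℝ, E) q) (p : M) (y v : E) :
    complexStructureInChart 𝓘(ℝ, E) J p y v =
      chartDeriv p ((extChartAt 𝓘(ℝ, E) p).symm y)
        (endoAt J ((extChartAt 𝓘(ℝ, E) p).symm y) (chartSymmDeriv p y v)) :=
  rfl

variable [IsManifold 𝓘(ℝ, E) ∞ M]

theorem isManifold_one : IsManifold 𝓘(ℝ, E) 1 M := IsManifold.of_le (n := ∞) (by simp)

theorem chartDeriv_self (p : M) (v : E) : chartDeriv p p v = v := by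
  have := isManifold_one (E := E) (M := M)
  rw [chartDeriv, mfderiv_extChartAt_self]
  rfl

theorem chartDeriv_chartSymmDeriv {p : M} {y : E} (hy : y ∈ (extChartAt 𝓘(ℝ, E) p).target) (v : E) :
    chartDeriv p ((extChartAt 𝓘(ℝ, E) p).symm y) (chartSymmDeriv p y v) = v := by
  have := isManifold_one (E := E) (M := M)
  have h := mfderiv_extChartAt_comp_mfderivWithin_extChartAt_symm (I := 𝓘(ℝ, E)) hy
  rw [modelWithCornersSelf_coe, range_id, mfderivWithin_univ] at h
  exact congrArg (fun L : E →L[ℝ] E => L v) h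

theorem chartSymmDeriv_chartDeriv {p q : M} (hq : q ∈ (extChartAt 𝓘(ℝ, E) p).source) (v : E) :
    chartSymmDeriv p (extChartAt 𝓘(ℝ, E) p q) (chartDeriv p q v) = v := by
  have := isManifold_one (E := E) (M := M)
  have h := mfderivWithin_extChartAt_symm_comp_mfderiv_extChartAt' (I := 𝓘(ℝ, E)) hq
  rw [modelWithCornersSelf_coe, range_id, mfderivWithin_univ] at h
  exact congrArg (fun L : E →L[ℝ] E => L v) h

theorem mdifferentiableAt_extChartAt' {p q : M} (hq : q ∈ (extChartAt 𝓘(ℝ, E) p).source) :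
    MDifferentiableAt 𝓘(ℝ, E) 𝓘(ℝ, E) (extChartAt 𝓘(ℝ, E) p) q := by
  have := isManifold_one (E := E) (M := M)
  exact mdifferentiableAt_extChartAt (by simpa using hq)

theorem contMDiffOn_extChartAt' (p : M) :
    ContMDiffOn 𝓘(ℝ, E) 𝓘(ℝ, E) ∞ (extChartAt 𝓘(ℝ, E) p) (extChartAt 𝓘(ℝ, E) p).source := by
  rw [extChartAt_source]
  exact contMDiffOn_extChartAt

theorem mdifferentiableAt_extChartAt_symm {p : M} {y : E}
    (hy : y ∈ (extChartAt 𝓘(ℝ, E) p).target) :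
    MDifferentiableAt 𝓘(ℝ, E) 𝓘(ℝ, E) (extChartAt 𝓘(ℝ, E) p).symm y :=
  ((contMDiffOn_extChartAt_symm (n := ∞) p).contMDiffAt
    ((isOpen_extChartAt_target p).mem_nhds hy)).mdifferentiableAt (by simp)

/-- The metric at `q`, expressed in the chart at `p`. -/
theorem inner_eq_metricInChart
    (g : ∀ q : M, TangentSpace 𝓘(ℝ, E) q →L[ℝ] TangentSpace 𝓘(ℝ, E) q →L[ℝ] ℝ) {p q : M}
    (hq : q ∈ (extChartAt 𝓘(ℝ, E) p).source) (v w : E) :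
    formAt g q v w =
      metricInChart 𝓘(ℝ, E) g p (extChartAt 𝓘(ℝ, E) p q) (chartDeriv p q v) (chartDeriv p q w) := by
  rw [metricInChart_apply, chartSymmDeriv_chartDeriv hq, chartSymmDeriv_chartDeriv hq,
    (extChartAt 𝓘(ℝ, E) p).left_inv hq]

/-- The complex structure at `q`, expressed in the chart at `p`. -/
theorem chartDeriv_endo
    (J : ∀ q : M, TangentSpace 𝓘(ℝ, E) q →L[ℝ] TangentSpace 𝓘(ℝ, E) q) {p q : M}
    (hq : q ∈ (extChartAt 𝓘(ℝ, E) p).source) (v : E) :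
    chartDeriv p q (endoAt J q v) =
      complexStructureInChart 𝓘(ℝ, E) J p (extChartAt 𝓘(ℝ, E) p q) (chartDeriv p q v) := by
  rw [complexStructureInChart_apply, chartSymmDeriv_chartDeriv hq,
    (extChartAt 𝓘(ℝ, E) p).left_inv hq]

/-- The domain of the change of charts from `p` to `p'`. -/
def transitionDomain (E : Type*) [NormedAddCommGroup E] [NormedSpace ℝ E] {M : Type*}
    [TopologicalSpace M] [ChartedSpace E M] (p p' : M) : Set E :=
  (extChartAt 𝓘(ℝ, E) p).target ∩ (extChartAt 𝓘(ℝ, E) p).symm ⁻¹' (extChartAt 𝓘(ℝ, E) p').source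

/-- The change of charts from `p` to `p'`. -/
noncomputable def transition (p p' : M) (y : E) : E :=
  extChartAt 𝓘(ℝ, E) p' ((extChartAt 𝓘(ℝ, E) p).symm y)

omit [IsManifold 𝓘(ℝ, E) ∞ M] in
theorem isOpen_transitionDomain (p p' : M) : IsOpen (transitionDomain E p p') :=
  (continuousOn_extChartAt_symm p).isOpen_inter_preimage (isOpen_extChartAt_target p)
    (isOpen_extChartAt_source p')

theorem contDiffOn_transition (p p' : M) :
    ContDiffOn ℝ ∞ (transition p p' : E → E) (transitionDomain E p p') := by
  rw [← contMDiffOn_iff_contDiffOn]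
  exact (contMDiffOn_extChartAt' p').comp
    ((contMDiffOn_extChartAt_symm p).mono inter_subset_left) fun y hy => hy.2

theorem fderiv_transition {p p' : M} {y : E} (hy : y ∈ transitionDomain E p p') (v : E) :
    fderiv ℝ (transition p p') y v =
      chartDeriv p' ((extChartAt 𝓘(ℝ, E) p).symm y) (chartSymmDeriv p y v) := by
  have h := mfderiv_comp (I := 𝓘(ℝ, E)) (I' := 𝓘(ℝ, E)) (I'' := 𝓘(ℝ, E)) y
    (mdifferentiableAt_extChartAt' (p := p') hy.2) (mdifferentiableAt_extChartAt_symm hy.1)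
  rw [mfderiv_eq_fderiv] at h
  exact congrArg (fun L : E →L[ℝ] E => L v) h

omit [IsManifold 𝓘(ℝ, E) ∞ M] in
theorem mem_transitionDomain {p p' q : M} (hq : q ∈ (extChartAt 𝓘(ℝ, E) p).source)
    (hq' : q ∈ (extChartAt 𝓘(ℝ, E) p').source) :
    extChartAt 𝓘(ℝ, E) p q ∈ transitionDomain E p p' := by
  refine ⟨(extChartAt 𝓘(ℝ, E) p).map_source hq, ?_⟩
  rw [mem_preimage, (extChartAt 𝓘(ℝ, E) p).left_inv hq]
  exact hq'

theorem fderiv_transition_chartDeriv {p p' q : M} (hq : q ∈ (extChartAt 𝓘(ℝ, E) p).source)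
    (hq' : q ∈ (extChartAt 𝓘(ℝ, E) p').source) (v : E) :
    fderiv ℝ (transition p p') (extChartAt 𝓘(ℝ, E) p q) (chartDeriv p q v) = chartDeriv p' q v := by
  rw [fderiv_transition (mem_transitionDomain hq hq'), chartSymmDeriv_chartDeriv hq,
    (extChartAt 𝓘(ℝ, E) p).left_inv hq]

omit [IsManifold 𝓘(ℝ, E) ∞ M] in
theorem transition_extChartAt {p p' q : M} (hq : q ∈ (extChartAt 𝓘(ℝ, E) p).source) :
    transition p p' (extChartAt 𝓘(ℝ, E) p q) = extChartAt 𝓘(ℝ, E) p' q := by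
  rw [transition, (extChartAt 𝓘(ℝ, E) p).left_inv hq]

/-- A vector field along a map into the domain of a chart is smooth when its coordinates are. -/
theorem contMDiffOn_field_iff {p : M} {b : E → M} {Ω : Set E}
    (hb : ContMDiffOn 𝓘(ℝ, E) 𝓘(ℝ, E) ∞ b Ω) (hbs : MapsTo b Ω (extChartAt 𝓘(ℝ, E) p).source)
    (W : E → E) :
    ContMDiffOn 𝓘(ℝ, E) (𝓘(ℝ, E).prod 𝓘(ℝ, E)) ∞
      (fun y => TotalSpace.mk' E (E := fun q : M => TangentSpace 𝓘(ℝ, E) q) (b y) (W y)) Ω ↔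
    ContDiffOn ℝ ∞ (fun y => chartDeriv p (b y) (W y)) Ω := by
  have hM := isManifold_one (E := E) (M := M)
  have hbs' : ∀ y ∈ Ω, b y ∈ (chartAt E p).source := fun y hy => by
    simpa [extChartAt_source] using hbs hy
  rw [Trivialization.contMDiffOn_iff (e := trivializationAt E (TangentSpace 𝓘(ℝ, E)) p)
    (fun y hy => by
      rw [Trivialization.mem_source]
      simpa using hbs' y hy)]
  -- On each fibre the trivialization of the tangent bundle at `p` is the derivative of the chart at
  -- `p`.
  have h : ∀ y ∈ Ω, (trivializationAt E (TangentSpace 𝓘(ℝ, E)) p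
      (TotalSpace.mk' E (E := fun q : M => TangentSpace 𝓘(ℝ, E) q) (b y) (W y))).2 =
      chartDeriv p (b y) (W y) := by
    intro y hy
    have h1 := TangentBundle.continuousLinearMapAt_trivializationAt (I := 𝓘(ℝ, E)) (hbs' y hy)
    have h2 := congrArg (fun L : E →L[ℝ] E => L (W y)) h1
    refine Eq.trans ?_ h2
    have h3 := congrFun (Trivialization.continuousLinearMapAt_apply ℝ
      (trivializationAt E (TangentSpace 𝓘(ℝ, E)) p) (b y)) (W y)
    refine Eq.trans ?_ h3.symm
    exact (congrFun (Trivialization.coe_linearMapAt_of_mem (R := ℝ)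
      (trivializationAt E (TangentSpace 𝓘(ℝ, E)) p) (by simpa using hbs' y hy)) (W y)).symm
  rw [← contMDiffOn_iff_contDiffOn]
  exact ⟨fun h' => h'.2.congr fun y hy => (h y hy).symm, fun h' => ⟨hb, h'.congr h⟩⟩

/-- These are the coordinate fields of the chart at `p`: their expression in that chart is constant.
Evaluating smooth tensors on them gives smooth coefficients. -/
theorem contMDiffOn_chartSymmDeriv (p : M) (v : E) :
    ContMDiffOn 𝓘(ℝ, E) (𝓘(ℝ, E).prod 𝓘(ℝ, E)) ∞
      (fun y => TotalSpace.mk' E (E := fun q : M => TangentSpace 𝓘(ℝ, E) q)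
        ((extChartAt 𝓘(ℝ, E) p).symm y) (chartSymmDeriv p y v)) (extChartAt 𝓘(ℝ, E) p).target :=
  (contMDiffOn_field_iff (contMDiffOn_extChartAt_symm p) (fun _ => (extChartAt 𝓘(ℝ, E) p).map_target) _).2
    (contDiffOn_const.congr fun _ hy => chartDeriv_chartSymmDeriv hy v)

theorem contDiffOn_metricInChart_apply
    (h : ContMDiffRiemannianMetric 𝓘(ℝ, E) ∞ E (fun p : M => TangentSpace 𝓘(ℝ, E) p)) (p : M)
    (v w : E) : ContDiffOn ℝ ∞ (fun y => metricInChart 𝓘(ℝ, E) h.inner p y v w)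
      (extChartAt 𝓘(ℝ, E) p).target := by
  have hM := isManifold_one (E := E) (M := M)
  rw [← contMDiffOn_iff_contDiffOn]
  intro y hy
  have h1 : ContMDiffWithinAt 𝓘(ℝ, E) (𝓘(ℝ, E).prod 𝓘(ℝ)) ∞
      (fun y => TotalSpace.mk' ℝ (E := Bundle.Trivial M ℝ) ((extChartAt 𝓘(ℝ, E) p).symm y)
        (formAt h.inner ((extChartAt 𝓘(ℝ, E) p).symm y) (chartSymmDeriv p y v)
          (chartSymmDeriv p y w))) (extChartAt 𝓘(ℝ, E) p).target y := by
    apply ContMDiffWithinAt.clm_bundle_apply₂ (F₁ := E) (F₂ := E)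
      (E₁ := fun p : M => TangentSpace 𝓘(ℝ, E) p) (E₂ := fun p : M => TangentSpace 𝓘(ℝ, E) p)
    · exact h.contMDiff.contMDiffAt.comp_contMDiffWithinAt y
        (contMDiffOn_extChartAt_symm (n := ∞) p y hy)
    · exact contMDiffOn_chartSymmDeriv p v y hy
    · exact contMDiffOn_chartSymmDeriv p w y hy
  rw [contMDiffWithinAt_totalSpace] at h1
  exact h1.2

variable [FiniteDimensional ℝ E]

theorem contDiffOn_metricInChart
    (h : ContMDiffRiemannianMetric 𝓘(ℝ, E) ∞ E (fun p : M => TangentSpace 𝓘(ℝ, E) p)) (p : M) :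
    ContDiffOn ℝ ∞ (metricInChart 𝓘(ℝ, E) h.inner p) (extChartAt 𝓘(ℝ, E) p).target := by
  refine contDiffOn_clm_apply.2 fun v => ?_
  refine contDiffOn_clm_apply.2 fun w => ?_
  exact contDiffOn_metricInChart_apply h p v w

theorem isMetricOn_metricInChart
    (h : ContMDiffRiemannianMetric 𝓘(ℝ, E) ∞ E (fun p : M => TangentSpace 𝓘(ℝ, E) p)) (p : M) :
    IsMetricOn (metricInChart 𝓘(ℝ, E) h.inner p) (extChartAt 𝓘(ℝ, E) p).target where
  isOpen := isOpen_extChartAt_target p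
  smooth := contDiffOn_metricInChart h p
  symm y _ v w := by
    rw [metricInChart_apply, metricInChart_apply]
    exact h.symm ((extChartAt 𝓘(ℝ, E) p).symm y) (chartSymmDeriv p y v) (chartSymmDeriv p y w)
  pos y hy v hv := by
    rw [metricInChart_apply]
    refine h.pos ((extChartAt 𝓘(ℝ, E) p).symm y) (chartSymmDeriv p y v) fun h0 => hv ?_
    have h1 := chartDeriv_chartSymmDeriv hy v
    have h2 : chartSymmDeriv p y v = 0 := h0
    rw [← h1, h2, map_zero]

/-- Both coordinate metrics are pullbacks of one metric on the manifold. -/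
theorem isLocalIsometryOn_transition
    (h : ContMDiffRiemannianMetric 𝓘(ℝ, E) ∞ E (fun p : M => TangentSpace 𝓘(ℝ, E) p)) (p p' : M) :
    IsLocalIsometryOn (metricInChart 𝓘(ℝ, E) h.inner p) (metricInChart 𝓘(ℝ, E) h.inner p')
      (transition p p') (transitionDomain E p p') (extChartAt 𝓘(ℝ, E) p').target where
  source := by
    have := isMetricOn_metricInChart h p
    exact ⟨isOpen_transitionDomain p p', this.smooth.mono inter_subset_left,
      fun y hy => this.symm y hy.1, fun y hy => this.pos y hy.1⟩
  target := isMetricOn_metricInChart h p'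
  smooth := contDiffOn_transition p p'
  mapsTo y hy := (extChartAt 𝓘(ℝ, E) p').map_source hy.2
  pullback y hy v w := by
    rw [fderiv_transition hy, fderiv_transition hy, transition]
    exact inner_eq_metricInChart h.inner hy.2 _ _
  surjective y hy v := by
    -- The preimage is the derivative of the reverse change of charts, applied to `v`.
    refine ⟨chartDeriv p ((extChartAt 𝓘(ℝ, E) p).symm y) (chartSymmDeriv p' (transition p p' y) v), ?_⟩
    have h1 := fderiv_transition_chartDeriv (p := p) (p' := p')
      ((extChartAt 𝓘(ℝ, E) p).map_target hy.1) hy.2 (chartSymmDeriv p' (transition p p' y) v)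
    rw [(extChartAt 𝓘(ℝ, E) p).right_inv hy.1] at h1
    rw [h1]
    have h2 := chartDeriv_chartSymmDeriv (p := p') ((extChartAt 𝓘(ℝ, E) p').map_source hy.2) v
    rwa [(extChartAt 𝓘(ℝ, E) p').left_inv hy.2] at h2

/-- The curvature at `q`, expressed in the chart at `p`. -/
theorem chartDeriv_curvature
    (h : ContMDiffRiemannianMetric 𝓘(ℝ, E) ∞ E (fun p : M => TangentSpace 𝓘(ℝ, E) p)) {p q : M}
    (hq : q ∈ (extChartAt 𝓘(ℝ, E) p).source) (v w z : E) :
    chartDeriv p q (curvatureAt h.inner q v w z) =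
      curvatureCoord (metricInChart 𝓘(ℝ, E) h.inner p) (extChartAt 𝓘(ℝ, E) p q)
        (chartDeriv p q v) (chartDeriv p q w) (chartDeriv p q z) := by
  have hqq := mem_extChartAt_source (I := 𝓘(ℝ, E)) q
  -- The curvature at `q` is defined in the chart at `q`; naturality carries it to the chart at `p`.
  have h1 := (isLocalIsometryOn_transition h q p).fderiv_curvatureCoord
    (mem_transitionDomain hqq hq) v w z
  have h2 : ∀ v, fderiv ℝ (transition q p) (extChartAt 𝓘(ℝ, E) q q) v = chartDeriv p q v := by
    intro v
    rw [← fderiv_transition_chartDeriv hqq hq, chartDeriv_self]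
  rw [h2, h2, h2, h2, transition_extChartAt hqq] at h1
  exact h1

theorem isAlmostHermitianOn_inChart
    {h : ContMDiffRiemannianMetric 𝓘(ℝ, E) ∞ E (fun p : M => TangentSpace 𝓘(ℝ, E) p)}
    {J : ∀ p : M, TangentSpace 𝓘(ℝ, E) p →L[ℝ] TangentSpace 𝓘(ℝ, E) p}
    (hK : IsKahler 𝓘(ℝ, E) h J) (p : M) :
    IsAlmostHermitianOn (metricInChart 𝓘(ℝ, E) h.inner p) (complexStructureInChart 𝓘(ℝ, E) J p)
      (extChartAt 𝓘(ℝ, E) p).target where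
  toIsMetricOn := isMetricOn_metricInChart h p
  smooth_endo := by
    have hM := isManifold_one (E := E) (M := M)
    rw [contDiffOn_clm_apply]
    intro v
    have hJ := hK.smooth.comp_contMDiffOn (contMDiffOn_extChartAt_symm (n := ∞) p)
    have h1 := ContMDiffOn.clm_bundle_apply (F₁ := E) (F₂ := E)
      (E₁ := fun p : M => TangentSpace 𝓘(ℝ, E) p) (E₂ := fun p : M => TangentSpace 𝓘(ℝ, E) p)
      hJ (contMDiffOn_chartSymmDeriv p v)
    exact (contMDiffOn_field_iff (contMDiffOn_extChartAt_symm p)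
      (fun _ hy => (extChartAt 𝓘(ℝ, E) p).map_target hy) _).1 h1
  sq_eq_neg y hy v := by
    have hs := (extChartAt 𝓘(ℝ, E) p).map_target hy
    have h1 := chartDeriv_endo J hs (endoAt J ((extChartAt 𝓘(ℝ, E) p).symm y) (chartSymmDeriv p y v))
    rw [(extChartAt 𝓘(ℝ, E) p).right_inv hy, ← complexStructureInChart_apply] at h1
    have h2 : endoAt J ((extChartAt 𝓘(ℝ, E) p).symm y)
        (endoAt J ((extChartAt 𝓘(ℝ, E) p).symm y) (chartSymmDeriv p y v)) = -chartSymmDeriv p y v :=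
      hK.sq_eq_neg _ _
    rw [← h1, h2, map_neg, chartDeriv_chartSymmDeriv hy]
  isometric y hy v w := by
    have hs := (extChartAt 𝓘(ℝ, E) p).map_target hy
    have h1 := inner_eq_metricInChart h.inner hs (endoAt J ((extChartAt 𝓘(ℝ, E) p).symm y) (chartSymmDeriv p y v))
      (endoAt J ((extChartAt 𝓘(ℝ, E) p).symm y) (chartSymmDeriv p y w))
    rw [(extChartAt 𝓘(ℝ, E) p).right_inv hy] at h1
    rw [complexStructureInChart_apply, complexStructureInChart_apply, ← h1, metricInChart_apply]
    exact hK.isometric _ _ _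

/-- A locally Hermitian symmetric space satisfying the curvature identity, in a chart. -/
theorem isSymmetricKahlerOn_inChart
    {h : ContMDiffRiemannianMetric 𝓘(ℝ, E) ∞ E (fun p : M => TangentSpace 𝓘(ℝ, E) p)}
    {J : ∀ p : M, TangentSpace 𝓘(ℝ, E) p →L[ℝ] TangentSpace 𝓘(ℝ, E) p}
    (hK : IsLocallyHermitianSymmetric 𝓘(ℝ, E) h J)
    (hcurv : ∀ (p : M) (X Y : TangentSpace 𝓘(ℝ, E) p),
      h.inner p (curvature 𝓘(ℝ, E) h.inner p Y X X)
        (curvature 𝓘(ℝ, E) h.inner p X (J p X) (J p X)) = 0) (p : M) :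
    IsSymmetricKahlerOn (metricInChart 𝓘(ℝ, E) h.inner p) (complexStructureInChart 𝓘(ℝ, E) J p)
      (extChartAt 𝓘(ℝ, E) p).target where
  toIsAlmostHermitianOn := isAlmostHermitianOn_inChart hK.toIsKahler p
  parallel_endo y hy a v := (isAlmostHermitianOn_inChart hK.toIsKahler p).nabla_endo_eq_zero hy
    (hK.integrable p y hy) (hK.closed p y hy) a v
  parallel_curvature y hy := hK.parallel p y hy
  curvature_identity y hy v w := by
    have hs := (extChartAt 𝓘(ℝ, E) p).map_target hy
    set q := (extChartAt 𝓘(ℝ, E) p).symm y with hq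
    have h0 : extChartAt 𝓘(ℝ, E) p q = y := (extChartAt 𝓘(ℝ, E) p).right_inv hy
    set v' := chartSymmDeriv p y v with hv'
    set w' := chartSymmDeriv p y w with hw'
    have h2 : formAt h.inner q (curvatureAt h.inner q w' v' v')
      (curvatureAt h.inner q v' (endoAt J q v') (endoAt J q v')) = 0 := hcurv q v' w'
    rw [inner_eq_metricInChart h.inner hs, chartDeriv_curvature h hs, chartDeriv_curvature h hs, chartDeriv_endo J hs, h0, hv', hw',
      chartDeriv_chartSymmDeriv hy, chartDeriv_chartSymmDeriv hy] at h2
    exact h2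

end Charts

end SchrodingerAiry

namespace SchrodingerAiry

set_option maxSynthPendingDepth 3
set_option synthInstance.maxHeartbeats 100000

/-! ### Restriction to lines and translation invariance -/

section Translation

variable {E : Type*} [NormedAddCommGroup E] [NormedSpace ℝ E]

theorem covDeriv_line {G : E → E →L[ℝ] E →L[ℝ] ℝ} {F V : ℝ × ℝ → E} {x t : ℝ}
    (hF : DifferentiableAt ℝ F (x, t)) (hV : DifferentiableAt ℝ V (x, t)) :
    covDeriv G (fun x => F (x, t)) (fun x => V (x, t)) (1 : ℝ) x = covDeriv G F V (1, 0) (x, t) := by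
  have h : ∀ {f : ℝ × ℝ → E}, DifferentiableAt ℝ f (x, t) →
      fderiv ℝ (fun x => f (x, t)) x 1 = fderiv ℝ f (x, t) (1, 0) := by
    intro f hf
    have h1 : HasFDerivAt (fun x : ℝ => (x, t)) (ContinuousLinearMap.inl ℝ ℝ ℝ) x :=
      hasFDerivAt_prodMk_left x t
    have h2 := (hf.hasFDerivAt.comp x h1).fderiv
    rw [show (fun x => f (x, t)) = f ∘ fun x => (x, t) from rfl, h2]
    simp
  rw [covDeriv, covDeriv, h hF, h hV]

theorem covDeriv_comp_add_right {P : Type*} [NormedAddCommGroup P] [NormedSpace ℝ P]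
    (G : E → E →L[ℝ] E →L[ℝ] ℝ) (F V : P → E) (a c : P) :
    covDeriv G (fun z => F (z + c)) (fun z => V (z + c)) a = fun z => covDeriv G F V a (z + c) := by
  funext z
  rw [covDeriv, covDeriv, fderiv_comp_add_right, fderiv_comp_add_right]

theorem coordFlux_comp_add_right (G : E → E →L[ℝ] E →L[ℝ] ℝ) (A : E → E →L[ℝ] E)
    (F : ℝ × ℝ → E) (α β : ℝ) (c z : ℝ × ℝ) :
    coordFlux G A (fun z => F (z + c)) α β z = coordFlux G A F α β (z + c) := by
  have h1 : coordUx (fun z => F (z + c)) = fun z => coordUx F (z + c) := by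
    funext z
    rw [coordUx, coordUx, fderiv_comp_add_right]
  have h2 : coordUt (fun z => F (z + c)) = fun z => coordUt F (z + c) := by
    funext z
    rw [coordUt, coordUt, fderiv_comp_add_right]
  have h3 : ∀ V, coordDx G (fun z => F (z + c)) (fun z => V (z + c)) =
      fun z => coordDx G F V (z + c) := fun V => covDeriv_comp_add_right G F V _ c
  have h4 : coordAiry G A (fun z => F (z + c)) = fun z => coordAiry G A F (z + c) := by
    funext z
    simp only [coordAiry, coordCurv, h1, h3]
  simp only [coordFlux, h1, h2, h3, h4]

end Translation

/-! ### Covariant derivatives along curves in a fixed chart -/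

section Curves

variable {E : Type*} [NormedAddCommGroup E] [NormedSpace ℝ E]
  {M : Type*} [TopologicalSpace M] [ChartedSpace E M]

/-- The velocity of a curve, in the model vector space. -/
noncomputable def velocityAt (c : ℝ → M) (s : ℝ) : E := velocity 𝓘(ℝ, E) c s

/-- The covariant derivative along a curve, in the model vector space. -/
noncomputable def covDerivAt
    (g : ∀ q : M, TangentSpace 𝓘(ℝ, E) q →L[ℝ] TangentSpace 𝓘(ℝ, E) q →L[ℝ] ℝ)
    (c : ℝ → M) (V : ℝ → E) (s : ℝ) : E :=
  covDerivAlong 𝓘(ℝ, E) g c V s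

variable [IsManifold 𝓘(ℝ, E) ∞ M]

theorem hasDerivAt_extChartAt_comp {c : ℝ → M} {s : ℝ} (hc : MDifferentiableAt 𝓘(ℝ, ℝ) 𝓘(ℝ, E) c s)
    {p : M} (hp : c s ∈ (extChartAt 𝓘(ℝ, E) p).source) :
    HasDerivAt (fun s' => extChartAt 𝓘(ℝ, E) p (c s')) (chartDeriv p (c s) (velocityAt c s)) s := by
  have h1 := (mdifferentiableAt_extChartAt' hp).hasMFDerivAt.comp s hc.hasMFDerivAt
  let L : ℝ →L[ℝ] E := mfderiv 𝓘(ℝ, ℝ) 𝓘(ℝ, E) c s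
  have h2 : HasFDerivAt (fun s' => extChartAt 𝓘(ℝ, E) p (c s')) (chartDeriv p (c s) ∘L L) s :=
    hasMFDerivAt_iff_hasFDerivAt.1 h1
  exact h2.hasDerivAt

/-- By definition the derivative at `s` uses the chart at `c s`, which moves with `s`. Naturality
under the change of charts replaces it by a fixed chart at `p`, so that ∇ can be iterated. -/
theorem chartDeriv_covDerivAt [FiniteDimensional ℝ E]
    (h : ContMDiffRiemannianMetric 𝓘(ℝ, E) ∞ E (fun p : M => TangentSpace 𝓘(ℝ, E) p))
    {c : ℝ → M} {V : ℝ → E} {s : ℝ} (hc : MDifferentiableAt 𝓘(ℝ, ℝ) 𝓘(ℝ, E) c s)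
    {p : M} (hp : c s ∈ (extChartAt 𝓘(ℝ, E) p).source)
    (hV : DifferentiableAt ℝ (fun s' => chartDeriv p (c s') (V s')) s) :
    chartDeriv p (c s) (covDerivAt h.inner c V s) =
      covDeriv (metricInChart 𝓘(ℝ, E) h.inner p) (fun s' => extChartAt 𝓘(ℝ, E) p (c s'))
        (fun s' => chartDeriv p (c s') (V s')) (1 : ℝ) s := by
  set q := c s with hq
  have hqq : q ∈ (extChartAt 𝓘(ℝ, E) q).source := mem_extChartAt_source (I := 𝓘(ℝ, E)) q
  have hF := hasDerivAt_extChartAt_comp hc hp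
  have hτ := (isLocalIsometryOn_transition h p q).covDeriv_comp
    (F := fun s' => extChartAt 𝓘(ℝ, E) p (c s')) (mem_transitionDomain hp hqq)
    hF.differentiableAt hV (1 : ℝ)
  have hnear : ∀ᶠ s' in 𝓝 s, c s' ∈ (extChartAt 𝓘(ℝ, E) p).source ∧
      c s' ∈ (extChartAt 𝓘(ℝ, E) q).source :=
    (hc.continuousAt.eventually_mem ((isOpen_extChartAt_source p).mem_nhds hp)).and
      (hc.continuousAt.eventually_mem ((isOpen_extChartAt_source q).mem_nhds hqq))
  have e1 : (fun s' => transition p q (extChartAt 𝓘(ℝ, E) p (c s'))) =ᶠ[𝓝 s]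
      fun s' => extChartAt 𝓘(ℝ, E) q (c s') := by
    filter_upwards [hnear] with s' hs' using transition_extChartAt hs'.1
  have e2 : (fun s' => fderiv ℝ (transition p q) (extChartAt 𝓘(ℝ, E) p (c s'))
      (chartDeriv p (c s') (V s'))) =ᶠ[𝓝 s] fun s' => chartDeriv q (c s') (V s') := by
    filter_upwards [hnear] with s' hs' using fderiv_transition_chartDeriv hs'.1 hs'.2 _
  have e3 : covDerivAt h.inner c V s = covDeriv (metricInChart 𝓘(ℝ, E) h.inner q)
      (fun s' => transition p q (extChartAt 𝓘(ℝ, E) p (c s')))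
      (fun s' => fderiv ℝ (transition p q) (extChartAt 𝓘(ℝ, E) p (c s'))
      (chartDeriv p (c s') (V s'))) (1 : ℝ) s := by
    rw [covDeriv, e1.fderiv_eq, e2.fderiv_eq, e1.eq_of_nhds, e2.eq_of_nhds, fderiv_apply_one_eq_deriv,
      fderiv_apply_one_eq_deriv, (hasDerivAt_extChartAt_comp hc hqq).deriv, ← hq,
      chartDeriv_self, chartDeriv_self]
    rfl
  rw [e3, hτ, fderiv_transition (mem_transitionDomain hp hqq),
    (extChartAt 𝓘(ℝ, E) p).left_inv hp, chartDeriv_self]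
  have h3 := chartDeriv_chartSymmDeriv (p := p) ((extChartAt 𝓘(ℝ, E) p).map_source hp)
    (covDeriv (metricInChart 𝓘(ℝ, E) h.inner p) (fun s' => extChartAt 𝓘(ℝ, E) p (c s'))
        (fun s' => chartDeriv p (c s') (V s')) (1 : ℝ) s)
  rwa [(extChartAt 𝓘(ℝ, E) p).left_inv hp] at h3

end Curves

/-! ### Fields along a two-parameter map, globally and in charts -/

section Fields

variable {E : Type*} [NormedAddCommGroup E] [NormedSpace ℝ E]
  {M : Type*} [TopologicalSpace M] [ChartedSpace E M]

/-- The map `U` in the chart at `p`. -/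
noncomputable def coordMap (E : Type*) [NormedAddCommGroup E] [NormedSpace ℝ E] {M : Type*} [TopologicalSpace M]
    [ChartedSpace E M] (U : ℝ × ℝ → M) (p : M) (z : ℝ × ℝ) : E := extChartAt 𝓘(ℝ, E) p (U z)

/-- The vector field `W` along `U` in the chart at `p`. -/
noncomputable def coordField (U : ℝ × ℝ → M) (W : ℝ × ℝ → E) (p : M) (z : ℝ × ℝ) : E :=
  chartDeriv p (U z) (W z)

/-- The part of `Ω` that `U` maps into the domain of the chart at `p`. -/
def coordDomain (E : Type*) [NormedAddCommGroup E] [NormedSpace ℝ E] {M : Type*}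
    [TopologicalSpace M] [ChartedSpace E M] (U : ℝ × ℝ → M) (Ω : Set (ℝ × ℝ)) (p : M) :
    Set (ℝ × ℝ) :=
  Ω ∩ U ⁻¹' (extChartAt 𝓘(ℝ, E) p).source

/-- A vector field along `U` is smooth if its coordinates are smooth in every chart. -/
def IsSmoothField (U : ℝ × ℝ → M) (Ω : Set (ℝ × ℝ)) (W : ℝ × ℝ → E) : Prop :=
  ∀ p, ContDiffOn ℝ ∞ (coordField U W p) (coordDomain E U Ω p)

/-- `u_x` along a map of two parameters. -/
noncomputable def fieldUx (E : Type*) [NormedAddCommGroup E] [NormedSpace ℝ E] {M : Type*}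
    [TopologicalSpace M] [ChartedSpace E M] (U : ℝ × ℝ → M) (z : ℝ × ℝ) : E :=
  velocityAt (fun x => U (x, z.2)) z.1

/-- `u_t` along a map of two parameters. -/
noncomputable def fieldUt (E : Type*) [NormedAddCommGroup E] [NormedSpace ℝ E] {M : Type*}
    [TopologicalSpace M] [ChartedSpace E M] (U : ℝ × ℝ → M) (z : ℝ × ℝ) : E :=
  velocityAt (fun t => U (z.1, t)) z.2

variable (g : ∀ q : M, TangentSpace 𝓘(ℝ, E) q →L[ℝ] TangentSpace 𝓘(ℝ, E) q →L[ℝ] ℝ)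
  (J : ∀ q : M, TangentSpace 𝓘(ℝ, E) q →L[ℝ] TangentSpace 𝓘(ℝ, E) q)

/-- `∇_x W` along a map of two parameters. -/
noncomputable def fieldDx (U : ℝ × ℝ → M) (W : ℝ × ℝ → E) (z : ℝ × ℝ) : E :=
  covDerivAt g (fun x => U (x, z.2)) (fun x => W (x, z.2)) z.1

/-- `R(u_x, J u_x) J u_x` along a map of two parameters. -/
noncomputable def fieldCurv (U : ℝ × ℝ → M) (z : ℝ × ℝ) : E :=
  curvatureAt g (U z) (fieldUx E U z) (endoAt J (U z) (fieldUx E U z))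
    (endoAt J (U z) (fieldUx E U z))

/-- `∇_x² u_x + (1/2) R(u_x, J u_x) J u_x` along a map of two parameters. -/
noncomputable def fieldAiry (U : ℝ × ℝ → M) (z : ℝ × ℝ) : E :=
  fieldDx g U (fieldDx g U (fieldUx E U)) z + (1 / 2 : ℝ) • fieldCurv g J U z

/-- The density of the energy. -/
noncomputable def density (U : ℝ × ℝ → M) (z : ℝ × ℝ) : ℝ :=
  formAt g (U z) (fieldDx g U (fieldUx E U) z) (fieldDx g U (fieldUx E U) z)
    - (1 / 4) * formAt g (U z) (fieldUx E U z) (fieldCurv g J U z)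

/-- The flux of the energy density. -/
noncomputable def flux (U : ℝ × ℝ → M) (α β : ℝ) (z : ℝ × ℝ) : ℝ :=
  2 * formAt g (U z) (fieldDx g U (fieldUt E U) z) (fieldDx g U (fieldUx E U) z)
    - 2 * formAt g (U z) (fieldUt E U z) (fieldAiry g J U z)
    + β * formAt g (U z) (fieldAiry g J U z) (fieldAiry g J U z)
    + β * formAt g (U z) (curvatureAt g (U z) (fieldDx g U (fieldUx E U) z) (fieldUx E U z)
        (fieldUx E U z)) (fieldDx g U (fieldUx E U) z)
    + 2 * α * formAt g (U z) (endoAt J (U z) (fieldDx g U (fieldUx E U) z))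
        (fieldDx g U (fieldDx g U (fieldUx E U)) z)

variable [IsManifold 𝓘(ℝ, E) ∞ M] {U : ℝ × ℝ → M} {Ω : Set (ℝ × ℝ)} (hΩ : IsOpen Ω)
  (hU : ContMDiffOn 𝓘(ℝ, ℝ × ℝ) 𝓘(ℝ, E) ∞ U Ω)

include hΩ hU

omit [IsManifold 𝓘(ℝ, E) ∞ M] in
theorem isOpen_coordDomain (p : M) : IsOpen (coordDomain E U Ω p) :=
  hU.continuousOn.isOpen_inter_preimage hΩ (isOpen_extChartAt_source p)

omit hΩ in
theorem contDiffOn_coordMap (p : M) : ContDiffOn ℝ ∞ (coordMap E U p) (coordDomain E U Ω p) := by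
  rw [← contMDiffOn_iff_contDiffOn]
  exact (contMDiffOn_extChartAt' p).comp (hU.mono inter_subset_left) fun z hz => hz.2

omit hΩ hU [IsManifold 𝓘(ℝ, E) ∞ M] in
theorem mapsTo_coordMap (p : M) :
    MapsTo (coordMap E U p) (coordDomain E U Ω p) (extChartAt 𝓘(ℝ, E) p).target :=
  fun _ hz => (extChartAt 𝓘(ℝ, E) p).map_source hz.2

omit [IsManifold 𝓘(ℝ, E) ∞ M] in
theorem mdifferentiableAt_x {z : ℝ × ℝ} (hz : z ∈ Ω) :
    MDifferentiableAt 𝓘(ℝ, ℝ) 𝓘(ℝ, E) (fun x => U (x, z.2)) z.1 := by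
  have h1 : MDifferentiableAt 𝓘(ℝ, ℝ × ℝ) 𝓘(ℝ, E) U (z.1, z.2) :=
    (hU.contMDiffAt (hΩ.mem_nhds hz)).mdifferentiableAt (by simp)
  have h2 : MDifferentiableAt 𝓘(ℝ, ℝ) 𝓘(ℝ, ℝ × ℝ) (fun x : ℝ => (x, z.2)) z.1 := by
    rw [mdifferentiableAt_iff_differentiableAt]
    fun_prop
  exact MDifferentiableAt.comp z.1 h1 h2

omit [IsManifold 𝓘(ℝ, E) ∞ M] in
theorem mdifferentiableAt_t {z : ℝ × ℝ} (hz : z ∈ Ω) :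
    MDifferentiableAt 𝓘(ℝ, ℝ) 𝓘(ℝ, E) (fun t => U (z.1, t)) z.2 := by
  have h1 : MDifferentiableAt 𝓘(ℝ, ℝ × ℝ) 𝓘(ℝ, E) U (z.1, z.2) :=
    (hU.contMDiffAt (hΩ.mem_nhds hz)).mdifferentiableAt (by simp)
  have h2 : MDifferentiableAt 𝓘(ℝ, ℝ) 𝓘(ℝ, ℝ × ℝ) (fun t : ℝ => (z.1, t)) z.2 := by
    rw [mdifferentiableAt_iff_differentiableAt]
    fun_prop
  exact MDifferentiableAt.comp z.2 h1 h2

theorem coordField_fieldUx (p : M) {z : ℝ × ℝ} (hz : z ∈ coordDomain E U Ω p) :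
    coordField U (fieldUx E U) p z = coordUx (coordMap E U p) z := by
  have h1 := hasDerivAt_extChartAt_comp (mdifferentiableAt_x hΩ hU hz.1) (p := p) hz.2
  have h2 : HasFDerivAt (fun x : ℝ => (x, z.2)) (ContinuousLinearMap.inl ℝ ℝ ℝ) z.1 :=
    hasFDerivAt_prodMk_left z.1 z.2
  have h3 := (ContDiffOn.differentiableAt_infty (contDiffOn_coordMap hU p)
    (isOpen_coordDomain hΩ hU p) hz).hasFDerivAt
  have h4 := (HasFDerivAt.comp z.1 h3 h2).hasDerivAt
  have h5 := h1.unique h4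
  rw [coordUx]
  simpa using! h5

theorem coordField_fieldUt (p : M) {z : ℝ × ℝ} (hz : z ∈ coordDomain E U Ω p) :
    coordField U (fieldUt E U) p z = coordUt (coordMap E U p) z := by
  have h1 := hasDerivAt_extChartAt_comp (mdifferentiableAt_t hΩ hU hz.1) (p := p) hz.2
  have h2 : HasFDerivAt (fun t : ℝ => (z.1, t)) (ContinuousLinearMap.inr ℝ ℝ ℝ) z.2 :=
    hasFDerivAt_prodMk_right z.1 z.2
  have h3 := (ContDiffOn.differentiableAt_infty (contDiffOn_coordMap hU p)
    (isOpen_coordDomain hΩ hU p) hz).hasFDerivAt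
  have h4 := (HasFDerivAt.comp z.2 h3 h2).hasDerivAt
  have h5 := h1.unique h4
  rw [coordUt]
  simpa using! h5

theorem isSmoothField_fieldUx : IsSmoothField U Ω (fieldUx E U) := fun p =>
  (IsMetricOn.contDiffOn_fderiv_apply (isOpen_coordDomain hΩ hU p) (contDiffOn_coordMap hU p)
    (1, 0)).congr fun _ hz => coordField_fieldUx hΩ hU p hz

theorem isSmoothField_fieldUt : IsSmoothField U Ω (fieldUt E U) := fun p =>
  (IsMetricOn.contDiffOn_fderiv_apply (isOpen_coordDomain hΩ hU p) (contDiffOn_coordMap hU p)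
    (0, 1)).congr fun _ hz => coordField_fieldUt hΩ hU p hz

variable [FiniteDimensional ℝ E]
  (h : ContMDiffRiemannianMetric 𝓘(ℝ, E) ∞ E (fun p : M => TangentSpace 𝓘(ℝ, E) p))

theorem coordField_fieldDx {W : ℝ × ℝ → E} (hW : IsSmoothField U Ω W) (p : M) {z : ℝ × ℝ}
    (hz : z ∈ coordDomain E U Ω p) :
    coordField U (fieldDx h.inner U W) p z =
      coordDx (metricInChart 𝓘(ℝ, E) h.inner p) (coordMap E U p) (coordField U W p) z := by
  have hO := isOpen_coordDomain hΩ hU p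
  have h1 : DifferentiableAt ℝ (coordField U W p) (z.1, z.2) :=
    ContDiffOn.differentiableAt_infty (hW p) hO hz
  have h2 : DifferentiableAt ℝ (coordMap E U p) (z.1, z.2) :=
    ContDiffOn.differentiableAt_infty (contDiffOn_coordMap hU p) hO hz
  have h3 : DifferentiableAt ℝ (fun x => coordField U W p (x, z.2)) z.1 :=
    DifferentiableAt.comp z.1 (f := fun x : ℝ => (x, z.2)) h1 (by fun_prop)
  have h4 := chartDeriv_covDerivAt h (mdifferentiableAt_x hΩ hU hz.1) (p := p) hz.2
    (V := fun x => W (x, z.2)) h3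
  exact h4.trans (covDeriv_line h2 h1)

theorem isSmoothField_fieldDx {W : ℝ × ℝ → E} (hW : IsSmoothField U Ω W) :
    IsSmoothField U Ω (fieldDx h.inner U W) := fun p =>
  ((isMetricOn_metricInChart h p).contDiffOn_covDeriv (isOpen_coordDomain hΩ hU p)
    (contDiffOn_coordMap hU p) (mapsTo_coordMap p) (hW p) (1, 0)).congr
      fun _ hz => coordField_fieldDx hΩ hU h hW p hz

/-- Agreement on an open set is inherited by ∇_x, so this form can be iterated to reach ∇_x² u_x. -/
theorem coordField_fieldDx_of_eqOn {W : ℝ × ℝ → E} (hW : IsSmoothField U Ω W) (p : M)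
    {w : ℝ × ℝ → E} (hw : EqOn (coordField U W p) w (coordDomain E U Ω p)) :
    EqOn (coordField U (fieldDx h.inner U W) p)
      (coordDx (metricInChart 𝓘(ℝ, E) h.inner p) (coordMap E U p) w) (coordDomain E U Ω p) := by
  intro z hz
  rw [coordField_fieldDx hΩ hU h hW p hz]
  exact covDeriv_congr (hw.eventuallyEq_of_mem ((isOpen_coordDomain hΩ hU p).mem_nhds hz)) _

theorem coordField_fieldCurv (p : M) :
    EqOn (coordField U (fieldCurv h.inner J U) p)
      (coordCurv (metricInChart 𝓘(ℝ, E) h.inner p) (complexStructureInChart 𝓘(ℝ, E) J p)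
        (coordMap E U p)) (coordDomain E U Ω p) := by
  intro z hz
  have h1 : chartDeriv p (U z) (fieldUx E U z) = _ := coordField_fieldUx hΩ hU p hz
  rw [coordField, fieldCurv, chartDeriv_curvature h hz.2, chartDeriv_endo J hz.2, h1]
  rfl

theorem coordField_fieldAiry (p : M) :
    EqOn (coordField U (fieldAiry h.inner J U) p)
      (coordAiry (metricInChart 𝓘(ℝ, E) h.inner p) (complexStructureInChart 𝓘(ℝ, E) J p)
        (coordMap E U p)) (coordDomain E U Ω p) := by
  intro z hz
  have hX := isSmoothField_fieldUx hΩ hU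
  have h1 := coordField_fieldDx_of_eqOn hΩ hU h hX p fun z hz => coordField_fieldUx hΩ hU p hz
  have h2 := coordField_fieldDx_of_eqOn hΩ hU h (isSmoothField_fieldDx hΩ hU h hX) p h1 hz
  have h3 := coordField_fieldCurv J hΩ hU h p hz
  rw [coordField] at h2 h3
  rw [coordField, fieldAiry, map_add, map_smul, h2, h3, coordAiry]

/-- The left side does not depend on `p`, so smoothness and the conservation law can be checked near
each point in whichever chart is convenient. -/
theorem density_eq_coordDensity (p : M) :
    EqOn (density h.inner J U) (coordDensity (metricInChart 𝓘(ℝ, E) h.inner p)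
      (complexStructureInChart 𝓘(ℝ, E) J p) (coordMap E U p)) (coordDomain E U Ω p) := by
  intro z hz
  have hX := isSmoothField_fieldUx hΩ hU
  have h1 : chartDeriv p (U z) _ = _ :=
    coordField_fieldDx_of_eqOn hΩ hU h hX p (fun z hz => coordField_fieldUx hΩ hU p hz) hz
  have h2 : chartDeriv p (U z) _ = _ := coordField_fieldCurv J hΩ hU h p hz
  have h3 : chartDeriv p (U z) _ = _ := coordField_fieldUx hΩ hU p hz
  rw [density, inner_eq_metricInChart _ hz.2, inner_eq_metricInChart _ hz.2, h1, h2, h3]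
  rfl

theorem flux_eq_coordFlux (α β : ℝ) (p : M) :
    EqOn (flux h.inner J U α β) (coordFlux (metricInChart 𝓘(ℝ, E) h.inner p)
      (complexStructureInChart 𝓘(ℝ, E) J p) (coordMap E U p) α β) (coordDomain E U Ω p) := by
  intro z hz
  have hX := isSmoothField_fieldUx hΩ hU
  have hT := isSmoothField_fieldUt hΩ hU
  have hDX := isSmoothField_fieldDx hΩ hU h hX
  have e1 : chartDeriv p (U z) _ = _ := coordField_fieldUx hΩ hU p hz
  have e2 : chartDeriv p (U z) _ = _ := coordField_fieldUt hΩ hU p hz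
  have h3 := coordField_fieldDx_of_eqOn hΩ hU h hX p fun z hz => coordField_fieldUx hΩ hU p hz
  have e3 : chartDeriv p (U z) _ = _ := h3 hz
  have e4 : chartDeriv p (U z) _ = _ :=
    coordField_fieldDx_of_eqOn hΩ hU h hT p (fun z hz => coordField_fieldUt hΩ hU p hz) hz
  have e5 : chartDeriv p (U z) _ = _ := coordField_fieldDx_of_eqOn hΩ hU h hDX p h3 hz
  have e6 : chartDeriv p (U z) _ = _ := coordField_fieldAiry J hΩ hU h p hz
  simp only [flux, inner_eq_metricInChart _ hz.2, chartDeriv_curvature h hz.2,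
    chartDeriv_endo J hz.2, e1, e2, e3, e4, e5, e6]
  rfl

variable {J} {h}

/-! ### The conservation law on one factor -/

section Conservation

variable (hS : ∀ p : M, IsSymmetricKahlerOn (metricInChart 𝓘(ℝ, E) h.inner p)
  (complexStructureInChart 𝓘(ℝ, E) J p) (extChartAt 𝓘(ℝ, E) p).target)
include hS

theorem contDiffOn_density : ContDiffOn ℝ ∞ (density h.inner J U) Ω := by
  intro z hz
  have hz' : z ∈ coordDomain E U Ω (U z) := ⟨hz, mem_extChartAt_source (I := 𝓘(ℝ, E)) (U z)⟩
  have hO := isOpen_coordDomain hΩ hU (U z)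
  have h1 := ((hS (U z)).contDiffOn_coordDensity hO (contDiffOn_coordMap hU (U z))
    (mapsTo_coordMap (U z))).congr (density_eq_coordDensity J hΩ hU h (U z))
  exact (h1.contDiffAt (hO.mem_nhds hz')).contDiffWithinAt

theorem contDiffOn_flux (α β : ℝ) : ContDiffOn ℝ ∞ (flux h.inner J U α β) Ω := by
  intro z hz
  have hz' : z ∈ coordDomain E U Ω (U z) := ⟨hz, mem_extChartAt_source (I := 𝓘(ℝ, E)) (U z)⟩
  have hO := isOpen_coordDomain hΩ hU (U z)
  have h1 := ((hS (U z)).contDiffOn_coordFlux hO (contDiffOn_coordMap hU (U z))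
    (mapsTo_coordMap (U z)) α β).congr (flux_eq_coordFlux J hΩ hU h α β (U z))
  exact (h1.contDiffAt (hO.mem_nhds hz')).contDiffWithinAt

/-- The local conservation law `∂_t e = ∂_x q`. -/
theorem fderiv_density_eq_fderiv_flux (α β : ℝ)
    (heq : ∀ z ∈ Ω, fieldUt E U z =
      α • endoAt J (U z) (fieldDx h.inner U (fieldUx E U) z) + β • fieldAiry h.inner J U z)
    {z : ℝ × ℝ} (hz : z ∈ Ω) :
    fderiv ℝ (density h.inner J U) z (0, 1) = fderiv ℝ (flux h.inner J U α β) z (1, 0) := by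
  set p := U z with hp
  have hz' : z ∈ coordDomain E U Ω p := ⟨hz, mem_extChartAt_source (I := 𝓘(ℝ, E)) (U z)⟩
  have hO := isOpen_coordDomain hΩ hU p
  have h1 := (density_eq_coordDensity J hΩ hU h p).eventuallyEq_of_mem (hO.mem_nhds hz')
  have h2 := (flux_eq_coordFlux J hΩ hU h α β p).eventuallyEq_of_mem (hO.mem_nhds hz')
  rw [h1.fderiv_eq, h2.fderiv_eq]
  refine (hS p).fderiv_coordDensity_eq_fderiv_coordFlux hO (contDiffOn_coordMap hU p)
    (mapsTo_coordMap p) α β (fun w hw => ?_) hz'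
  have hX := isSmoothField_fieldUx hΩ hU
  have e2 : chartDeriv p (U w) _ = _ := coordField_fieldUt hΩ hU p hw
  have e3 : chartDeriv p (U w) _ = _ :=
    coordField_fieldDx_of_eqOn hΩ hU h hX p (fun z hz => coordField_fieldUx hΩ hU p hz) hw
  have e6 : chartDeriv p (U w) _ = _ := coordField_fieldAiry J hΩ hU h p hw
  have e7 := congrArg (chartDeriv p (U w)) (heq w hw.1)
  rw [map_add, map_smul, map_smul, chartDeriv_endo J hw.2, e2, e3, e6] at e7
  exact e7

omit hS in
/-- The flux is invariant under a translation which leaves the map invariant. -/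
theorem flux_add_period (α β : ℝ) {c : ℝ × ℝ} (hc : ∀ z, U (z + c) = U z) {z : ℝ × ℝ} (hz : z ∈ Ω)
    (hzc : z + c ∈ Ω) : flux h.inner J U α β (z + c) = flux h.inner J U α β z := by
  have hs := mem_extChartAt_source (I := 𝓘(ℝ, E)) (U z)
  have hz' : z ∈ coordDomain E U Ω (U z) := ⟨hz, hs⟩
  have hzc' : z + c ∈ coordDomain E U Ω (U z) := ⟨hzc, by rw [mem_preimage, hc]; exact hs⟩
  -- The points U(z) and U(z + c) coincide, so both values are computed in one chart, where
  -- translation invariance is plain.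
  rw [flux_eq_coordFlux J hΩ hU h α β (U z) hz', flux_eq_coordFlux J hΩ hU h α β (U z) hzc',
    ← coordFlux_comp_add_right]
  simp only [coordMap, hc]
  rfl

end Conservation

end Fields

end SchrodingerAiry

namespace SchrodingerAiry

set_option maxSynthPendingDepth 3
set_option synthInstance.maxHeartbeats 100000

/-! ### Locality of the Christoffel symbols and curvature -/

section Congruence

variable {E : Type*} [NormedAddCommGroup E] [NormedSpace ℝ E]
  {G G' : E → E →L[ℝ] E →L[ℝ] ℝ} {y : E}

theorem christoffel_congr (h : G =ᶠ[𝓝 y] G') (v w : E) :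
    christoffel G y v w = christoffel G' y v w := by
  rw [christoffel, christoffel, h.fderiv_eq, h.eq_of_nhds]

theorem curvatureCoord_congr (h : G =ᶠ[𝓝 y] G') (v w z : E) :
    curvatureCoord G y v w z = curvatureCoord G' y v w z := by
  have h1 : ∀ v w, (fun y' => christoffel G y' v w) =ᶠ[𝓝 y] fun y' => christoffel G' y' v w := by
    intro v w
    filter_upwards [h.eventuallyEq_nhds] with y' hy' using christoffel_congr hy' v w
  simp only [curvatureCoord, (h1 _ _).fderiv_eq, christoffel_congr h]

end Congruence

/-! ### Product metrics on open sets -/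

section LocalProduct

variable {ι : Type*} [Fintype ι] {E : ι → Type*} [∀ i, NormedAddCommGroup (E i)]
  [∀ i, NormedSpace ℝ (E i)]

/-- The product of the metrics `G i`. -/
noncomputable def sumMetric (G : ∀ i, E i → E i →L[ℝ] E i →L[ℝ] ℝ) (y : ∀ i, E i) :
    (∀ i, E i) →L[ℝ] (∀ i, E i) →L[ℝ] ℝ :=
  ∑ i, (G i (y i)).bilinearComp (ContinuousLinearMap.proj i) (ContinuousLinearMap.proj i)

theorem sumMetric_apply (G : ∀ i, E i → E i →L[ℝ] E i →L[ℝ] ℝ) (y v w : ∀ i, E i) :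
    sumMetric G y v w = ∑ i, G i (y i) (v i) (w i) := by
  simp [sumMetric]

variable [∀ i, FiniteDimensional ℝ (E i)] {G : ∀ i, E i → E i →L[ℝ] E i →L[ℝ] ℝ}
  {O : ∀ i, Set (E i)} (hG : ∀ i, IsMetricOn (G i) (O i))
include hG

theorem isMetricOn_sumMetric : IsMetricOn (sumMetric G) (Set.pi univ O) where
  isOpen := isOpen_set_pi finite_univ fun i _ => (hG i).isOpen
  smooth := by
    refine contDiffOn_clm_apply.2 fun v => ?_
    refine contDiffOn_clm_apply.2 fun w => ?_
    simp only [sumMetric_apply]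
    refine ContDiffOn.sum fun i _ => ?_
    have h1 : ContDiffOn ℝ ∞ (fun y : ∀ i, E i => G i (y i)) (Set.pi univ O) :=
      (hG i).smooth.comp (ContinuousLinearMap.proj (R := ℝ) i : (∀ i, E i) →L[ℝ] E i).contDiff.contDiffOn fun y hy => hy i (mem_univ i)
    exact (h1.clm_apply contDiffOn_const).clm_apply contDiffOn_const
  symm y hy v w := by
    simp only [sumMetric_apply]
    exact Finset.sum_congr rfl fun i _ => (hG i).symm _ (hy i (mem_univ i)) _ _
  pos y hy v hv := by
    rw [sumMetric_apply]
    obtain ⟨i, hi⟩ := Function.ne_iff.1 hv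
    refine Finset.sum_pos' (fun j _ => ?_) ⟨i, Finset.mem_univ i, (hG i).pos _ (hy i (mem_univ i)) _ hi⟩
    by_cases hj : v j = 0
    · simp [hj]
    · exact ((hG j).pos _ (hy j (mem_univ j)) _ hj).le

theorem fderiv_sumMetric {y : ∀ i, E i} (hy : y ∈ Set.pi univ O) (a v w : ∀ i, E i) :
    fderiv ℝ (sumMetric G) y a v w = ∑ i, fderiv ℝ (G i) (y i) (a i) (v i) (w i) := by
  have hd := (isMetricOn_sumMetric hG).differentiableAt hy
  have h1 : fderiv ℝ (sumMetric G) y a v w = fderiv ℝ (fun y => sumMetric G y v w) y a := by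
    rw [fderiv_apply_apply₂ hd (by fun_prop) (by fun_prop)]
    simp
  have hp : ∀ i, HasFDerivAt (fun y : ∀ i, E i => y i) (ContinuousLinearMap.proj (R := ℝ) i) y :=
    fun i => (ContinuousLinearMap.proj (R := ℝ) i : (∀ i, E i) →L[ℝ] E i).hasFDerivAt
  have hGi := fun i => (hG i).differentiableAt (hy i (mem_univ i))
  have hd2 : ∀ i, DifferentiableAt ℝ (fun y : ∀ i, E i => G i (y i) (v i) (w i)) y := fun i =>
    (((hGi i).comp y (hp i).differentiableAt).clm_apply (by fun_prop)).clm_apply (by fun_prop)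
  simp only [h1, sumMetric_apply]
  rw [fderiv_fun_sum fun i _ => hd2 i, _root_.sum_apply]
  refine Finset.sum_congr rfl fun i _ => ?_
  rw [fderiv_apply_apply₂ (B := fun y : ∀ i, E i => G i (y i)) ((hGi i).comp y (hp i).differentiableAt)
    (by fun_prop) (by fun_prop), fderiv_comp_apply' (hGi i) (hp i).differentiableAt, (hp i).fderiv]
  simp

/-- The Koszul formula of the sum is the sum of the Koszul formulas, and nondegeneracy determines
the vector. -/
theorem christoffel_sumMetric {y : ∀ i, E i} (hy : y ∈ Set.pi univ O) (v w : ∀ i, E i) :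
    christoffel (sumMetric G) y v w = fun i => christoffel (G i) (y i) (v i) (w i) := by
  have hm := isMetricOn_sumMetric hG
  refine hm.ext_inner hy fun z => ?_
  have h1 := hm.koszul hy v w z
  rw [fderiv_sumMetric hG hy, fderiv_sumMetric hG hy, fderiv_sumMetric hG hy,
    ← Finset.sum_add_distrib, ← Finset.sum_sub_distrib] at h1
  have h2 : 2 * sumMetric G y (fun i => christoffel (G i) (y i) (v i) (w i)) z =
      ∑ i, (fderiv ℝ (G i) (y i) (v i) (w i) (z i) + fderiv ℝ (G i) (y i) (w i) (v i) (z i)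
        - fderiv ℝ (G i) (y i) (z i) (v i) (w i)) := by
    rw [sumMetric_apply, Finset.mul_sum]
    exact Finset.sum_congr rfl fun i _ => (hG i).koszul (hy i (mem_univ i)) _ _ _
  linarith

theorem fderiv_christoffel_sumMetric {y : ∀ i, E i} (hy : y ∈ Set.pi univ O) (a v w : ∀ i, E i) :
    fderiv ℝ (fun y' => christoffel (sumMetric G) y' v w) y a =
      fun i => fderiv ℝ (fun y' => christoffel (G i) y' (v i) (w i)) (y i) (a i) := by
  have hm := isMetricOn_sumMetric hG
  have h1 : (fun y' => christoffel (sumMetric G) y' v w) =ᶠ[𝓝 y]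
      fun y' i => christoffel (G i) (y' i) (v i) (w i) := by
    filter_upwards [hm.isOpen.mem_nhds hy] with y' hy' using christoffel_sumMetric hG hy' v w
  have hp : ∀ i, HasFDerivAt (fun y : ∀ i, E i => y i) (ContinuousLinearMap.proj (R := ℝ) i) y :=
    fun i => (ContinuousLinearMap.proj (R := ℝ) i : (∀ i, E i) →L[ℝ] E i).hasFDerivAt
  have hc : ∀ i, DifferentiableAt ℝ (fun y' => christoffel (G i) y' (v i) (w i)) (y i) := by
    intro i
    simp only [← christoffelMap_apply]
    exact (((hG i).differentiableAt_christoffelMap (hy i (mem_univ i))).clm_apply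
      (by fun_prop)).clm_apply (by fun_prop)
  have h2 : HasFDerivAt (fun (y' : ∀ i, E i) i => christoffel (G i) (y' i) (v i) (w i))
      (ContinuousLinearMap.pi fun i => (fderiv ℝ (fun y' => christoffel (G i) y' (v i) (w i)) (y i)) ∘L
        ContinuousLinearMap.proj i) y :=
    hasFDerivAt_pi.2 fun i => HasFDerivAt.comp y (f := fun y : ∀ i, E i => y i)
      (g := fun y' => christoffel (G i) y' (v i) (w i)) (hc i).hasFDerivAt (hp i)
  rw [h1.fderiv_eq, h2.fderiv]
  rfl

theorem curvatureCoord_sumMetric {y : ∀ i, E i} (hy : y ∈ Set.pi univ O) (v w z : ∀ i, E i) :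
    curvatureCoord (sumMetric G) y v w z =
      fun i => curvatureCoord (G i) (y i) (v i) (w i) (z i) := by
  simp only [curvatureCoord, fderiv_christoffel_sumMetric hG hy, christoffel_sumMetric hG hy]
  rfl

end LocalProduct

/-! ### Charts, connection and curvature of a product manifold -/

section ProductCharts

variable {n : ℕ} {E : Fin n → Type*} [∀ i, NormedAddCommGroup (E i)] [∀ i, NormedSpace ℝ (E i)]
  {M : Fin n → Type*} [∀ i, TopologicalSpace (M i)] [∀ i, ChartedSpace (E i) (M i)]

theorem mem_extChartAt_product_source {p q : ∀ i, M i} :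
    q ∈ (extChartAt (productModel E) p).source ↔
      ∀ i, q i ∈ (extChartAt 𝓘(ℝ, E i) (p i)).source := by
  simp

/-- The components of a smooth map into a product are smooth. -/
theorem ContMDiffOn.component {E' H' N : Type*} [NormedAddCommGroup E'] [NormedSpace ℝ E']
    [TopologicalSpace H'] {I' : ModelWithCorners ℝ E' H'} [TopologicalSpace N] [ChartedSpace H' N]
    {f : N → ∀ i, M i} {s : Set N} (hf : ContMDiffOn I' (productModel E) ∞ f s) (i : Fin n) :
    ContMDiffOn I' 𝓘(ℝ, E i) ∞ (fun x => f x i) s := by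
  intro x hx
  have h := contMDiffWithinAt_iff.1 (hf x hx)
  refine contMDiffWithinAt_iff.2 ⟨(continuous_apply i).continuousAt.comp_continuousWithinAt h.1, ?_⟩
  exact contDiffWithinAt_pi.1 h.2 i

/-- The chart of the product is the product of the charts, so the derivative is taken componentwise;
at the base point each `chartDeriv` is the identity. -/
theorem hasMFDerivAt_curve_product [∀ i, IsManifold 𝓘(ℝ, E i) ∞ (M i)] {c : ℝ → ∀ i, M i} {s : ℝ}
    (hc : ∀ i, MDifferentiableAt 𝓘(ℝ, ℝ) 𝓘(ℝ, E i) (fun s => c s i) s) :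
    HasMFDerivAt 𝓘(ℝ, ℝ) (productModel E) c s
      (ContinuousLinearMap.toSpanSingleton ℝ
        (fun i => velocityAt (fun s => c s i) s : ∀ i, E i)) := by
  refine ⟨continuousAt_pi.2 fun i => (hc i).continuousAt, ?_⟩
  have h1 : HasDerivAt (fun s' i => extChartAt 𝓘(ℝ, E i) (c s i) (c s' i))
      (fun i => velocityAt (fun s => c s i) s : ∀ i, E i) s := by
    rw [hasDerivAt_pi]
    intro i
    have h2 := hasDerivAt_extChartAt_comp (hc i) (mem_extChartAt_source (I := 𝓘(ℝ, E i)) (c s i))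
    rwa [chartDeriv_self] at h2
  exact h1.hasFDerivAt.hasFDerivWithinAt

theorem velocity_product [∀ i, IsManifold 𝓘(ℝ, E i) ∞ (M i)] {c : ℝ → ∀ i, M i} {s : ℝ}
    (hc : ∀ i, MDifferentiableAt 𝓘(ℝ, ℝ) 𝓘(ℝ, E i) (fun s => c s i) s) :
    velocity (productModel E) c s = (fun i => velocityAt (fun s => c s i) s : ∀ i, E i) := by
  rw [velocity, (hasMFDerivAt_curve_product hc).mfderiv]
  exact ContinuousLinearMap.toSpanSingleton_apply_one ℝ _

/-- Read in the chart at `q`, the product chart at `p` is the product of the changes of charts from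
`q i` to `p i`. -/
theorem mfderiv_extChartAt_product [∀ i, IsManifold 𝓘(ℝ, E i) ∞ (M i)] {p q : ∀ i, M i}
    (hq : q ∈ (extChartAt (productModel E) p).source) (v : ∀ i, E i) :
    mfderiv (productModel E) 𝓘(ℝ, ∀ i, E i) (extChartAt (productModel E) p) q v =
      (fun i => chartDeriv (p i) (q i) (v i) : ∀ i, E i) := by
  have hq' := mem_extChartAt_product_source.1 hq
  have h1 : HasFDerivAt (fun (y : ∀ i, E i) i => transition (q i) (p i) (y i))
      (ContinuousLinearMap.pi fun i => chartDeriv (p i) (q i) ∘L ContinuousLinearMap.proj i)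
      (fun i => extChartAt 𝓘(ℝ, E i) (q i) (q i)) := by
    refine hasFDerivAt_pi.2 fun i => ?_
    have hqq := mem_extChartAt_source (I := 𝓘(ℝ, E i)) (q i)
    have hm := mem_transitionDomain hqq (hq' i)
    have h2 := ContDiffOn.differentiableAt_infty (contDiffOn_transition (q i) (p i))
      (isOpen_transitionDomain (q i) (p i)) hm
    have h3 : fderiv ℝ (transition (q i) (p i)) (extChartAt 𝓘(ℝ, E i) (q i) (q i)) =
        chartDeriv (p i) (q i) := by
      ext v
      rw [← fderiv_transition_chartDeriv hqq (hq' i), chartDeriv_self]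
    have h4 := h2.hasFDerivAt
    rw [h3] at h4
    exact h4.comp (fun i => extChartAt 𝓘(ℝ, E i) (q i) (q i))
      (ContinuousLinearMap.proj (R := ℝ) i : (∀ i, E i) →L[ℝ] E i).hasFDerivAt
  have h5 : HasMFDerivAt (productModel E) 𝓘(ℝ, ∀ i, E i) (extChartAt (productModel E) p) q
      (ContinuousLinearMap.pi fun i => chartDeriv (p i) (q i) ∘L ContinuousLinearMap.proj i) :=
    ⟨continuousAt_extChartAt' hq, h1.hasFDerivWithinAt⟩
  rw [h5.mfderiv]
  rfl

theorem mfderiv_extChartAt_product_symm [∀ i, IsManifold 𝓘(ℝ, E i) ∞ (M i)] {p : ∀ i, M i}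
    {y : ∀ i, E i} (hy : ∀ i, y i ∈ (extChartAt 𝓘(ℝ, E i) (p i)).target) (v : ∀ i, E i) :
    mfderiv 𝓘(ℝ, ∀ i, E i) (productModel E) (extChartAt (productModel E) p).symm y v =
      (fun i => chartSymmDeriv (p i) (y i) (v i) : ∀ i, E i) := by
  have h1 : HasFDerivAt (fun (y' : ∀ i, E i) i =>
      transition (p i) ((extChartAt 𝓘(ℝ, E i) (p i)).symm (y i)) (y' i))
      (ContinuousLinearMap.pi fun i => chartSymmDeriv (p i) (y i) ∘L ContinuousLinearMap.proj i)
      y := by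
    refine hasFDerivAt_pi.2 fun i => ?_
    -- The inverse chart is read in the chart at its own image point, where `chartDeriv` is the
    -- identity.
    set q := (extChartAt 𝓘(ℝ, E i) (p i)).symm (y i) with hq
    have hm : y i ∈ transitionDomain (E i) (p i) q :=
      ⟨hy i, mem_extChartAt_source (I := 𝓘(ℝ, E i)) q⟩
    have h2 := ContDiffOn.differentiableAt_infty (contDiffOn_transition (p i) q)
      (isOpen_transitionDomain (p i) q) hm
    have h3 : fderiv ℝ (transition (p i) q) (y i) = chartSymmDeriv (p i) (y i) := by
      ext v
      rw [fderiv_transition hm, ← hq, chartDeriv_self]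
    have h4 := h2.hasFDerivAt
    rw [h3] at h4
    exact h4.comp y (ContinuousLinearMap.proj (R := ℝ) i : (∀ i, E i) →L[ℝ] E i).hasFDerivAt
  have h5 : HasMFDerivAt 𝓘(ℝ, ∀ i, E i) (productModel E) (extChartAt (productModel E) p).symm y
      (ContinuousLinearMap.pi fun i => chartSymmDeriv (p i) (y i) ∘L ContinuousLinearMap.proj i) := by
    refine ⟨continuousAt_pi.2 fun i => ?_, h1.hasFDerivWithinAt⟩
    exact ContinuousAt.comp (f := fun y' : ∀ i, E i => y' i)
      (g := (extChartAt 𝓘(ℝ, E i) (p i)).symm) ((continuousOn_extChartAt_symm (p i)).continuousAt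
        ((isOpen_extChartAt_target (p i)).mem_nhds (hy i))) (continuous_apply i).continuousAt
  rw [h5.mfderiv]
  rfl

variable [∀ i, IsManifold 𝓘(ℝ, E i) ∞ (M i)]
  {g : ∀ i, ∀ q : M i, TangentSpace 𝓘(ℝ, E i) q →L[ℝ] TangentSpace 𝓘(ℝ, E i) q →L[ℝ] ℝ}

omit [∀ i, IsManifold 𝓘(ℝ, E i) ∞ (M i)] in
theorem productMetric_apply (p : ∀ i, M i) (v w : ∀ i, E i) :
    (productMetric g p : (∀ i, E i) →L[ℝ] (∀ i, E i) →L[ℝ] ℝ) v w =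
      ∑ i, formAt (g i) (p i) (v i) (w i) := by
  change (∑ i, (formAt (g i) (p i)).bilinearComp (ContinuousLinearMap.proj (R := ℝ) i)
    (ContinuousLinearMap.proj (R := ℝ) i) : (∀ i, E i) →L[ℝ] (∀ i, E i) →L[ℝ] ℝ) v w = _
  simp

theorem metricInChart_product_apply {p : ∀ i, M i} {y : ∀ i, E i}
    (hy : ∀ i, y i ∈ (extChartAt 𝓘(ℝ, E i) (p i)).target) :
    metricInChart (productModel E) (productMetric g) p y =
      sumMetric (fun i => metricInChart 𝓘(ℝ, E i) (g i) (p i)) y := by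
  ext v w
  rw [sumMetric_apply]
  have h1 : metricInChart (productModel E) (productMetric g) p y v w =
      (productMetric g ((extChartAt (productModel E) p).symm y) :
        (∀ i, E i) →L[ℝ] (∀ i, E i) →L[ℝ] ℝ)
        (mfderiv 𝓘(ℝ, ∀ i, E i) (productModel E) (extChartAt (productModel E) p).symm y v)
        (mfderiv 𝓘(ℝ, ∀ i, E i) (productModel E) (extChartAt (productModel E) p).symm y w) := rfl
  rw [h1, mfderiv_extChartAt_product_symm hy, mfderiv_extChartAt_product_symm hy]
  exact productMetric_apply _ _ _

theorem metricInChart_product_eventuallyEq {p : ∀ i, M i} {y : ∀ i, E i}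
    (hy : ∀ i, y i ∈ (extChartAt 𝓘(ℝ, E i) (p i)).target) :
    metricInChart (productModel E) (productMetric g) p =ᶠ[𝓝 y]
      sumMetric (fun i => metricInChart 𝓘(ℝ, E i) (g i) (p i)) := by
  have hO : IsOpen (Set.pi univ fun i => (extChartAt 𝓘(ℝ, E i) (p i)).target) :=
    isOpen_set_pi finite_univ fun i _ => isOpen_extChartAt_target (p i)
  filter_upwards [hO.mem_nhds fun i _ => hy i] with y' hy' using
    metricInChart_product_apply fun i => hy' i (mem_univ i)

variable [∀ i, FiniteDimensional ℝ (E i)]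
  (h : ∀ i, ContMDiffRiemannianMetric 𝓘(ℝ, E i) ∞ (E i) (fun p : M i => TangentSpace 𝓘(ℝ, E i) p))

theorem curvature_product (p : ∀ i, M i) (v w z : ∀ i, E i) :
    curvature (productModel E) (productMetric fun i => (h i).inner) p v w z =
      (fun i => curvatureAt (h i).inner (p i) (v i) (w i) (z i) : ∀ i, E i) := by
  have hy : ∀ i, extChartAt 𝓘(ℝ, E i) (p i) (p i) ∈ (extChartAt 𝓘(ℝ, E i) (p i)).target :=
    fun i => mem_extChartAt_target (I := 𝓘(ℝ, E i)) (p i)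
  change curvatureCoord (metricInChart (productModel E) (productMetric fun i => (h i).inner) p)
    (fun i => extChartAt 𝓘(ℝ, E i) (p i) (p i)) v w z = _
  rw [curvatureCoord_congr (metricInChart_product_eventuallyEq hy)]
  exact curvatureCoord_sumMetric (fun i => isMetricOn_metricInChart (h i) (p i))
    (fun i _ => hy i) v w z

/-- Both terms of V' + Γ(c', V) split. The expressions in the product chart agree with the
componentwise ones only near `s`, which is enough for the derivative. -/
theorem covDerivAlong_product {c : ℝ → ∀ i, M i} {V : ℝ → ∀ i, E i} {s : ℝ}
    (hc : ∀ i, MDifferentiableAt 𝓘(ℝ, ℝ) 𝓘(ℝ, E i) (fun s => c s i) s)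
    (hV : ∀ i, DifferentiableAt ℝ (fun s' => chartDeriv (c s i) (c s' i) (V s' i)) s) :
    covDerivAlong (productModel E) (productMetric fun i => (h i).inner) c V s =
      (fun i => covDerivAt (h i).inner (fun s => c s i) (fun s => V s i) s : ∀ i, E i) := by
  have hy : ∀ i, extChartAt 𝓘(ℝ, E i) (c s i) (c s i) ∈ (extChartAt 𝓘(ℝ, E i) (c s i)).target :=
    fun i => mem_extChartAt_target (I := 𝓘(ℝ, E i)) (c s i)
  have hcont : ContinuousAt c s := continuousAt_pi.2 fun i => (hc i).continuousAt
  have h1 : (fun s' => (mfderiv (productModel E) 𝓘(ℝ, ∀ i, E i)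
      (extChartAt (productModel E) (c s)) (c s') (V s') : ∀ i, E i)) =ᶠ[𝓝 s]
      fun s' i => chartDeriv (c s i) (c s' i) (V s' i) := by
    have hmem := hcont.eventually_mem ((isOpen_extChartAt_source (I := productModel E) (c s)).mem_nhds
      (mem_extChartAt_source (I := productModel E) (c s)))
    filter_upwards [hmem] with s' hs' using mfderiv_extChartAt_product hs' (V s')
  have h2 : deriv (fun s' i => chartDeriv (c s i) (c s' i) (V s' i)) s =
      fun i => deriv (fun s' => chartDeriv (c s i) (c s' i) (V s' i)) s := deriv_pi hV
  change deriv (fun s' => (mfderiv (productModel E) 𝓘(ℝ, ∀ i, E i)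
      (extChartAt (productModel E) (c s)) (c s') (V s') : ∀ i, E i)) s
    + christoffel (metricInChart (productModel E) (productMetric fun i => (h i).inner) (c s))
      (fun i => extChartAt 𝓘(ℝ, E i) (c s i) (c s i)) (velocity (productModel E) c s) (V s) = _
  rw [h1.deriv_eq, h2]
  have h3 := christoffel_sumMetric (fun i => isMetricOn_metricInChart (h i) (c s i))
    (y := fun i => extChartAt 𝓘(ℝ, E i) (c s i) (c s i))
    (fun i _ => hy i) (fun i => velocityAt (fun s => c s i) s) (V s)
  have h4 := congrArg (fun w : ∀ i, E i => christoffel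
    (sumMetric fun i => metricInChart 𝓘(ℝ, E i) (h i).inner (c s i))
    (fun i => extChartAt 𝓘(ℝ, E i) (c s i) (c s i)) w (V s)) (velocity_product hc)
  have h5 := christoffel_congr (metricInChart_product_eventuallyEq (g := fun i => (h i).inner) hy)
    (velocity (productModel E) c s) (V s)
  exact congrArg (fun w : ∀ i, E i =>
    (fun i => deriv (fun s' => chartDeriv (c s i) (c s' i) (V s' i)) s) + w)
    (h5.trans (h4.trans h3))

end ProductCharts

end SchrodingerAiry

namespace SchrodingerAiry

set_option maxSynthPendingDepth 3
set_option synthInstance.maxHeartbeats 100000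

/-! ### Integrating a conservation law over a period -/

section Integration

theorem isOpen_timeInterval (T : EReal) : IsOpen (timeInterval T) :=
  (isOpen_lt continuous_const continuous_id).inter
    (isOpen_lt continuous_coe_real_ereal continuous_const)

theorem isPreconnected_timeInterval (T : EReal) : IsPreconnected (timeInterval T) :=
  OrdConnected.isPreconnected ⟨fun _ hx _ hy _ hz =>
    ⟨hx.1.trans_le hz.1, (EReal.coe_le_coe_iff.2 hz.2).trans_lt hy.2⟩⟩

/-- A conserved density with a periodic flux has a constant integral over a period. -/
theorem hasDerivAt_integral_of_conservation {I : Set ℝ} (hI : IsOpen I) {d q : ℝ × ℝ → ℝ} {L : ℝ}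
    (hd : ContDiffOn ℝ ∞ d (univ ×ˢ I)) (hq : ContDiffOn ℝ ∞ q (univ ×ˢ I))
    (hdq : ∀ z ∈ univ ×ˢ I, fderiv ℝ d z (0, 1) = fderiv ℝ q z (1, 0))
    (hper : ∀ t ∈ I, q (L, t) = q (0, t)) {t : ℝ} (ht : t ∈ I) :
    HasDerivAt (fun t' => ∫ x in (0 : ℝ)..L, d (x, t')) 0 t := by
  have hΩ : IsOpen ((univ : Set ℝ) ×ˢ I) := isOpen_univ.prod hI
  have hd' := ContDiffOn.fderiv_of_isOpen_infty hd hΩ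
  have hq' := ContDiffOn.fderiv_of_isOpen_infty hq hΩ
  have hline : ∀ {f : ℝ × ℝ → ℝ}, ContinuousOn f (univ ×ˢ I) → ∀ s ∈ I,
      Continuous fun x => f (x, s) := fun hf s hs =>
    hf.comp_continuous (by fun_prop) fun x => ⟨mem_univ x, hs⟩
  have hdt : ContinuousOn (fun z => fderiv ℝ d z (0, 1)) (univ ×ˢ I) :=
    (hd'.clm_apply contDiffOn_const).continuousOn
  have hqx : ContinuousOn (fun z => fderiv ℝ q z (1, 0)) (univ ×ˢ I) :=
    (hq'.clm_apply contDiffOn_const).continuousOn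
  -- On a compact time neighbourhood times the period, the continuous time derivative is bounded by
  -- a constant, which serves as the dominating function.
  obtain ⟨ε, hε, hball⟩ := Metric.nhds_basis_closedBall.mem_iff.1 (hI.mem_nhds ht)
  have hK : IsCompact (uIcc 0 L ×ˢ Metric.closedBall t ε) :=
    isCompact_uIcc.prod (isCompact_closedBall t ε)
  obtain ⟨C, hC⟩ := hK.exists_bound_of_continuousOn
    (hdt.mono (prod_mono (subset_univ _) hball))
  have key := (intervalIntegral.hasDerivAt_integral_of_dominated_loc_of_deriv_le
    (μ := MeasureTheory.volume) (a := 0) (b := L) (F := fun s x => d (x, s))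
    (F' := fun s x => fderiv ℝ d (x, s) (0, 1)) (x₀ := t) (bound := fun _ => C)
    (Metric.closedBall_mem_nhds t hε) ?_ ((hline hd.continuousOn t ht).intervalIntegrable 0 L)
    (hline hdt t ht).aestronglyMeasurable ?_ intervalIntegrable_const ?_).2
  · have h1 : ∫ x in (0 : ℝ)..L, fderiv ℝ d (x, t) (0, 1) = 0 := by
      -- The integral of ∂_x q is the difference of the endpoint values, zero by periodicity.
      have h2 : ∀ x ∈ uIcc 0 L, HasDerivAt (fun x => q (x, t)) (fderiv ℝ q (x, t) (1, 0)) x := by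
        intro x _
        have h3 := (ContDiffOn.differentiableAt_infty hq hΩ
          (show (x, t) ∈ univ ×ˢ I from ⟨mem_univ x, ht⟩)).hasFDerivAt
        have h4 := (h3.comp x (hasFDerivAt_prodMk_left (𝕜 := ℝ) x t)).hasDerivAt
        simpa using! h4
      have h5 := intervalIntegral.integral_eq_sub_of_hasDerivAt h2
        ((hline hqx t ht).intervalIntegrable 0 L)
      rw [hper t ht, sub_self] at h5
      refine Eq.trans ?_ h5
      exact intervalIntegral.integral_congr fun x _ => hdq (x, t) ⟨mem_univ x, ht⟩
    rwa [h1] at key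
  · filter_upwards [hI.mem_nhds ht] with s hs using (hline hd.continuousOn s hs).aestronglyMeasurable
  · refine Filter.Eventually.of_forall fun x hx s hs => hC (x, s) ⟨uIoc_subset_uIcc hx, hs⟩
  · refine Filter.Eventually.of_forall fun x _ s hs => ?_
    have h3 := (ContDiffOn.differentiableAt_infty hd hΩ
      (show (x, s) ∈ univ ×ˢ I from ⟨mem_univ x, hball hs⟩)).hasFDerivAt
    have h4 := (h3.comp s (hasFDerivAt_prodMk_right (𝕜 := ℝ) x s)).hasDerivAt
    simpa using! h4

end Integration

/-! ### Smoothness of inner products and of the curvature field -/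

section SmoothScalars

variable {E : Type*} [NormedAddCommGroup E] [NormedSpace ℝ E] [FiniteDimensional ℝ E]
  {M : Type*} [TopologicalSpace M] [ChartedSpace E M] [IsManifold 𝓘(ℝ, E) ∞ M]
  {h : ContMDiffRiemannianMetric 𝓘(ℝ, E) ∞ E (fun p : M => TangentSpace 𝓘(ℝ, E) p)}
  {J : ∀ p : M, TangentSpace 𝓘(ℝ, E) p →L[ℝ] TangentSpace 𝓘(ℝ, E) p}
  {U : ℝ × ℝ → M} {Ω : Set (ℝ × ℝ)} (hΩ : IsOpen Ω)
  (hU : ContMDiffOn 𝓘(ℝ, ℝ × ℝ) 𝓘(ℝ, E) ∞ U Ω)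
include hΩ hU

/-- Needed for the two terms of the energy separately, since each must be integrable before their
integrals are merged. -/
theorem contDiffOn_formAt {V W : ℝ × ℝ → E} (hV : IsSmoothField U Ω V) (hW : IsSmoothField U Ω W) :
    ContDiffOn ℝ ∞ (fun z => formAt h.inner (U z) (V z) (W z)) Ω := by
  intro z hz
  have hz' : z ∈ coordDomain E U Ω (U z) := ⟨hz, mem_extChartAt_source (I := 𝓘(ℝ, E)) (U z)⟩
  have h1 := ((isMetricOn_metricInChart h (U z)).contDiffOn_inner (contDiffOn_coordMap hU (U z))
    (mapsTo_coordMap (U z)) (hV (U z)) (hW (U z))).congr fun w hw =>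
      inner_eq_metricInChart h.inner hw.2 (V w) (W w)
  exact (h1.contDiffAt ((isOpen_coordDomain hΩ hU _).mem_nhds hz')).contDiffWithinAt

theorem isSmoothField_fieldCurv
    (hS : ∀ p : M, IsSymmetricKahlerOn (metricInChart 𝓘(ℝ, E) h.inner p)
      (complexStructureInChart 𝓘(ℝ, E) J p) (extChartAt 𝓘(ℝ, E) p).target) :
    IsSmoothField U Ω (fieldCurv h.inner J U) := fun p =>
  ((hS p).contDiffOn_coordCurv (isOpen_coordDomain hΩ hU p) (contDiffOn_coordMap hU p)
    (mapsTo_coordMap p)).congr (coordField_fieldCurv J hΩ hU h p)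

end SmoothScalars

/-! ### Splitting the flow and the energy over the factors -/

section ProductFlow

variable {n : ℕ} {E : Fin n → Type*} [∀ i, NormedAddCommGroup (E i)] [∀ i, NormedSpace ℝ (E i)]
  {M : Fin n → Type*} [∀ i, TopologicalSpace (M i)] [∀ i, ChartedSpace (E i) (M i)]
  {u : Circle → ℝ → ∀ i, M i} {T : EReal}

/-- The components of `u`, as maps of two real parameters. -/
noncomputable def component (u : Circle → ℝ → ∀ i, M i) (i : Fin n) (z : ℝ × ℝ) : M i :=
  u (Circle.exp z.1) z.2 i

theorem contMDiffOn_component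
    (hu : ContMDiffOn ((𝓡 1).prod 𝓘(ℝ, ℝ)) (productModel E) ∞
      (fun z : Circle × ℝ => u z.1 z.2) (univ ×ˢ timeInterval T)) (i : Fin n) :
    ContMDiffOn 𝓘(ℝ, ℝ × ℝ) 𝓘(ℝ, E i) ∞ (component u i) (univ ×ˢ timeInterval T) := by
  have h1 : ContMDiff 𝓘(ℝ, ℝ × ℝ) ((𝓡 1).prod 𝓘(ℝ, ℝ)) ∞
      (fun z : ℝ × ℝ => (Circle.exp z.1, z.2)) :=
    (contMDiff_circleExp.comp contDiff_fst.contMDiff).prodMk contDiff_snd.contMDiff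
  exact (ContMDiffOn.component hu i).comp h1.contMDiffOn fun z hz => ⟨mem_univ _, hz.2⟩

theorem component_add_period (i : Fin n) (z : ℝ × ℝ) :
    component u i (z + (2 * Real.pi, 0)) = component u i z := by
  simp [component, Circle.exp_add]

variable [∀ i, IsManifold 𝓘(ℝ, E i) ∞ (M i)]
  (hU : ∀ i, ContMDiffOn 𝓘(ℝ, ℝ × ℝ) 𝓘(ℝ, E i) ∞ (component u i) (univ ×ˢ timeInterval T))
  {t : ℝ} (ht : t ∈ timeInterval T) (x : ℝ)
include hU ht

theorem ux_product : ux (productModel E) (fun ξ => u ξ t) x =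
    (fun i => fieldUx (E i) (component u i) (x, t) : ∀ i, E i) :=
  velocity_product fun i => mdifferentiableAt_x (isOpen_univ.prod (isOpen_timeInterval T)) (hU i)
    (z := (x, t)) ⟨mem_univ x, ht⟩

theorem velocity_time_product :
    velocity (productModel E) (fun t' => u (Circle.exp x) t') t =
      (fun i => fieldUt (E i) (component u i) (x, t) : ∀ i, E i) :=
  velocity_product fun i => mdifferentiableAt_t (isOpen_univ.prod (isOpen_timeInterval T)) (hU i)
    (z := (x, t)) ⟨mem_univ x, ht⟩

variable [∀ i, FiniteDimensional ℝ (E i)]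
  (h : ∀ i, ContMDiffRiemannianMetric 𝓘(ℝ, E i) ∞ (E i) (fun p : M i => TangentSpace 𝓘(ℝ, E i) p))
  (J : ∀ i, ∀ p : M i, TangentSpace 𝓘(ℝ, E i) p →L[ℝ] TangentSpace 𝓘(ℝ, E i) p)

theorem covDerivAlong_product_of_isSmoothField {W : ∀ i, ℝ × ℝ → E i}
    (hW : ∀ i, IsSmoothField (component u i) (univ ×ˢ timeInterval T) (W i)) :
    covDerivAlong (productModel E) (productMetric fun i => (h i).inner)
      (fun x' => u (Circle.exp x') t) (fun x' => (fun i => W i (x', t) : ∀ i, E i)) x =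
      (fun i => fieldDx (h i).inner (component u i) (W i) (x, t) : ∀ i, E i) := by
  have hΩ : IsOpen ((univ : Set ℝ) ×ˢ timeInterval T) := isOpen_univ.prod (isOpen_timeInterval T)
  have hz : (x, t) ∈ (univ : Set ℝ) ×ˢ timeInterval T := ⟨mem_univ x, ht⟩
  refine covDerivAlong_product h (V := fun x' i => W i (x', t))
    (fun i => mdifferentiableAt_x hΩ (hU i) hz) fun i => ?_
  have h1 : DifferentiableAt ℝ (coordField (component u i) (W i) (component u i (x, t))) (x, t) :=
    ContDiffOn.differentiableAt_infty (hW i _) (isOpen_coordDomain hΩ (hU i) _)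
      ⟨hz, mem_extChartAt_source (I := 𝓘(ℝ, E i)) _⟩
  exact DifferentiableAt.comp x (f := fun x : ℝ => (x, t)) h1 (by fun_prop)

theorem nablaUx_product :
    nablaUx (productModel E) (productMetric fun i => (h i).inner) (fun ξ => u ξ t) x =
      (fun i => fieldDx (h i).inner (component u i) (fieldUx (E i) (component u i)) (x, t) :
        ∀ i, E i) := by
  have hΩ : IsOpen ((univ : Set ℝ) ×ˢ timeInterval T) := isOpen_univ.prod (isOpen_timeInterval T)
  have h1 : (ux (productModel E) (fun ξ => u ξ t) : ℝ → ∀ i, E i) =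
      fun x' i => fieldUx (E i) (component u i) (x', t) := funext fun x' => ux_product hU ht x'
  exact (congrArg (fun V : ℝ → ∀ i, E i => covDerivAlong (productModel E)
    (productMetric fun i => (h i).inner) (fun x' => u (Circle.exp x') t) V x) h1).trans
    (covDerivAlong_product_of_isSmoothField hU ht x h fun i => isSmoothField_fieldUx hΩ (hU i))

theorem nablaSqUx_product :
    nablaSqUx (productModel E) (productMetric fun i => (h i).inner) (fun ξ => u ξ t) x =
      (fun i => fieldDx (h i).inner (component u i)
        (fieldDx (h i).inner (component u i) (fieldUx (E i) (component u i))) (x, t) :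
          ∀ i, E i) := by
  have hΩ : IsOpen ((univ : Set ℝ) ×ˢ timeInterval T) := isOpen_univ.prod (isOpen_timeInterval T)
  have h1 : (nablaUx (productModel E) (productMetric fun i => (h i).inner) (fun ξ => u ξ t) :
      ℝ → ∀ i, E i) = fun x' i => fieldDx (h i).inner (component u i)
        (fieldUx (E i) (component u i)) (x', t) := funext fun x' => nablaUx_product hU ht x' h
  exact (congrArg (fun V : ℝ → ∀ i, E i => covDerivAlong (productModel E)
    (productMetric fun i => (h i).inner) (fun x' => u (Circle.exp x') t) V x) h1).trans
    (covDerivAlong_product_of_isSmoothField hU ht x h fun i =>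
      isSmoothField_fieldDx hΩ (hU i) (h i) (isSmoothField_fieldUx hΩ (hU i)))

theorem curvUx_product :
    curvUx (productModel E) (productMetric fun i => (h i).inner) (productComplexStructure J)
      (fun ξ => u ξ t) x =
      (fun i => fieldCurv (h i).inner (J i) (component u i) (x, t) : ∀ i, E i) := by
  exact (congrArg (fun v : ∀ i, E i => (curvature (productModel E)
    (productMetric fun i => (h i).inner) (u (Circle.exp x) t) v
    (productComplexStructure J (u (Circle.exp x) t) v)
    (productComplexStructure J (u (Circle.exp x) t) v) : ∀ i, E i)) (ux_product hU ht x)).trans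
    (curvature_product h _ _ _ _)

/-- Each component of a solution in the product solves the flow in its factor. -/
theorem fieldUt_component {α β : ℝ}
    (hu : IsSmoothSolution (productModel E) (productMetric fun i => (h i).inner)
      (productComplexStructure J) α β T u) (i : Fin n) :
    fieldUt (E i) (component u i) (x, t) =
      α • endoAt (J i) (component u i (x, t))
        (fieldDx (h i).inner (component u i) (fieldUx (E i) (component u i)) (x, t))
      + β • fieldAiry (h i).inner (J i) (component u i) (x, t) := by
  -- Naming the four vectors as elements of the model product allows all of them to be replaced at
  -- once by their componentwise forms, after which the equation is read in coordinate `i`.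
  have key : ∀ v a b c : ∀ i, E i,
      velocity (productModel E) (fun t' => u (Circle.exp x) t') t = v →
      nablaUx (productModel E) (productMetric fun i => (h i).inner) (fun ξ => u ξ t) x = a →
      nablaSqUx (productModel E) (productMetric fun i => (h i).inner) (fun ξ => u ξ t) x = b →
      curvUx (productModel E) (productMetric fun i => (h i).inner) (productComplexStructure J)
        (fun ξ => u ξ t) x = c →
      v = α • (fun i => endoAt (J i) (u (Circle.exp x) t i) (a i)) + β • (b + (1 / 2 : ℝ) • c) := by
    rintro _ _ _ _ rfl rfl rfl rfl
    exact hu.eqn t ht x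
  exact congrFun (key _ _ _ _ (velocity_time_product hU ht x) (nablaUx_product hU ht x h)
    (nablaSqUx_product hU ht x h) (curvUx_product hU ht x h J)) i

theorem energy3_product (hS : ∀ i, ∀ p : M i,
      IsSymmetricKahlerOn (metricInChart 𝓘(ℝ, E i) (h i).inner p)
        (complexStructureInChart 𝓘(ℝ, E i) (J i) p) (extChartAt 𝓘(ℝ, E i) p).target) :
    energy3 (productModel E) (productMetric fun i => (h i).inner) (productComplexStructure J)
      (fun ξ => u ξ t) =
    ∫ x in (0 : ℝ)..(2 * Real.pi), ∑ i, density (h i).inner (J i) (component u i) (x, t) := by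
  have hΩ : IsOpen ((univ : Set ℝ) ×ˢ timeInterval T) := isOpen_univ.prod (isOpen_timeInterval T)
  have h1 : ∀ x, productMetric (fun i => (h i).inner) (u (Circle.exp x) t)
      (nablaUx (productModel E) (productMetric fun i => (h i).inner) (fun ξ => u ξ t) x)
      (nablaUx (productModel E) (productMetric fun i => (h i).inner) (fun ξ => u ξ t) x) =
      ∑ i, formAt (h i).inner (component u i (x, t))
        (fieldDx (h i).inner (component u i) (fieldUx (E i) (component u i)) (x, t))
        (fieldDx (h i).inner (component u i) (fieldUx (E i) (component u i)) (x, t)) := by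
    intro x
    exact (congrArg (fun v : ∀ i, E i => (productMetric (fun i => (h i).inner)
      (u (Circle.exp x) t) : (∀ i, E i) →L[ℝ] (∀ i, E i) →L[ℝ] ℝ) v v)
      (nablaUx_product hU ht x h)).trans (productMetric_apply _ _ _)
  have h2 : ∀ x, productMetric (fun i => (h i).inner) (u (Circle.exp x) t)
      (ux (productModel E) (fun ξ => u ξ t) x)
      (curvUx (productModel E) (productMetric fun i => (h i).inner) (productComplexStructure J)
        (fun ξ => u ξ t) x) =
      ∑ i, formAt (h i).inner (component u i (x, t)) (fieldUx (E i) (component u i) (x, t))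
        (fieldCurv (h i).inner (J i) (component u i) (x, t)) := by
    intro x
    exact (congrArg₂ (fun v w : ∀ i, E i => (productMetric (fun i => (h i).inner)
      (u (Circle.exp x) t) : (∀ i, E i) →L[ℝ] (∀ i, E i) →L[ℝ] ℝ) v w)
      (ux_product hU ht x) (curvUx_product hU ht x h J)).trans (productMetric_apply _ _ _)
  have hcont : ∀ {f : ℝ × ℝ → ℝ}, ContDiffOn ℝ ∞ f ((univ : Set ℝ) ×ˢ timeInterval T) →
      Continuous fun x => f (x, t) := fun hf =>
    hf.continuousOn.comp_continuous (by fun_prop) fun x => ⟨mem_univ x, ht⟩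
  have hX := fun i => isSmoothField_fieldUx hΩ (hU i)
  have hDX := fun i => isSmoothField_fieldDx hΩ (hU i) (h i) (hX i)
  have hR := fun i => isSmoothField_fieldCurv hΩ (hU i) (hS i)
  rw [energy3]
  simp only [h1, h2]
  -- The energy is a difference of two integrals; merging them needs integrability, which follows
  -- from continuity in `x`.
  rw [← intervalIntegral.integral_const_mul, ← intervalIntegral.integral_sub]
  · refine intervalIntegral.integral_congr fun x _ => ?_
    simp only [density, Finset.mul_sum, Finset.sum_sub_distrib]
  · exact (continuous_finsetSum _ fun i _ =>
      hcont (contDiffOn_formAt hΩ (hU i) (hDX i) (hDX i))).intervalIntegrable _ _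
  · exact (continuous_const.mul (continuous_finsetSum _ fun i _ =>
      hcont (contDiffOn_formAt hΩ (hU i) (hX i) (hR i)))).intervalIntegrable _ _

end ProductFlow

end SchrodingerAiry

/-! ### Conservation of the energy -/

theorem corollary3p5 {n : ℕ}
    {E : Fin n → Type*} [∀ i, NormedAddCommGroup (E i)] [∀ i, NormedSpace ℝ (E i)]
    [∀ i, FiniteDimensional ℝ (E i)]
    {M : Fin n → Type*} [∀ i, TopologicalSpace (M i)] [∀ i, ChartedSpace (E i) (M i)]
    [∀ i, IsManifold 𝓘(ℝ, E i) ∞ (M i)]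
    (h : ∀ i, ContMDiffRiemannianMetric 𝓘(ℝ, E i) ∞ (E i)
      (fun p : M i => TangentSpace 𝓘(ℝ, E i) p))
    (J : ∀ i, ∀ p : M i, TangentSpace 𝓘(ℝ, E i) p →L[ℝ] TangentSpace 𝓘(ℝ, E i) p)
    (hsymm : ∀ i, SchrodingerAiry.IsLocallyHermitianSymmetric 𝓘(ℝ, E i) (h i) (J i))
    (hcurv : ∀ i, ∀ (p : M i) (X Y : TangentSpace 𝓘(ℝ, E i) p),
      (h i).inner p
        (SchrodingerAiry.curvature 𝓘(ℝ, E i) (h i).inner p Y X X)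
        (SchrodingerAiry.curvature 𝓘(ℝ, E i) (h i).inner p X (J i p X) (J i p X)) = 0)
    {α β : ℝ} (hα : 0 < α) (hβ : 0 < β) (T : EReal) (u : Circle → ℝ → (∀ i, M i))
    (hu : SchrodingerAiry.IsSmoothSolution (SchrodingerAiry.productModel E)
      (SchrodingerAiry.productMetric fun i => (h i).inner)
      (SchrodingerAiry.productComplexStructure J) α β T u) :
    (∀ t ∈ SchrodingerAiry.timeInterval T,
      HasDerivAt (fun t' => SchrodingerAiry.energy3 (SchrodingerAiry.productModel E)
        (SchrodingerAiry.productMetric fun i => (h i).inner)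
        (SchrodingerAiry.productComplexStructure J) (fun ξ => u ξ t')) 0 t) ∧
    (∀ s ∈ SchrodingerAiry.timeInterval T, ∀ t ∈ SchrodingerAiry.timeInterval T,
      SchrodingerAiry.energy3 (SchrodingerAiry.productModel E)
        (SchrodingerAiry.productMetric fun i => (h i).inner)
        (SchrodingerAiry.productComplexStructure J) (fun ξ => u ξ s) =
      SchrodingerAiry.energy3 (SchrodingerAiry.productModel E)
        (SchrodingerAiry.productMetric fun i => (h i).inner)
        (SchrodingerAiry.productComplexStructure J) (fun ξ => u ξ t)) := by
  have hS := fun i => SchrodingerAiry.isSymmetricKahlerOn_inChart (hsymm i) (hcurv i)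
  have hU := SchrodingerAiry.contMDiffOn_component hu.smooth
  have hI := SchrodingerAiry.isOpen_timeInterval T
  have hΩ : IsOpen ((univ : Set ℝ) ×ˢ SchrodingerAiry.timeInterval T) := isOpen_univ.prod hI
  have hd := fun i => SchrodingerAiry.contDiffOn_density hΩ (hU i) (hS i)
  have hq := fun i => SchrodingerAiry.contDiffOn_flux hΩ (hU i) (hS i) α β
  have hderiv : ∀ t ∈ SchrodingerAiry.timeInterval T,
      HasDerivAt (fun t' => SchrodingerAiry.energy3 (SchrodingerAiry.productModel E)
        (SchrodingerAiry.productMetric fun i => (h i).inner)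
        (SchrodingerAiry.productComplexStructure J) (fun ξ => u ξ t')) 0 t := by
    intro t ht
    -- The density and flux of the product are the sums over the factors, and the conservation law
    -- holds term by term.
    refine (SchrodingerAiry.hasDerivAt_integral_of_conservation hI (L := 2 * Real.pi)
      (d := fun z => ∑ i, SchrodingerAiry.density (h i).inner (J i)
        (SchrodingerAiry.component u i) z)
      (q := fun z => ∑ i, SchrodingerAiry.flux (h i).inner (J i)
        (SchrodingerAiry.component u i) α β z)
      (ContDiffOn.sum fun i _ => hd i) (ContDiffOn.sum fun i _ => hq i) (fun z hz => ?_)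
      (fun s hs => ?_) ht).congr_of_eventuallyEq ?_
    · have hdz := fun i => SchrodingerAiry.ContDiffOn.differentiableAt_infty (hd i) hΩ hz
      have hqz := fun i => SchrodingerAiry.ContDiffOn.differentiableAt_infty (hq i) hΩ hz
      rw [fderiv_fun_sum fun i _ => hdz i, fderiv_fun_sum fun i _ => hqz i, sum_apply, sum_apply]
      exact Finset.sum_congr rfl fun i _ =>
        SchrodingerAiry.fderiv_density_eq_fderiv_flux hΩ (hU i) (hS i) α β
          (fun w hw => SchrodingerAiry.fieldUt_component hU hw.2 w.1 h J hu i) hz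
    · refine Finset.sum_congr rfl fun i _ => ?_
      have hp := SchrodingerAiry.flux_add_period (J := J i) (h := h i) hΩ (hU i) α β
        (c := (2 * Real.pi, 0)) (z := (0, s)) (SchrodingerAiry.component_add_period i)
        ⟨mem_univ _, hs⟩ (by simpa using hs)
      simpa using hp
    · filter_upwards [hI.mem_nhds ht] with s hs using
        SchrodingerAiry.energy3_product hU hs h J hS
  refine ⟨hderiv, fun s hs t ht => ?_⟩
  -- The time interval is open and connected, so zero derivative gives constancy.
  exact hI.is_const_of_deriv_eq_zero (SchrodingerAiry.isPreconnected_timeInterval T)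
    (fun r hr => (hderiv r hr).differentiableAt.differentiableWithinAt)
    (fun r hr => (hderiv r hr).deriv) hs ht
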